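/- Let $p>2$ be a prime and let $\mathbb F$ be an algebraically closed field of characteristic $p$. Let $\mathfrak g$ be a finite-dimensional $\mathbb F$-vector space with a non-degenerate symmetric bilinear form $\langle\cdot,\cdot\rangle$, regarded as a purely odd abelian Lie superalgebra, and let $\ell\in\mathbb F$ be nonzero. Let $\widehat{\mathfrak g}=\mathfrak g\otimes\mathbb F[t,t^{-1}]\oplus\mathbb F\mathbf k$ be the Lie superalgebra with odd part $\mathfrak g\otimes\mathbb F[t,t^{-1}]$, even central element $\mathbf k$ and superbracket $[a\otimes t^m,b\otimes t^n]=\langle a,b\rangle\delta_{m+n+1,0}\mathbf k$. Let $V=V_{\widehat{\mathfrak g}}(\ell,0)$ be the quotient of $U(\widehat{\mathfrak g})$ by the left ideal generated by $\mathbf k-\ell$ and all $a\otimes t^n$ with $a\in\mathfrak g$, $n\ge 0$, let $\mathbf 1\in V$ be the image of $1$, and identify $a\in\mathfrak g$ with $(a\otimes t^{-1})\mathbf 1\in V$. On $V$, with its natural $\mathbb Z_2$-grading, there is a unique vertex superalgebra structure with vacuum vector $\mathbf 1$ and $Y(a,x)=\sum_{n\in\mathbb Z}(a\otimes t^n)x^{-n-1}$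 for all $a\in\mathfrak g$ (the modular Clifford vertex superalgebra). Let $\tau$ be a linear automorphism of $\mathfrak g$ preserving $\langle\cdot,\cdot\rangle$, let $T$ be a positive integer prime to $p$ with $\tau^T=1$, let $\eta\in\mathbb F$ be a primitive $T$-th root of unity, and put $\mathfrak g_i=\{a\in\mathfrak g\mid\tau a=\eta^i a\}$. Denote again by $\tau$ the induced automorphism of $V$, which fixes $\mathbf 1$ and sends $(a^1\otimes t^{n_1})\cdots(a^k\otimes t^{n_k})\mathbf 1$ to $(\tau a^1\otimes t^{n_1})\cdots(\tau a^k\otimes t^{n_k})\mathbf 1$. A $\tau$-twisted $V$-module is a vector space $W$ (not necessarily $\mathbb Z_2$-graded) with a linear map $Y_W(\cdot,x)\colon V\to(\operatorname{End}W)[[x^{1/T},x^{-1/T}]]$, $Y_W(u,x)=\sum_{n\in\frac1T\mathbb Z}u_nx^{-n-1}$, such that $Y_W(\mathbf 1,x)=1_W$ and, for all $w\in W$, $0\le r<T$, all $\mathbb Z_2$-homogeneous $u\in V$ with $\tau u=\eta^r u$ and all $\mathbb Z_2$-homogeneous $v\in V$: $u_n=0$ unless $n\in\frac rT+\mathbb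 Z$; $u_nw=0$ for all sufficiently large $n$; and $$x_0^{-1}\delta\Bigl(\frac{x_1-x_2}{x_0}\Bigr)Y_W(u,x_1)Y_W(v,x_2)-(-1)^{|u||v|}x_0^{-1}\delta\Bigl(\frac{x_2-x_1}{-x_0}\Bigr)Y_W(v,x_2)Y_W(u,x_1)=x_2^{-1}\delta\Bigl(\frac{x_1-x_0}{x_2}\Bigr)\Bigl(\frac{x_1-x_0}{x_2}\Bigr)^{-r/T}Y_W(Y(u,x_0)v,x_2),$$ where binomials are expanded in nonnegative powers of the second variable and the binomial coefficients $\binom{\alpha}{i}$, $\alpha\in\frac1T\mathbb Z$, are reduced modulo $p$. Then: (i) If $T$ is odd, or if $T$ is even and $\dim\mathfrak g_{T/2}$ is even, then $V$ has, up to isomorphism, exactly one irreducible $\tau$-twisted module. (ii) If $T$ is even and $\dim\mathfrak g_{T/2}$ is odd, then $V$ has, up to isomorphism, exactly two irreducible $\tau$-twisted modules. (iii) Every $\tau$-twisted $V$-module is completely reducible, that is, a direct sum of irreducible submodules. -/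

import Mathlib

open scoped TensorProduct LaurentPolynomial

universe u v w w'

noncomputable section

namespace ModularClifford

/-! ### Vertex superalgebras and twisted modules over a field -/

section General

variable {F : Type u} [Field F]

/-- The binomial coefficient `α (α - 1) ⋯ (α - i + 1) / i !` of a rational number `α`. -/
def ratBinom (α : ℚ) (i : ℕ) : ℚ :=
  (∏ j ∈ Finset.range i, (α - (j : ℚ))) / (i.factorial : ℚ)

variable (F) in
/-- The binomial coefficient of `α`, regarded as an element of `F` by reducing numerator and
denominator. If `F` has characteristic `p` and the denominator of `α` is prime to `p`, then so is
the denominator of `ratBinom α i`, and this is its image under the ring homomorphism from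
`{m / n | p ∤ n}` to `F`. -/
def binom (α : ℚ) (i : ℕ) : F := ((ratBinom α i : ℚ) : F)

variable (F) in
/-- `(-1) ^ (|u| |v|)` for parities `|u| = α` and `|v| = β`. -/
def superSign (α β : ZMod 2) : F := if α = 1 ∧ β = 1 then -1 else 1

/-- The coefficient of `x₀ ^ (-l - 1) x₁ ^ (-m / T - 1) x₂ ^ (-n / T - 1)` in the (twisted) Jacobi
identity
`x₀⁻¹ δ((x₁ - x₂) / x₀) Y_W(u, x₁) Y_W(v, x₂) - ε x₀⁻¹ δ((x₂ - x₁) / (- x₀)) Y_W(v, x₂) Y_W(u, x₁)`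
`  = x₂⁻¹ δ((x₁ - x₀) / x₂) ((x₁ - x₀) / x₂) ^ (- r / T) Y_W(Y(u, x₀) v, x₂)`
applied to `x : W`, where `m ≡ r` mod `T`, `Y(u, x) = ∑ (Y u k) x ^ (-k - 1)` on `V`, and
`Y_W(u, x) = ∑ (YW u k) x ^ (-k / T - 1)` on `W`. Under the truncation conditions
the three sums are finite. -/
def JacobiCoeff {V : Type v} [AddCommGroup V] [Module F V] {W : Type w} [AddCommGroup W]
    [Module F W] (T : ℕ) (Y : V →ₗ[F] (ℤ → Module.End F V)) (YW : V →ₗ[F] (ℤ → Module.End F W))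
    (ε : F) (u v : V) (l m n : ℤ) (x : W) : Prop :=
  (∑ᶠ i : ℕ, ((-1 : F) ^ i * binom F (l : ℚ) i) •
      YW u (m + (l - (i : ℤ)) * (T : ℤ)) (YW v (n + (i : ℤ) * (T : ℤ)) x))
    - ε • (∑ᶠ i : ℕ, ((-1 : F) ^ l * ((-1 : F) ^ i * binom F (l : ℚ) i)) •
      YW v (n + (l - (i : ℤ)) * (T : ℤ)) (YW u (m + (i : ℤ) * (T : ℤ)) x))
  = ∑ᶠ i : ℕ, binom F ((m : ℚ) / (T : ℚ)) i •
      YW (Y u (l + (i : ℤ)) v) (m + n - (i : ℤ) * (T : ℤ)) x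

variable (F) in
/-- A vertex superalgebra structure on the vector space `V`; `Y u n` is the mode `u_n`, so that
`Y(u, x) = ∑ (Y u n) x ^ (-n - 1)`. -/
@[ext]
structure VertexSuperalgebra (V : Type v) [AddCommGroup V] [Module F V] where
  /-- the even (`0`) and the odd (`1`) part -/
  parity : ZMod 2 → Submodule F V
  /-- the vacuum vector -/
  vac : V
  /-- the modes of the vertex operators -/
  Y : V →ₗ[F] (ℤ → Module.End F V)
  isInternal : DirectSum.IsInternal parity
  vac_mem : vac ∈ parity 0
  parity_mode : ∀ (α β : ZMod 2), ∀ u ∈ parity α, ∀ v ∈ parity β, ∀ n : ℤ,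
    Y u n v ∈ parity (α + β)
  truncation : ∀ u v : V, ∃ N : ℤ, ∀ n ≥ N, Y u n v = 0
  vacuum : ∀ n : ℤ, Y vac n = if n = -1 then 1 else 0
  creation : ∀ (u : V) (n : ℤ), 0 ≤ n → Y u n vac = 0
  creation' : ∀ u : V, Y u (-1) vac = u
  jacobi : ∀ (α β : ZMod 2), ∀ u ∈ parity α, ∀ v ∈ parity β, ∀ (l m n : ℤ) (x : V),
    JacobiCoeff 1 Y Y (superSign F α β) u v l m n x

/-- A `g`-twisted module structure on the vector space `W`, for an automorphism `g` of a vertex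
superalgebra with `g ^ T = 1` and a primitive `T`-th root of unity `η`; the mode `u_{k / T}` is
`YW u k`, so that `Y_W(u, x) = ∑ (YW u k) x ^ (-k / T - 1)`. -/
structure TwistedModule {V : Type v} [AddCommGroup V] [Module F V] (𝒱 : VertexSuperalgebra F V)
    (g : Module.End F V) (T : ℕ) (η : F) (W : Type w) [AddCommGroup W] [Module F W] where
  /-- the modes of the twisted vertex operators -/
  YW : V →ₗ[F] (ℤ → Module.End F W)
  support : ∀ r < T, ∀ u ∈ g.eigenspace (η ^ r), ∀ k : ℤ,
    ¬ k ≡ (r : ℤ) [ZMOD (T : ℤ)] → YW u k = 0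
  truncation : ∀ (u : V) (x : W), ∃ N : ℤ, ∀ k ≥ N, YW u k x = 0
  vacuum : ∀ k : ℤ, YW 𝒱.vac k = if k = -(T : ℤ) then 1 else 0
  jacobi : ∀ r < T, ∀ (α β : ZMod 2), ∀ u ∈ 𝒱.parity α, u ∈ g.eigenspace (η ^ r) →
    ∀ v ∈ 𝒱.parity β, ∀ l m n : ℤ, m ≡ (r : ℤ) [ZMOD (T : ℤ)] → ∀ x : W,
      JacobiCoeff T 𝒱.Y YW (superSign F α β) u v l m n x

namespace TwistedModule

variable {V : Type v} [AddCommGroup V] [Module F V] {𝒱 : VertexSuperalgebra F V}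
  {g : Module.End F V} {T : ℕ} {η : F}
  {W : Type w} [AddCommGroup W] [Module F W] {W' : Type w'} [AddCommGroup W'] [Module F W']

/-- `N` is a submodule of the twisted module `M`. -/
def IsSub (M : TwistedModule 𝒱 g T η W) (N : Submodule F W) : Prop :=
  ∀ (u : V) (k : ℤ), ∀ x ∈ N, M.YW u k x ∈ N

/-- `N` is an irreducible submodule of the twisted module `M`. -/
def IsIrreducibleSub (M : TwistedModule 𝒱 g T η W) (N : Submodule F W) : Prop :=
  M.IsSub N ∧ N ≠ ⊥ ∧ ∀ N' ≤ N, M.IsSub N' → N' = ⊥ ∨ N' = N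

/-- `M` is an irreducible twisted module. -/
def IsIrreducible (M : TwistedModule 𝒱 g T η W) : Prop :=
  M.IsIrreducibleSub ⊤

/-- `M` is a direct sum of irreducible submodules. -/
def IsCompletelyReducible (M : TwistedModule 𝒱 g T η W) : Prop :=
  ∃ (ι : Type w) (N : ι → Submodule F W),
    (∀ i, M.IsIrreducibleSub (N i)) ∧ iSupIndep N ∧ ⨆ i, N i = ⊤

/-- `M` and `M'` are isomorphic twisted modules. -/
def Isomorphic (M : TwistedModule 𝒱 g T η W) (M' : TwistedModule 𝒱 g T η W') : Prop :=
  ∃ f : W ≃ₗ[F] W', ∀ (u : V) (k : ℤ) (x : W), f (M.YW u k x) = M'.YW u k (f x)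

end TwistedModule

end General

/-! ### The Clifford vertex superalgebra -/

section Clifford

variable {F : Type u} [Field F] {U : Type v} [AddCommGroup U] [Module F U]

variable (F U) in
/-- The underlying space `U ⊗ F[t, t⁻¹] ⊕ F 𝐤` of the affine Lie superalgebra of the purely odd
abelian Lie superalgebra `U`; the first summand is odd and the second one is even. -/
abbrev Affine : Type (max u v) := (U ⊗[F] F[T;T⁻¹]) × F

/-- The element `a ⊗ t ^ n`. -/
def loop (a : U) (n : ℤ) : Affine F U := (a ⊗ₜ[F] LaurentPolynomial.T n, 0)

variable (F U) in
/-- The central element `𝐤`. -/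
def central : Affine F U := (0, 1)

/-- The relations `x y - (-1) ^ (|x| |y|) y x = [x, y]` of the universal enveloping algebra, for
the superbracket `[a ⊗ t ^ m, b ⊗ t ^ n] = ⟨a, b⟩ δ_{m + n + 1, 0} 𝐤` with `𝐤` even and
central. -/
inductive EnvRel (B : LinearMap.BilinForm F U) :
    TensorAlgebra F (Affine F U) → TensorAlgebra F (Affine F U) → Prop
  | odd (a b : U) (m n : ℤ) :
      EnvRel B
        (TensorAlgebra.ι F (loop a m) * TensorAlgebra.ι F (loop b n)
          + TensorAlgebra.ι F (loop b n) * TensorAlgebra.ι F (loop a m))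
        ((if m + n + 1 = 0 then B a b else 0) • TensorAlgebra.ι F (central F U))
  | central (a : U) (m : ℤ) :
      EnvRel B
        (TensorAlgebra.ι F (central F U) * TensorAlgebra.ι F (loop a m))
        (TensorAlgebra.ι F (loop a m) * TensorAlgebra.ι F (central F U))

/-- The universal enveloping algebra of the affine Lie superalgebra. -/
abbrev Env (B : LinearMap.BilinForm F U) : Type (max u v) := RingQuot (EnvRel B)

/-- The canonical map from the affine Lie superalgebra to its universal enveloping algebra. -/
def toEnv (B : LinearMap.BilinForm F U) : Affine F U →ₗ[F] Env B :=
  (RingQuot.mkAlgHom F (EnvRel B)).toLinearMap ∘ₗ TensorAlgebra.ι F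

/-- The element `a_n = a ⊗ t ^ n` of the universal enveloping algebra. -/
def mode (B : LinearMap.BilinForm F U) (a : U) (n : ℤ) : Env B := toEnv B (loop a n)

/-- The left ideal generated by the elements `a ⊗ t ^ n` with `n ≥ 0` and by `𝐤 - ℓ`. -/
def vacIdeal (B : LinearMap.BilinForm F U) (ℓ : F) : Submodule (Env B) (Env B) :=
  Submodule.span (Env B)
    ({x | ∃ (a : U) (n : ℤ), 0 ≤ n ∧ x = mode B a n} ∪
      {toEnv B (central F U) - algebraMap F (Env B) ℓ})

/-- The vacuum module of level `ℓ`, induced from the one-dimensional module on which `a ⊗ t ^ n`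
acts as `0` for `n ≥ 0` and `𝐤` acts as `ℓ`. -/
abbrev VacuumModule (B : LinearMap.BilinForm F U) (ℓ : F) : Type (max u v) :=
  Env B ⧸ vacIdeal B ℓ

/-- The vacuum vector `𝟏 = 1 ⊗ 1`. -/
def vacuumVector (B : LinearMap.BilinForm F U) (ℓ : F) : VacuumModule B ℓ :=
  Submodule.Quotient.mk 1

/-- The parity of the vacuum module: `a¹_{n₁} ⋯ aᵏ_{nₖ} 𝟏` has the parity of `k`. -/
def vacuumParity (B : LinearMap.BilinForm F U) (ℓ : F) (i : ZMod 2) :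
    Submodule F (VacuumModule B ℓ) :=
  Submodule.span F {x | ∃ L : List (U × ℤ), (L.length : ZMod 2) = i ∧
    x = (L.map fun q => mode B q.1 q.2).prod • vacuumVector B ℓ}

/-- The vertex superalgebra structure `𝒱` on the vacuum module has vacuum vector `𝟏`, its parity is
the natural one, and `Y(a, x) = ∑ (a ⊗ t ^ n) x ^ (-n - 1)` for `a ∈ U`, where `a` is identified
with `a_{-1} 𝟏`. -/
structure IsCliffordStructure (B : LinearMap.BilinForm F U) (ℓ : F)
    (𝒱 : VertexSuperalgebra F (VacuumModule B ℓ)) : Prop where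
  parity_eq : 𝒱.parity = vacuumParity B ℓ
  vac_eq : 𝒱.vac = vacuumVector B ℓ
  field_eq : ∀ (a : U) (n : ℤ) (x : VacuumModule B ℓ),
    𝒱.Y (mode B a (-1) • vacuumVector B ℓ) n x = mode B a n • x

/-- The linear map `a ⊗ t ^ n ↦ τ a ⊗ t ^ n`, `𝐤 ↦ 𝐤`. -/
def affineMap (τ : U ≃ₗ[F] U) : Affine F U →ₗ[F] Affine F U :=
  LinearMap.prodMap (LinearMap.rTensor F[T;T⁻¹] τ.toLinearMap) LinearMap.id

theorem affineMap_loop (τ : U ≃ₗ[F] U) (a : U) (n : ℤ) :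
    affineMap τ (loop a n) = loop (τ a) n := by
  simp [affineMap, loop]

theorem affineMap_central (τ : U ≃ₗ[F] U) :
    affineMap τ (central F U) = central F U := by
  simp [affineMap, central]

theorem toEnv_odd (B : LinearMap.BilinForm F U) (a b : U) (m n : ℤ) :
    mode B a m * mode B b n + mode B b n * mode B a m
      = (if m + n + 1 = 0 then B a b else 0) • toEnv B (central F U) := by
  have h := RingQuot.mkAlgHom_rel F (EnvRel.odd (B := B) a b m n)
  simp only [map_add, map_mul, map_smul] at h
  exact h

theorem toEnv_central (B : LinearMap.BilinForm F U) (a : U) (m : ℤ) :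
    toEnv B (central F U) * mode B a m = mode B a m * toEnv B (central F U) := by
  have h := RingQuot.mkAlgHom_rel F (EnvRel.central (B := B) a m)
  simp only [map_mul] at h
  exact h

/-- The automorphism of the universal enveloping algebra induced by an isometry `τ` of `U`. -/
def envMap (B : LinearMap.BilinForm F U) (τ : U ≃ₗ[F] U) (hτ : ∀ a b, B (τ a) (τ b) = B a b) :
    Env B →ₐ[F] Env B :=
  RingQuot.liftAlgHom F ⟨TensorAlgebra.lift F (toEnv B ∘ₗ affineMap τ), by
    intro x y h
    induction h with
    | odd a b m n =>
      have h1 := toEnv_odd B (τ a) (τ b) m n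
      simp only [mode, hτ] at h1
      simp only [map_add, map_mul, map_smul, TensorAlgebra.lift_ι_apply, LinearMap.comp_apply,
        affineMap_loop, affineMap_central]
      exact h1
    | central a m =>
      have h1 := toEnv_central B (τ a) m
      simp only [mode] at h1
      simpa [affineMap_loop, affineMap_central] using h1⟩

theorem envMap_toEnv (B : LinearMap.BilinForm F U) (τ : U ≃ₗ[F] U)
    (hτ : ∀ a b, B (τ a) (τ b) = B a b) (x : Affine F U) :
    envMap B τ hτ (toEnv B x) = toEnv B (affineMap τ x) := by
  simp [envMap, toEnv]

theorem envMap_mem (B : LinearMap.BilinForm F U) (ℓ : F) (τ : U ≃ₗ[F] U)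
    (hτ : ∀ a b, B (τ a) (τ b) = B a b) (x : Env B) (hx : x ∈ vacIdeal B ℓ) :
    envMap B τ hτ x ∈ vacIdeal B ℓ := by
  induction hx using Submodule.span_induction with
  | mem x hx =>
    rcases hx with ⟨a, n, hn, rfl⟩ | hx
    · rw [mode, envMap_toEnv, affineMap_loop]
      exact Submodule.subset_span (Or.inl ⟨τ a, n, hn, rfl⟩)
    · rw [Set.mem_singleton_iff] at hx
      subst hx
      rw [map_sub, envMap_toEnv, affineMap_central, AlgHom.commutes]
      exact Submodule.subset_span (Or.inr rfl)
  | zero => simp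
  | add x y _ _ hx hy => rw [map_add]; exact add_mem hx hy
  | smul c x _ hx =>
    rw [smul_eq_mul, map_mul]
    exact Submodule.smul_mem _ _ hx

/-- The linear map induced by an isometry `τ` of `U` on the vacuum module; it sends
`a¹_{n₁} ⋯ aᵏ_{nₖ} 𝟏` to `(τ a¹)_{n₁} ⋯ (τ aᵏ)_{nₖ} 𝟏`. -/
def vacuumMap (B : LinearMap.BilinForm F U) (ℓ : F) (τ : U ≃ₗ[F] U)
    (hτ : ∀ a b, B (τ a) (τ b) = B a b) : Module.End F (VacuumModule B ℓ) :=
  ((vacIdeal B ℓ).restrictScalars F).mapQ ((vacIdeal B ℓ).restrictScalars F)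
    (envMap B τ hτ).toLinearMap fun x hx => envMap_mem B ℓ τ hτ x hx

theorem vacuumMap_mk (B : LinearMap.BilinForm F U) (ℓ : F) (τ : U ≃ₗ[F] U)
    (hτ : ∀ a b, B (τ a) (τ b) = B a b) (x : Env B) :
    vacuumMap B ℓ τ hτ (Submodule.Quotient.mk x) = Submodule.Quotient.mk (envMap B τ hτ x) :=
  rfl

end Clifford

end ModularClifford

end

open ModularClifford

/-! A twisted module is determined by the fields of the generating vectors, and these fields only
have to satisfy anticommutation relations. The theorem therefore splits into a dictionary between
twisted modules and mode representations, and a classification of representations of an infinite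
Clifford algebra.

Dictionary. Binomials of `m / T` are images of elements of `ℤ_[p]`, a binomial ring in which `T` is
invertible, so the usual binomial identities hold without division by factorials. If the fields `A`
and `φ` are local, the Jacobi identity can be solved for the product fields `A_l φ`
(`exists_isProd`), and the solution is unique (`IsProd.unique`). Comparing three fields
(`IsProd.finsum_jl_eq`) yields Dong's lemma and the commutator formula for products (`IsProd.comm`).
Hence the operators `φ ↦ (A_j)_n φ` on the space of fields local to all `A_j` again satisfy the
affine relations, and for `n ≥ 0` they kill the identity field. The universal property of the vacuum
module turns this into a map from `V` to fields (`exists_isFieldMap`). The Jacobi identity for two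
arbitrary vectors follows by induction on the second one (`IsVertexMap.isProd`); its base case is
that `u_{-1-t} 𝟏` acts by a divided power derivative of the field of `u`. For `T = 1` this
constructs the vertex superalgebra itself; for general `T` it constructs twisted modules. Submodules
and isomorphisms can be tested on generators.

Classification. There is a basis `f` of eigenvectors of `τ` with an involution `σ` such that `f i`
pairs to `1` with `f (σ i)` and to `0` with the others, and at most one `σ`-fixed vector has
eigenvalue `-1` (`exists_isDualSystem`). The mode `(j, k)` is conjugate to `(σ j, -T - k)`. A mode
is its own conjugate only if `σ j = j` and `2 k = -T`, which forces eigenvalue `-1`; a parity count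
shows that such a mode exists exactly if `T` is even and the `-1`-eigenspace has odd dimension
(`IsDualSystem.odd_finrank_iff`). The other modes split into annihilation and creation operators. By
truncation, all but finitely many annihilation operators kill a given vector, so a stable subspace
is generated by its vacuum vectors (`IsFermion.eq_generated`), and generating creates no new ones
(`IsFermion.generated_inf`). Submodules thus correspond to subspaces of the vacuum space stable
under an involution `z`: the normalized self-conjugate mode, or `1` if there is none. Diagonalizing
`z` gives complete reducibility. Irreducible modules have a one-dimensional vacuum space and are
classified by the eigenvalue of `z` on it: only `1` without a self-conjugate mode, and `1` and `-1`
with one. All cases are realized on an exterior algebra. -/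

noncomputable section

namespace ModularClifford

/-! ### Binomial coefficients of a binomial ring, reduced to the field -/

section Binomials

open Finset

variable {F : Type u} [Field F] {R : Type*} [CommRing R] [BinomialRing R] (χ : R →+* F)

/-- The image in `F` of a binomial coefficient of a binomial ring. -/
def bc (x : R) (i : ℕ) : F := χ (Ring.choose x i)

@[simp] theorem bc_zero (x : R) : bc χ x 0 = 1 := by simp [bc]

theorem bc_zero_left (i : ℕ) : bc χ 0 i = if i = 0 then 1 else 0 := by
  rw [bc, Ring.choose_zero_ite]; split_ifs <;> simp

theorem bc_natCast (n i : ℕ) : bc χ (n : R) i = (n.choose i : F) := by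
  simp [bc, Ring.choose_natCast]

theorem bc_add (x y : R) (k : ℕ) :
    bc χ (x + y) k = ∑ q ∈ antidiagonal k, bc χ x q.1 * bc χ y q.2 := by
  simp [bc, Ring.add_choose_eq k (Commute.all x y)]

theorem bc_succ_succ (x : R) (k : ℕ) : bc χ (x + 1) (k + 1) = bc χ x k + bc χ x (k + 1) := by
  simp [bc, Ring.choose_succ_succ]

theorem bc_mul_choose (x : R) (i j : ℕ) :
    bc χ x (i + j) * ((i + j).choose i : F) = bc χ x i * bc χ (x - i) j := by
  have h := Ring.choose_smul_choose x (n := i + j) (k := i) (by omega)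
  rw [nsmul_eq_mul, Nat.add_sub_cancel_left] at h
  have h2 := congrArg χ h
  simp only [map_mul, map_natCast] at h2
  rw [bc, bc, bc, ← h2, mul_comm]

theorem bc_mul_bc_comm (x : R) (i j : ℕ) :
    bc χ x i * bc χ (x - i) j = bc χ x j * bc χ (x - j) i := by
  rw [← bc_mul_choose, ← bc_mul_choose, add_comm j i, Nat.choose_symm_add]

theorem bc_mul_bc_natCast (x : R) (i p : ℕ) :
    bc χ x i * bc χ (i : R) p = if p ≤ i then bc χ x p * bc χ (x - p) (i - p) else 0 := by
  rw [bc_natCast]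
  split_ifs with h
  · obtain ⟨j, rfl⟩ := Nat.exists_eq_add_of_le h
    rw [bc_mul_choose, Nat.add_sub_cancel_left]
  · rw [Nat.choose_eq_zero_of_lt (by omega)]; simp

theorem sum_antidiagonal_antidiagonal {M : Type*} [AddCommMonoid M] (f : ℕ → ℕ → ℕ → M) (j : ℕ) :
    ∑ q ∈ antidiagonal j, ∑ r ∈ antidiagonal q.2, f q.1 r.1 r.2 =
      ∑ q ∈ antidiagonal j, ∑ r ∈ antidiagonal q.1, f r.1 r.2 q.2 := by
  rw [sum_sigma', sum_sigma']
  refine sum_nbij' (fun x => ⟨(x.1.1 + x.2.1, x.2.2), (x.1.1, x.2.1)⟩)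
    (fun x => ⟨(x.2.1, x.2.2 + x.1.2), (x.2.2, x.1.2)⟩) ?_ ?_ ?_ ?_ ?_
  · rintro ⟨⟨a, b⟩, ⟨c, d⟩⟩ h
    simp only [mem_sigma, HasAntidiagonal.mem_antidiagonal] at h ⊢
    obtain ⟨rfl, rfl⟩ := h
    simp [add_assoc]
  · rintro ⟨⟨a, b⟩, ⟨c, d⟩⟩ h
    simp only [mem_sigma, HasAntidiagonal.mem_antidiagonal] at h ⊢
    obtain ⟨rfl, rfl⟩ := h
    simp [add_assoc]
  · rintro ⟨⟨a, b⟩, ⟨c, d⟩⟩ h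
    simp only [mem_sigma, HasAntidiagonal.mem_antidiagonal] at h ⊢
    simp [h.2]
  · rintro ⟨⟨a, b⟩, ⟨c, d⟩⟩ h
    simp only [mem_sigma, HasAntidiagonal.mem_antidiagonal] at h ⊢
    simp [h.2]
  · rintro ⟨⟨a, b⟩, ⟨c, d⟩⟩ h
    rfl

theorem sum_antidiagonal_shift (f g : ℕ → F) (p s : ℕ) :
    ∑ q ∈ antidiagonal s, (if p ≤ q.1 then f (q.1 - p) else 0) * g q.2 =
      if p ≤ s then ∑ q ∈ antidiagonal (s - p), f q.1 * g q.2 else 0 := by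
  split_ifs with h
  · obtain ⟨s, rfl⟩ := Nat.exists_eq_add_of_le h
    rw [Nat.add_sub_cancel_left, Nat.sum_antidiagonal_eq_sum_range_succ
      (fun a b => (if p ≤ a then f (a - p) else 0) * g b), Nat.sum_antidiagonal_eq_sum_range_succ
      (fun a b => f a * g b), ← Nat.add_succ, sum_range_add, sum_eq_zero, zero_add]
    · refine sum_congr rfl fun i _ => ?_
      rw [if_pos (by omega)]; congr 2 <;> omega
    · intro i hi
      rw [if_neg (by simpa using hi), zero_mul]
  · refine sum_eq_zero fun q hq => ?_
    rw [HasAntidiagonal.mem_antidiagonal] at hq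
    rw [if_neg (by omega), zero_mul]

/-- Vandermonde splits `bc χ (M + l - q.1) P` along `(l - q.1) + M`, trinomial revision exchanges
the two lower indices of `l`, and Vandermonde collapses the old sum. The effect is to trade a sum of
length `t` for one of length `P`, which stays fixed while `t` runs. -/
theorem sum_bc_sub (l k M : R) (t P : ℕ) :
    ∑ q ∈ antidiagonal t, bc χ l q.1 * bc χ k q.2 * bc χ (M + l - q.1) P =
      ∑ q ∈ antidiagonal P, bc χ l q.1 * bc χ M q.2 * bc χ (k + l - q.1) t := by
  have h1 : ∀ q ∈ antidiagonal t, bc χ l q.1 * bc χ k q.2 * bc χ (M + l - q.1) P =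
      ∑ r ∈ antidiagonal P, (bc χ l r.1 * bc χ M r.2) * (bc χ (l - r.1) q.1 * bc χ k q.2) := by
    intro q _
    rw [show M + l - (q.1 : R) = (l - q.1) + M by ring, bc_add, mul_sum]
    refine sum_congr rfl fun r _ => ?_
    linear_combination bc χ k q.2 * bc χ M r.2 * bc_mul_bc_comm χ l q.1 r.1
  rw [sum_congr rfl h1, sum_comm]
  refine sum_congr rfl fun r _ => ?_
  rw [← mul_sum, ← bc_add]
  congr 2; ring

/-- The same exchange as in `sum_bc_sub` when the running index enters with a plus sign. Trinomial
revision now involves the natural number `q.1` as upper index, which produces the cutoff `q.1 ≤ s`.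
-/
theorem sum_bc_add (l k M : R) (s P : ℕ) :
    ∑ q ∈ antidiagonal s, bc χ l q.1 * bc χ k q.2 * bc χ (M + q.1) P =
      ∑ q ∈ antidiagonal P, bc χ l q.1 * bc χ M q.2 *
        (if q.1 ≤ s then bc χ (k + l - q.1) (s - q.1) else 0) := by
  have h1 : ∀ q ∈ antidiagonal s, bc χ l q.1 * bc χ k q.2 * bc χ (M + q.1) P =
      ∑ r ∈ antidiagonal P, (bc χ l r.1 * bc χ M r.2) *
        ((if r.1 ≤ q.1 then bc χ (l - r.1) (q.1 - r.1) else 0) * bc χ k q.2) := by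
    intro q _
    rw [add_comm M, bc_add, mul_sum]
    refine sum_congr rfl fun r _ => ?_
    have := bc_mul_bc_natCast χ l q.1 r.1
    rw [show bc χ l q.1 * bc χ k q.2 * (bc χ (q.1 : R) r.1 * bc χ M r.2) =
      (bc χ l q.1 * bc χ (q.1 : R) r.1) * (bc χ k q.2 * bc χ M r.2) by ring, this]
    split_ifs <;> ring
  rw [sum_congr rfl h1, sum_comm]
  refine sum_congr rfl fun r _ => ?_
  rw [← mul_sum, sum_antidiagonal_shift (fun i => bc χ (l - r.1) i) (fun i => bc χ k i)]
  simp only [← bc_add]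
  rw [show l - (r.1 : R) + k = k + l - r.1 by ring]

theorem sum_neg_one_pow_choose (t : ℕ) :
    ∑ q ∈ antidiagonal t, (-1 : F) ^ q.1 * ((q.1 + q.2).choose q.1 : F) =
      if t = 0 then 1 else 0 := by
  have h := Int.alternating_sum_range_choose (n := t)
  have h2 := congrArg (Int.cast : ℤ → F) h
  rw [Nat.sum_antidiagonal_eq_sum_range_succ
    (fun a b => (-1 : F) ^ a * ((a + b).choose a : F))]
  push_cast at h2
  rw [← h2]
  refine sum_congr rfl fun i hi => ?_
  rw [Nat.add_sub_cancel' (by simpa [Nat.lt_succ_iff] using hi)]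

theorem sum_neg_one_pow_bc (x : R) (t : ℕ) :
    ∑ q ∈ antidiagonal t, (-1 : F) ^ q.1 * (bc χ x q.1 * bc χ (x - q.1) q.2) =
      if t = 0 then 1 else 0 := by
  have h1 : ∀ q ∈ antidiagonal t, (-1 : F) ^ q.1 * (bc χ x q.1 * bc χ (x - q.1) q.2) =
      bc χ x t * ((-1 : F) ^ q.1 * ((q.1 + q.2).choose q.1 : F)) := by
    intro q hq
    rw [HasAntidiagonal.mem_antidiagonal] at hq
    rw [← bc_mul_choose, hq]; ring
  rw [sum_congr rfl h1, ← mul_sum, sum_neg_one_pow_choose]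
  split_ifs with h <;> simp [h]

/-- This is the coefficient of `X ^ j` in `(1 + X) ^ (N + y) (1 - X / (1 + X)) ^ y = (1 + X) ^ N`.
-/
theorem sum_neg_one_pow_bc_mul_bc (y N : R) (j : ℕ) :
    ∑ q ∈ antidiagonal j, (-1 : F) ^ q.1 * bc χ y q.1 * bc χ (N + y - q.1) q.2 = bc χ N j := by
  have h1 : ∀ q ∈ antidiagonal j, (-1 : F) ^ q.1 * bc χ y q.1 * bc χ (N + y - q.1) q.2 =
      ∑ r ∈ antidiagonal q.2,
        (-1 : F) ^ q.1 * (bc χ y q.1 * bc χ (y - q.1) r.1) * bc χ N r.2 := by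
    intro q _
    rw [show N + y - (q.1 : R) = (y - q.1) + N by ring, bc_add, mul_sum]
    refine sum_congr rfl fun r _ => ?_
    ring
  rw [sum_congr rfl h1, sum_antidiagonal_antidiagonal fun a b c =>
    (-1 : F) ^ a * (bc χ y a * bc χ (y - a) b) * bc χ N c]
  simp only [← sum_mul, sum_neg_one_pow_bc]
  rw [sum_eq_single (0, j)]
  · simp
  · intro q hq hne
    rw [HasAntidiagonal.mem_antidiagonal] at hq
    rw [if_neg, zero_mul]
    rintro h0
    exact hne (Prod.ext h0 (by simp; omega))
  · intro h; simp at h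

/-- A rational number that is a `p`-adic integer has denominator prime to `p`. Its cast to `F`,
which is numerator divided by denominator, is then not a division by zero and agrees with `χ`. -/
theorem cast_eq_of_padic {p : ℕ} [Fact p.Prime] [CharP F p] (χ : ℤ_[p] →+* F) (q : ℚ) (z : ℤ_[p])
    (h : (q : ℚ_[p]) = z) : (q : F) = χ z := by
  have hden : (q.den : F) ≠ 0 := by
    rw [Ne, CharP.cast_eq_zero_iff F p]
    intro hd
    have h1 : ‖(q : ℚ_[p])‖ ≤ 1 := by rw [h]; exact z.2
    have h2 : (q : ℚ_[p]) * ((q.den : ℤ) : ℚ_[p]) = (q.num : ℚ_[p]) := by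
      exact_mod_cast congrArg (Rat.cast : ℚ → ℚ_[p]) (Rat.mul_den_eq_num q)
    have h3 : ‖((q.den : ℤ) : ℚ_[p])‖ < 1 :=
      (Padic.norm_intCast_lt_one_iff).2 (by exact_mod_cast hd)
    have h4 : (p : ℤ) ∣ q.num := by
      rw [← Padic.norm_intCast_lt_one_iff, ← h2, norm_mul]
      exact lt_of_le_of_lt (mul_le_of_le_one_left (norm_nonneg _) h1) h3
    have h5 := Nat.dvd_gcd (Int.natCast_dvd.1 h4) hd
    rw [q.reduced] at h5
    exact (Fact.out : p.Prime).one_lt.ne' (Nat.dvd_one.1 h5)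
  have h1 : z * (q.den : ℤ_[p]) = (q.num : ℤ_[p]) := by
    apply Subtype.ext
    push_cast
    rw [← h]
    exact_mod_cast Rat.mul_den_eq_num q
  have h2 := congrArg χ h1
  simp only [map_mul, map_natCast, map_intCast] at h2
  rw [Rat.cast_def, div_eq_iff hden, h2]

/-- `ℤ_[p]` is a binomial ring, so the rational binomial coefficient of a `p`-adic integer is again
one. This links the coefficients in the definition of a module to those for which the identities
above hold. -/
theorem binom_eq_bc {p : ℕ} [Fact p.Prime] [CharP F p] (χ : ℤ_[p] →+* F) (α : ℚ) (z : ℤ_[p])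
    (h : (α : ℚ_[p]) = z) (i : ℕ) : binom F α i = bc χ z i := by
  rw [binom, bc]
  apply cast_eq_of_padic
  have h1 := Ring.descPochhammer_eq_factorial_smul_choose z i
  rw [← Polynomial.aeval_eq_smeval, Polynomial.aeval_def, Polynomial.eval₂_eq_eval_map,
    descPochhammer_map, descPochhammer_eval_eq_prod_range, nsmul_eq_mul] at h1
  have h2 := congrArg (Subtype.val) h1
  rw [ratBinom]
  push_cast at h2 ⊢
  rw [h, div_eq_iff (by exact_mod_cast i.factorial_ne_zero), mul_comm]
  rw [← h2]
  have := map_prod (PadicInt.Coe.ringHom (p := p)) (fun j : ℕ => z - (j : ℤ_[p])) (range i)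
  refine Eq.trans ?_ this.symm
  refine prod_congr rfl fun j _ => ?_
  rw [map_sub, map_natCast]
  rfl

end Binomials

/-! ### Finite support of single and double sums, and elimination principles -/

section Sums

open Finset

variable {F : Type u} [Field F] {M : Type*} [AddCommGroup M] [Module F M]
  {N : Type*} [AddCommGroup N] [Module F N]

/-- The sequence `f` vanishes eventually. -/
def EZ (f : ℕ → M) : Prop := ∃ n, ∀ i ≥ n, f i = 0

/-- The double sequence `f` vanishes outside a box. -/
def BoxZ (f : ℕ → ℕ → M) : Prop := ∃ n, ∀ i j, n ≤ i ∨ n ≤ j → f i j = 0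

/-- A `finsum` with infinite support is `0` by default, so every splitting or interchange of sums
below has to be backed by `EZ` or `BoxZ`. -/
theorem EZ.hasFiniteSupport {f : ℕ → M} (hf : EZ f) : f.HasFiniteSupport := by
  obtain ⟨n, hn⟩ := hf
  refine (Set.finite_lt_nat n).subset fun i hi => ?_
  by_contra h
  exact hi (hn i (by simpa using h))

theorem finsum_eq_sum_range {f : ℕ → M} {n : ℕ} (hn : ∀ i ≥ n, f i = 0) :
    ∑ᶠ i, f i = ∑ i ∈ range n, f i := by
  refine finsum_eq_finsetSum_of_support_subset _ fun i hi => ?_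
  by_contra h
  exact hi (hn i (by simpa using h))

theorem EZ.of_imp {f : ℕ → M} {g : ℕ → N} (hf : EZ f) (h : ∀ i, f i = 0 → g i = 0) : EZ g := by
  obtain ⟨n, hn⟩ := hf
  exact ⟨n, fun i hi => h i (hn i hi)⟩

theorem EZ.smul {f : ℕ → M} (hf : EZ f) (c : ℕ → F) : EZ fun i => c i • f i :=
  hf.of_imp fun i h => by simp [h]

theorem EZ.sub {f g : ℕ → M} (hf : EZ f) (hg : EZ g) : EZ fun i => f i - g i := by
  obtain ⟨n, hn⟩ := hf
  obtain ⟨m, hm⟩ := hg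
  exact ⟨max n m, fun i hi => by
    simp [hn i (le_trans (le_max_left _ _) hi), hm i (le_trans (le_max_right _ _) hi)]⟩

theorem EZ.finsum_add {f g : ℕ → M} (hf : EZ f) (hg : EZ g) :
    ∑ᶠ i, (f i + g i) = ∑ᶠ i, f i + ∑ᶠ i, g i :=
  finsum_add_distrib hf.hasFiniteSupport hg.hasFiniteSupport

theorem EZ.finsum_sub {f g : ℕ → M} (hf : EZ f) (hg : EZ g) :
    ∑ᶠ i, (f i - g i) = ∑ᶠ i, f i - ∑ᶠ i, g i :=
  finsum_sub_distrib hf.hasFiniteSupport hg.hasFiniteSupport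

theorem EZ.map_finsum {f : ℕ → M} (hf : EZ f) (L : M →ₗ[F] N) :
    L (∑ᶠ i, f i) = ∑ᶠ i, L (f i) :=
  _root_.map_finsum L hf.hasFiniteSupport

theorem finsum_finset_sum {ι : Type*} (s : Finset ι) (f : ι → ℕ → M) (h : ∀ a ∈ s, EZ (f a)) :
    ∑ᶠ i, ∑ a ∈ s, f a i = ∑ a ∈ s, ∑ᶠ i, f a i := by
  exact (sum_finsum_comm s f fun a ha => (h a ha).hasFiniteSupport).symm

theorem EZ.finsum_succ {f : ℕ → M} (hf : EZ f) : ∑ᶠ i, f i = f 0 + ∑ᶠ i, f (i + 1) := by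
  obtain ⟨n, hn⟩ := hf
  rw [finsum_eq_sum_range (n := n + 1) fun i hi => hn i (by omega),
    finsum_eq_sum_range (n := n) fun i hi => hn (i + 1) (by omega), sum_range_succ', add_comm]

theorem finsum_shift {f : ℕ → M} (hf : EZ f) (p : ℕ) :
    ∑ᶠ i, (if p ≤ i then f (i - p) else 0) = ∑ᶠ i, f i := by
  obtain ⟨n, hn⟩ := hf
  rw [finsum_eq_sum_range (n := p + n), finsum_eq_sum_range hn, sum_range_add, sum_eq_zero,
    zero_add]
  · refine sum_congr rfl fun i _ => ?_
    rw [if_pos (by omega), Nat.add_sub_cancel_left]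
  · intro i hi
    rw [if_neg (by simpa using hi)]
  · intro i hi
    split_ifs
    · exact hn _ (by omega)
    · rfl

theorem BoxZ.swap {f : ℕ → ℕ → M} (hf : BoxZ f) : BoxZ fun j i => f i j := by
  obtain ⟨n, hn⟩ := hf
  exact ⟨n, fun j i h => hn i j h.symm⟩

theorem BoxZ.outer {f : ℕ → ℕ → M} (hf : BoxZ f) : EZ fun i => ∑ᶠ j, f i j := by
  obtain ⟨n, hn⟩ := hf
  refine ⟨n, fun i hi => ?_⟩
  simp [hn i _ (Or.inl hi)]

theorem BoxZ.finsum_eq_sum {f : ℕ → ℕ → M} {n : ℕ} (hn : ∀ i j, n ≤ i ∨ n ≤ j → f i j = 0) :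
    ∑ᶠ i, ∑ᶠ j, f i j = ∑ i ∈ range n, ∑ j ∈ range n, f i j := by
  have h1 : ∀ i, ∑ᶠ j, f i j = ∑ j ∈ range n, f i j := fun i =>
    finsum_eq_sum_range fun j hj => hn i j (Or.inr hj)
  simp only [h1]
  exact finsum_eq_sum_range fun i hi => sum_eq_zero fun j _ => hn i j (Or.inl hi)

theorem BoxZ.finsum_comm {f : ℕ → ℕ → M} (hf : BoxZ f) :
    ∑ᶠ i, ∑ᶠ j, f i j = ∑ᶠ j, ∑ᶠ i, f i j := by
  obtain ⟨n, hn⟩ := hf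
  rw [BoxZ.finsum_eq_sum hn, BoxZ.finsum_eq_sum fun j i h => hn i j h.symm, sum_comm]

theorem BoxZ.ez_sum_antidiagonal {f : ℕ → ℕ → M} (hf : BoxZ f) :
    EZ fun t => ∑ q ∈ antidiagonal t, f q.1 q.2 := by
  obtain ⟨n, hn⟩ := hf
  refine ⟨2 * n, fun t ht => sum_eq_zero fun q hq => ?_⟩
  rw [HasAntidiagonal.mem_antidiagonal] at hq
  exact hn _ _ (by omega)

theorem BoxZ.finsum_antidiagonal {f : ℕ → ℕ → M} (hf : BoxZ f) :
    ∑ᶠ i, ∑ᶠ j, f i j = ∑ᶠ t, ∑ q ∈ antidiagonal t, f q.1 q.2 := by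
  obtain ⟨n, hn⟩ := hf
  rw [BoxZ.finsum_eq_sum hn, finsum_eq_sum_range (n := 2 * n)]
  · rw [← sum_product', sum_sigma']
    refine sum_bij_ne_zero (fun q _ _ => ⟨q.1 + q.2, q⟩) ?_ ?_ ?_ ?_
    · rintro ⟨i, j⟩ h1 _
      simp only [mem_product, mem_range] at h1
      simp only [mem_sigma, mem_range, HasAntidiagonal.mem_antidiagonal, and_true]
      omega
    · rintro ⟨i, j⟩ _ _ ⟨i', j'⟩ _ _ h
      simp only [Sigma.mk.injEq] at h
      exact eq_of_heq h.2
    · rintro ⟨t, i, j⟩ h1 h2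
      simp only [mem_sigma, mem_range, HasAntidiagonal.mem_antidiagonal] at h1
      obtain ⟨h1, rfl⟩ := h1
      refine ⟨(i, j), ?_, h2, rfl⟩
      by_contra h3
      simp only [mem_product, mem_range, not_and_or, not_lt] at h3
      exact h2 (hn i j h3)
    · intros; rfl
  · intro t ht
    refine sum_eq_zero fun q hq => ?_
    rw [HasAntidiagonal.mem_antidiagonal] at hq
    exact hn _ _ (by omega)

theorem int_down_induction {P : ℤ → Prop} (h0 : ∃ n, ∀ l ≥ n, P l)
    (h : ∀ l, (∀ l' > l, P l') → P l) (l : ℤ) : P l := by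
  obtain ⟨n, hn⟩ := h0
  have : ∀ d : ℕ, ∀ l ≥ n - d, P l := by
    intro d
    induction d with
    | zero => simpa using hn
    | succ d ih =>
      intro l hl
      exact h l fun l' hl' => ih l' (by push_cast at hl; omega)
  exact this (n - l).toNat l (by omega)

/-- The system is unitriangular in `l`: the term `i = 0` is `K l`, and the others involve larger
first indices only. Downward induction from the range where `K` vanishes solves it. -/
theorem eq_zero_of_finsum_eq_zero (T : ℤ) (b : ℕ → F) (hb : b 0 = 1) (K : ℤ → ℤ → M)
    (hK : ∃ N, ∀ l ≥ N, ∀ k, K l k = 0)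
    (h : ∀ l n, ∑ᶠ i : ℕ, b i • K (l + i) (n - i * T) = 0) (l k : ℤ) : K l k = 0 := by
  revert k
  refine int_down_induction hK (fun l ih k => ?_) l
  have h1 := h l k
  rw [finsum_eq_single _ 0] at h1
  · simpa [hb] using h1
  · intro i hi
    rw [ih _ (by omega), smul_zero]

/-- A family with `X (l + 1) m n = X l (m + T) n - X l m (n + T)` that vanishes for large `l`
vanishes if each diagonal contains a zero. -/
theorem eq_zero_of_recursion (T r : ℤ) (X : ℤ → ℤ → ℤ → M)
    (hrec : ∀ l m n, X (l + 1) m n = X l (m + T) n - X l m (n + T))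
    (hX : ∃ N, ∀ l ≥ N, ∀ m n, m ≡ r [ZMOD T] → X l m n = 0)
    (h0 : ∀ l m n, m ≡ r [ZMOD T] → ∃ d : ℤ, X l (m + d * T) (n - d * T) = 0)
    (l m n : ℤ) (hm : m ≡ r [ZMOD T]) : X l m n = 0 := by
  obtain ⟨N, hN⟩ := hX
  revert m n
  refine int_down_induction (P := fun l => ∀ m n : ℤ, m ≡ r [ZMOD T] → X l m n = 0)
    ⟨N, hN⟩ (fun l ih m n hm => ?_) l
  have hmT : ∀ m d : ℤ, m ≡ r [ZMOD T] → m + d * T ≡ r [ZMOD T] := by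
    intro m d hm
    simpa using (Int.ModEq.add hm (Int.modEq_zero_iff_dvd.2 (Dvd.intro_left d rfl)))
  have h1 : ∀ m n, m ≡ r [ZMOD T] → X l (m + T) n = X l m (n + T) := by
    intro m n hm
    have := hrec l m n
    rw [ih (l + 1) (by omega) m n hm] at this
    exact (sub_eq_zero.1 this.symm)
  have h2 : ∀ d : ℤ, X l (m + d * T) (n - d * T) = X l m n := by
    intro d
    induction d using Int.induction_on with
    | zero => simp
    | succ i ih =>
      rw [← ih, show m + ((i : ℤ) + 1) * T = m + i * T + T by ring, h1 _ _ (hmT _ _ hm)]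
      congr 1; ring
    | pred i ih =>
      rw [← ih, show m + -(i : ℤ) * T = m + (-(i : ℤ) - 1) * T + T by ring, h1 _ _ (hmT _ _ hm)]
      congr 1; ring
  obtain ⟨d, hd⟩ := h0 l m n hm
  rw [← h2 d, hd]

end Sums

/-! ### Fields, the Jacobi identity and products of local fields -/

section Fields

open Finset

variable {F : Type u} [Field F] {R : Type*} [CommRing R] [BinomialRing R] (χ : R →+* F)
  (T : ℕ) (θ : R) {W : Type w} [AddCommGroup W] [Module F W]

/-- The truncation condition on a field. -/
def Trunc (φ : ℤ → Module.End F W) : Prop := ∀ x, ∃ N : ℤ, ∀ k ≥ N, φ k x = 0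

/-- The coefficient of `(x₁ - x₂) ^ l A(x₁) B(x₂)`, expanded in nonnegative powers of `x₂`. -/
def half (A B : ℤ → Module.End F W) (l m n : ℤ) (x : W) : W :=
  ∑ᶠ i : ℕ, ((-1 : F) ^ i * bc χ (l : R) i) • A (m + (l - i) * T) (B (n + i * T) x)

/-- The left hand side of the Jacobi identity for the fields `A` and `B`. -/
def jl (ε : F) (A B : ℤ → Module.End F W) (l m n : ℤ) (x : W) : W :=
  half χ T A B l m n x - (ε * (-1) ^ l) • half χ T B A l n m x

/-- The right hand side of the Jacobi identity for the fields `C l`. -/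
def jr (C : ℤ → ℤ → Module.End F W) (l m n : ℤ) (x : W) : W :=
  ∑ᶠ i : ℕ, bc χ ((m : R) * θ) i • C (l + i) (m + n - i * T) x

/-- The fields `C l` are the products `A_l B` of the field `A`, with modes in `r + T ℤ`, and the
field `B`. -/
structure IsProd (r : ℤ) (ε : F) (A B : ℤ → Module.End F W)
    (C : ℤ → ℤ → Module.End F W) : Prop where
  bdd : ∃ N : ℤ, ∀ l ≥ N, C l = 0
  eq : ∀ l m n x, m ≡ r [ZMOD T] → jl χ T ε A B l m n x = jr χ T θ C l m n x

variable {χ T θ} {A B : ℤ → Module.End F W} {C : ℤ → ℤ → Module.End F W}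

theorem Trunc.ez (hB : Trunc B) (hT : 0 < T) (n : ℤ) (x : W) :
    EZ fun i : ℕ => B (n + i * T) x := by
  obtain ⟨N, hN⟩ := hB x
  refine ⟨(N - n).toNat, fun i hi => hN _ ?_⟩
  have : (i : ℤ) * 1 ≤ i * T := by gcongr; exact_mod_cast hT
  omega

theorem Trunc.add (hA : Trunc A) (hB : Trunc B) : Trunc (A + B) := by
  intro x
  obtain ⟨N, hN⟩ := hA x
  obtain ⟨M, hM⟩ := hB x
  exact ⟨max N M, fun k hk => by
    simp [hN k (le_trans (le_max_left _ _) hk), hM k (le_trans (le_max_right _ _) hk)]⟩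

theorem Trunc.smul (hA : Trunc A) (c : F) : Trunc (c • A) := by
  intro x
  obtain ⟨N, hN⟩ := hA x
  exact ⟨N, fun k hk => by simp [hN k hk]⟩

theorem Trunc.zero : Trunc (0 : ℤ → Module.End F W) := fun _ => ⟨0, fun _ _ => rfl⟩

theorem Trunc.half_ez (hB : Trunc B) (hT : 0 < T) (c : ℕ → F) (f : ℕ → ℤ) (n : ℤ) (x : W) :
    EZ fun i : ℕ => c i • A (f i) (B (n + i * T) x) :=
  (hB.ez hT n x).of_imp fun i h => by simp [h]

/-- Splitting one factor off `(x₁ - x₂) ^ (l + 1)` is Pascal's rule for its coefficients. -/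
theorem half_succ (hB : Trunc B) (hT : 0 < T) (l m n : ℤ) (x : W) :
    half χ T A B (l + 1) m n x = half χ T A B l (m + T) n x - half χ T A B l m (n + T) x := by
  have h1 : half χ T A B l (m + T) n x =
      ∑ᶠ i : ℕ, ((-1 : F) ^ i * bc χ (l : R) i) • A (m + (l + 1 - i) * T) (B (n + i * T) x) := by
    refine finsum_congr fun i => ?_
    congr 2; ring_nf
  have h2 : half χ T A B l m (n + T) x =
      ∑ᶠ i : ℕ, ((-1 : F) ^ i * bc χ (l : R) i) •
        A (m + (l + 1 - (i + 1 : ℕ)) * T) (B (n + (i + 1 : ℕ) * T) x) := by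
    refine finsum_congr fun i => ?_
    congr 2 <;> push_cast <;> ring_nf
  have e1 := hB.half_ez (A := A) hT (fun i => (-1 : F) ^ i * bc χ (l : R) i)
    (fun i => m + (l + 1 - i) * T) n x
  have e2 := hB.half_ez (A := A) hT (fun i => (-1 : F) ^ i * bc χ ((l + 1 : ℤ) : R) i)
    (fun i => m + (l + 1 - i) * T) n x
  rw [h1, h2, half, e1.finsum_succ, e2.finsum_succ]
  refine (congrArg₂ (· + ·) (by simp) ((finsum_congr fun i => ?_).trans
    (EZ.finsum_sub ?_ ?_))).trans (add_sub_assoc _ _ _).symm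
  · rw [← sub_smul]
    congr 1
    push_cast
    rw [bc_succ_succ]
    ring
  · obtain ⟨N, hN⟩ := e1
    exact ⟨N, fun i hi => hN (i + 1) (by omega)⟩
  · have := hB.half_ez (A := A) hT (fun i => (-1 : F) ^ i * bc χ (l : R) i)
      (fun i => m + (l + 1 - (i + 1 : ℕ)) * T) (n + T) x
    refine this.of_imp fun i h => ?_
    rw [← h]
    congr 3; push_cast; ring_nf

theorem jl_succ (hA : Trunc A) (hB : Trunc B) (hT : 0 < T) (ε : F) (l m n : ℤ) (x : W) :
    jl χ T ε A B (l + 1) m n x = jl χ T ε A B l (m + T) n x - jl χ T ε A B l m (n + T) x := by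
  rw [jl, jl, jl, half_succ hB hT, half_succ hA hT, zpow_add_one₀ (by simp)]
  module

theorem jr_ez (hC : ∃ N : ℤ, ∀ l ≥ N, C l = 0) (c : ℕ → F) (f : ℕ → ℤ) (l : ℤ) (x : W) :
    EZ fun i : ℕ => c i • C (l + i) (f i) x := by
  obtain ⟨N, hN⟩ := hC
  exact ⟨(N - l).toNat, fun i hi => by simp [hN (l + i) (by omega)]⟩

theorem jr_eq_zero {l : ℤ} (hC : ∀ l' ≥ l, C l' = 0) {m n : ℤ} {x : W} :
    jr χ T θ C l m n x = 0 :=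
  finsum_eq_zero_of_forall_eq_zero fun i => by rw [hC _ (by omega)]; simp

/-- The right hand side obeys the recursion of the left one: raising `m` by `T` raises the upper
index `m * θ` by one, and Pascal's rule applies. Equality of both sides thus spreads along diagonals
and downwards in `l`. -/
theorem jr_succ (hθ : T * θ = 1) (hC : ∃ N : ℤ, ∀ l ≥ N, C l = 0) (l m n : ℤ) (x : W) :
    jr χ T θ C (l + 1) m n x = jr χ T θ C l (m + T) n x - jr χ T θ C l m (n + T) x := by
  have hm : ((m + T : ℤ) : R) * θ = m * θ + 1 := by push_cast; rw [add_mul, hθ]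
  have h2 : jr χ T θ C l m (n + T) x =
      ∑ᶠ i : ℕ, bc χ ((m : R) * θ) i • C (l + i) (m + T + n - i * T) x := by
    refine finsum_congr fun i => ?_
    congr 2; ring_nf
  have h3 : jr χ T θ C (l + 1) m n x = ∑ᶠ i : ℕ, bc χ ((m : R) * θ) i •
      C (l + (i + 1 : ℕ)) (m + T + n - (i + 1 : ℕ) * T) x := by
    refine finsum_congr fun i => ?_
    congr 2; push_cast; ring_nf
  have e1 := jr_ez hC (fun i => bc χ ((m : R) * θ) i) (fun i => m + T + n - i * T) l x
  have e2 := jr_ez hC (fun i => bc χ ((m : R) * θ + 1) i) (fun i => m + T + n - i * T) l x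
  rw [h2, h3, jr, hm, e1.finsum_succ, e2.finsum_succ, eq_sub_iff_add_eq, add_left_comm,
    ← EZ.finsum_add]
  · congr 1
    · simp
    · refine finsum_congr fun i => ?_
      rw [← add_smul, bc_succ_succ]
  · obtain ⟨N, hN⟩ := jr_ez hC (fun i => bc χ ((m : R) * θ) (i - 1)) (fun i => m + T + n - i * T) l x
    exact ⟨N, fun i hi => by simpa using hN (i + 1) (by omega)⟩
  · obtain ⟨N, hN⟩ := e1
    exact ⟨N, fun i hi => hN (i + 1) (by omega)⟩

/-- The equations with `m = r` already determine the products, because `jr` is unitriangular in `l`.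
This is the tool for identifying product fields throughout. -/
theorem IsProd.unique {r : ℤ} {ε ε' : F} {A' B' : ℤ → Module.End F W}
    {C' : ℤ → ℤ → Module.End F W} (h : IsProd χ T θ r ε A B C) (h' : IsProd χ T θ r ε' A' B' C')
    (hJ : ∀ l n x, jl χ T ε A B l r n x = jl χ T ε' A' B' l r n x) : C = C' := by
  funext l k
  refine LinearMap.ext fun x => ?_
  rw [← sub_eq_zero]
  refine eq_zero_of_finsum_eq_zero (T : ℤ) (bc χ ((r : R) * θ)) (bc_zero _ _)
    (fun l k => C l k x - C' l k x) ?_ (fun l n => ?_) l k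
  · obtain ⟨N, hN⟩ := h.bdd
    obtain ⟨N', hN'⟩ := h'.bdd
    exact ⟨max N N', fun l hl k => by
      rw [hN l (le_trans (le_max_left _ _) hl), hN' l (le_trans (le_max_right _ _) hl)]; simp⟩
  · have h1 := h.eq l r (n - r) x rfl
    rw [hJ, h'.eq l r (n - r) x rfl, jr, jr, add_sub_cancel] at h1
    simp only [smul_sub]
    rw [EZ.finsum_sub (jr_ez h.bdd _ _ _ _) (jr_ez h'.bdd _ _ _ _), h1, sub_self]

theorem half_add_right (hB : Trunc B) (hT : 0 < T) (l m n : ℤ) (x y : W) :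
    half χ T A B l m n (x + y) = half χ T A B l m n x + half χ T A B l m n y := by
  rw [half, half, half, ← EZ.finsum_add (hB.half_ez hT _ _ _ _) (hB.half_ez hT _ _ _ _)]
  simp

theorem half_smul_right (c : F) (l m n : ℤ) (x : W) :
    half χ T A B l m n (c • x) = c • half χ T A B l m n x := by
  rw [half, half, smul_finsum]
  refine finsum_congr fun i => ?_
  rw [map_smul, map_smul, smul_comm]

theorem jl_add_right (hA : Trunc A) (hB : Trunc B) (hT : 0 < T) (ε : F) (l m n : ℤ) (x y : W) :
    jl χ T ε A B l m n (x + y) = jl χ T ε A B l m n x + jl χ T ε A B l m n y := by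
  rw [jl, jl, jl, half_add_right hB hT, half_add_right hA hT]
  module

theorem jl_smul_right (c ε : F) (l m n : ℤ) (x : W) :
    jl χ T ε A B l m n (c • x) = c • jl χ T ε A B l m n x := by
  rw [jl, jl, half_smul_right, half_smul_right]
  module

variable (χ T) in
/-- The fields `A` and `B` are local. -/
def IsLocal (r : ℤ) (ε : F) (A B : ℤ → Module.End F W) : Prop :=
  ∃ N : ℤ, ∀ l ≥ N, ∀ m n x, m ≡ r [ZMOD T] → jl χ T ε A B l m n x = 0

theorem IsProd.isLocal {r : ℤ} {ε : F} (h : IsProd χ T θ r ε A B C) : IsLocal χ T r ε A B := by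
  obtain ⟨N, hN⟩ := h.bdd
  refine ⟨N, fun l hl m n x hm => ?_⟩
  rw [h.eq l m n x hm]
  exact jr_eq_zero fun l' hl' => hN l' (by omega)

theorem half_trunc (hA : Trunc A) (hB : Trunc B) (hT : 0 < T) (l m : ℤ) (x : W) :
    ∃ N : ℤ, ∀ n ≥ N, half χ T A B l m n x = 0 ∧ half χ T B A l n m x = 0 := by
  obtain ⟨N, hN⟩ := hB x
  obtain ⟨I, hI⟩ := hA.ez hT m x
  -- Only the vectors `A (m + i * T) x` with `i < I` are nonzero, so the finitely many truncation
  -- bounds of `B` at them have a common bound `K`.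
  have : ∃ K : ℤ, ∀ i < I, ∀ k ≥ K, B k (A (m + i * T) x) = 0 := by
    clear hI
    induction I with
    | zero => exact ⟨0, by simp⟩
    | succ I ih =>
      obtain ⟨K, hK⟩ := ih
      obtain ⟨K', hK'⟩ := hB (A (m + I * T) x)
      refine ⟨max K K', fun i hi k hk => ?_⟩
      rcases Nat.lt_succ_iff_lt_or_eq.1 hi with h | rfl
      · exact hK i h k (le_trans (le_max_left _ _) hk)
      · exact hK' k (le_trans (le_max_right _ _) hk)
  obtain ⟨K, hK⟩ := this
  -- The terms with `I - l` and `l - I` cancel; the remaining `K + I * T + |l| * T` ensures `n + (l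
  -- - i) * T ≥ K` for `i < I`.
  refine ⟨max N (K + (I - l) * T + (l - I)* T + I * T + |l| * T), fun n hn => ⟨?_, ?_⟩⟩
  · rw [half]
    refine finsum_eq_zero_of_forall_eq_zero fun i => ?_
    rw [hN _ (le_trans (le_max_left _ _) (le_trans hn _)), map_zero, smul_zero]
    exact le_add_of_nonneg_right (by positivity)
  · rw [half]
    refine finsum_eq_zero_of_forall_eq_zero fun i => ?_
    rcases lt_or_ge i I with h | h
    · rw [hK i h _ _, smul_zero]
      have h1 := le_trans (le_max_right _ _) hn
      have h2 : (0 : ℤ) ≤ (l + |l|) * T := mul_nonneg (by linarith [neg_abs_le l]) (by positivity)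
      have h3 : (0 : ℤ) ≤ (I - i) * T := mul_nonneg (by omega) (by positivity)
      nlinarith
    · simp only at hI
      rw [hI i h, map_zero, smul_zero]

theorem jl_trunc (hA : Trunc A) (hB : Trunc B) (hT : 0 < T) (ε : F) (l m : ℤ) (x : W) :
    ∃ N : ℤ, ∀ n ≥ N, jl χ T ε A B l m n x = 0 := by
  obtain ⟨N, hN⟩ := half_trunc (χ := χ) hA hB hT l m x
  exact ⟨N, fun n hn => by simp [jl, hN n hn]⟩

/-- Locality makes the unitriangular system at `m = r` solvable by a finite sum. The Jacobi identity
for the other `m` in the class of `r` is then forced, since both sides obey the same recursion. -/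
theorem exists_isProd (hθ : T * θ = 1) (hA : Trunc A) (hB : Trunc B) (hT : 0 < T) {r : ℤ} {ε : F}
    (h : IsLocal χ T r ε A B) :
    ∃ C, IsProd χ T θ r ε A B C ∧ (∀ l, Trunc (C l)) ∧ ∀ l k x, C l k x =
      ∑ᶠ j : ℕ, bc χ (-(r : R) * θ) j • jl χ T ε A B (l + j) r (k - r - j * T) x := by
  obtain ⟨N, hN⟩ := h
  have hez : ∀ (l : ℤ) (c : ℕ → F) (f : ℕ → ℤ) (x : W),
      EZ fun j : ℕ => c j • jl χ T ε A B (l + j) r (f j) x := fun l c f x =>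
    ⟨(N - l).toNat, fun j hj => by simp only; rw [hN _ (by omega) _ _ _ rfl, smul_zero]⟩
  -- The coefficients invert those of `jr` at `m = r`, because `(1 + X) ^ (r * θ)` and `(1 + X) ^
  -- (-r * θ)` are inverse to each other.
  let C : ℤ → ℤ → Module.End F W := fun l k =>
    { toFun := fun x => ∑ᶠ j : ℕ, bc χ (-(r : R) * θ) j • jl χ T ε A B (l + j) r (k - r - j * T) x
      map_add' := fun x y => by
        simp only [jl_add_right hA hB hT, smul_add]
        exact EZ.finsum_add (hez _ _ _ _) (hez _ _ _ _)
      map_smul' := fun c x => by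
        simp only [jl_smul_right, smul_comm _ c, RingHom.id_apply]
        exact (smul_finsum _ _).symm }
  have hC : ∀ l k x, C l k x =
    ∑ᶠ j : ℕ, bc χ (-(r : R) * θ) j • jl χ T ε A B (l + j) r (k - r - j * T) x := fun _ _ _ => rfl
  have hb : ∃ N : ℤ, ∀ l ≥ N, C l = 0 := by
    refine ⟨N, fun l hl => ?_⟩
    funext k
    refine LinearMap.ext fun x => ?_
    rw [hC]
    exact finsum_eq_zero_of_forall_eq_zero fun i => by rw [hN _ (by omega) _ _ _ rfl, smul_zero]
  refine ⟨C, ⟨hb, fun l m n x hm => ?_⟩, fun l x => ?_, hC⟩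
  · rw [← sub_eq_zero]
    refine eq_zero_of_recursion (T : ℤ) r
      (fun l m n => jl χ T ε A B l m n x - jr χ T θ C l m n x) ?_ ?_ ?_ l m n hm
    · intro l m n
      simp only [jl_succ hA hB hT, jr_succ hθ hb]
      abel
    · obtain ⟨N', hN'⟩ := hb
      refine ⟨max N N', fun l hl m n hm => ?_⟩
      have h1 := le_trans (le_max_left _ _) hl
      have h2 := le_trans (le_max_right _ _) hl
      rw [hN l h1 m n x hm, jr_eq_zero fun l' hl' => hN' l' (by omega), sub_zero]
    · intro l m n hm
      obtain ⟨d, hd⟩ := hm.dvd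
      refine ⟨d, ?_⟩
      rw [show m + d * T = r by rw [mul_comm]; omega, sub_eq_zero]
      generalize n - d * T = n'
      have h1 : ∀ i : ℕ, bc χ ((r : R) * θ) i • C (l + i) (r + n' - i * T) x =
          ∑ᶠ j : ℕ, (bc χ ((r : R) * θ) i * bc χ (-(r : R) * θ) j) •
            jl χ T ε A B (l + (i + j : ℕ)) r (n' - (i + j : ℕ) * T) x := by
        intro i
        rw [hC, smul_finsum]
        refine finsum_congr fun j => ?_
        rw [smul_smul]
        congr 2 <;> push_cast <;> ring
      rw [jr, finsum_congr h1, BoxZ.finsum_antidiagonal, finsum_eq_single _ 0]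
      · simp
      · intro t ht
        have h2 : ∀ q ∈ antidiagonal t, (bc χ ((r : R) * θ) q.1 * bc χ (-(r : R) * θ) q.2) •
            jl χ T ε A B (l + (q.1 + q.2 : ℕ)) r (n' - (q.1 + q.2 : ℕ) * T) x =
            (bc χ ((r : R) * θ) q.1 * bc χ (-(r : R) * θ) q.2) •
            jl χ T ε A B (l + (t : ℕ)) r (n' - (t : ℕ) * T) x := by
          intro q hq
          rw [HasAntidiagonal.mem_antidiagonal.1 hq]
        rw [sum_congr rfl h2, ← sum_smul, ← bc_add, neg_mul, add_neg_cancel, bc_zero_left,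
          if_neg ht, zero_smul]
      · refine ⟨(N - l).toNat, fun i j hij => ?_⟩
        simp only
        rw [hN _ (by push_cast; omega) _ _ _ rfl, smul_zero]
  · have h1 : ∀ j : ℕ, ∃ K : ℤ, ∀ n ≥ K, jl χ T ε A B (l + j) r n x = 0 := fun j =>
      jl_trunc hA hB hT ε (l + j) r x
    choose K hK using h1
    -- The sum of absolute values serves as a common upper bound of the finitely many thresholds;
    -- the same device recurs below.
    refine ⟨∑ j ∈ range (N - l).toNat, |r + j * T + K j|, fun k hk => ?_⟩
    rw [hC]
    refine finsum_eq_zero_of_forall_eq_zero fun j => ?_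
    rcases lt_or_ge j (N - l).toNat with h | h
    · rw [hK, smul_zero]
      have h3 := single_le_sum (f := fun j : ℕ => |r + j * T + K j|) (fun i _ => abs_nonneg _)
        (mem_range.2 h)
      have h4 := le_abs_self (r + j * T + K j)
      omega
    · rw [hN _ (by omega) _ _ _ rfl, smul_zero]

theorem IsProd.apply_eq (hθ : T * θ = 1) (hA : Trunc A) (hB : Trunc B) (hT : 0 < T) {r : ℤ} {ε : F}
    (h : IsProd χ T θ r ε A B C) (l k : ℤ) (x : W) : C l k x =
      ∑ᶠ j : ℕ, bc χ (-(r : R) * θ) j • jl χ T ε A B (l + j) r (k - r - j * T) x := by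
  obtain ⟨C', h1, -, h2⟩ := exists_isProd hθ hA hB hT h.isLocal
  rw [h.unique h1 fun _ _ _ => rfl, h2]

theorem IsProd.trunc (hθ : T * θ = 1) (hA : Trunc A) (hB : Trunc B) (hT : 0 < T) {r : ℤ} {ε : F}
    (h : IsProd χ T θ r ε A B C) (l : ℤ) : Trunc (C l) := by
  obtain ⟨C', h1, h2, -⟩ := exists_isProd hθ hA hB hT h.isLocal
  rw [h.unique h1 fun _ _ _ => rfl]
  exact h2 l

end Fields

/-! ### Three fields: the operator Jacobi identity with factors `(x₁ - x₃) ^ l (x₂ - x₃) ^ k` -/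

section Triple

open Finset

variable {F : Type u} [Field F] {R : Type*} [CommRing R] [BinomialRing R] {χ : R →+* F}
  {T : ℕ} {θ : R} {W : Type w} [AddCommGroup W] [Module F W]
  {A U φ : ℤ → Module.End F W} {Ca Cu : ℤ → ℤ → Module.End F W} {r s : ℤ} {e f h : F}

theorem BoxZ.of_rows {M : Type*} [AddCommGroup M] {g : ℕ → ℕ → M}
    (h1 : ∃ n, ∀ i ≥ n, ∀ j, g i j = 0) (h2 : ∀ i, EZ (g i)) : BoxZ g := by
  obtain ⟨n, hn⟩ := h1
  choose k hk using h2
  refine ⟨n + ∑ i ∈ range n, k i, fun i j hij => ?_⟩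
  rcases lt_or_ge i n with h | h
  · have := single_le_sum (f := k) (fun i _ => Nat.zero_le _) (mem_range.2 h)
    exact hk i j (by omega)
  · exact hn i h j

@[simp] theorem half_zero_right (A B : ℤ → Module.End F W) (l m n : ℤ) :
    half χ T A B l m n 0 = 0 := by
  simp [half]

theorem smul_apply_congr {c c' : F} {a a' : ℤ} (hc : c = c') (ha : a = a') (x : W) :
    c • A a x = c' • A a' x := by
  rw [hc, ha]

theorem smul_apply_apply_congr {c c' : F} {a a' b b' : ℤ} (hc : c = c') (ha : a = a')
    (hb : b = b') (x : W) : c • A a (U b x) = c' • A a' (U b' x) := by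
  rw [hc, ha, hb]

theorem EZ.finset_sum {M ι : Type*} [AddCommGroup M] (s : Finset ι) (f : ι → ℕ → M)
    (h : ∀ a ∈ s, EZ (f a)) : EZ fun i => ∑ a ∈ s, f a i := by
  classical
  choose! n hn using h
  refine ⟨∑ a ∈ s, n a, fun i hi => sum_eq_zero fun a ha => hn a ha i ?_⟩
  exact le_trans (single_le_sum (f := n) (fun _ _ => Nat.zero_le _) ha) hi

theorem half_ez (hφ : Trunc φ) (hA : Trunc A) (hT : 0 < T) (l m n : ℤ) (x : W) :
    EZ (fun j : ℕ => half χ T A φ l m (n + j * T) x) ∧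
      EZ (fun j : ℕ => half χ T φ A l (n + j * T) m x) := by
  obtain ⟨N, hN⟩ := half_trunc (χ := χ) hA hφ hT l m x
  have : ∀ j : ℕ, j ≥ (N - n).toNat → n + j * T ≥ N := by
    intro j hj
    have : (j : ℤ) * 1 ≤ j * T := by gcongr; exact_mod_cast hT
    omega
  exact ⟨⟨(N - n).toNat, fun j hj => (hN _ (this j hj)).1⟩,
    ⟨(N - n).toNat, fun j hj => (hN _ (this j hj)).2⟩⟩

/-- After the sums are interchanged, the inner one is the right hand side of the Jacobi identity of
`A` and `φ`. Replacing it by the left hand side removes the products `Ca`. -/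
theorem IsProd.finsum_half_left (hCa : IsProd χ T θ r f A φ Ca) (hCaT : ∀ l, Trunc (Ca l))
    (hT : 0 < T) (l k m₁ m₂ m₃ : ℤ) (x : W) (hm : m₁ ≡ r [ZMOD T]) :
    ∑ᶠ i : ℕ, bc χ ((m₁ : R) * θ) i • half χ T U (Ca (l + i)) k m₂ (m₁ + m₃ - i * T) x =
      ∑ᶠ j : ℕ, ((-1 : F) ^ j * bc χ (k : R) j) •
        U (m₂ + (k - j) * T) (jl χ T f A φ l m₁ (m₃ + j * T) x) := by
  simp only [half, smul_finsum]
  rw [BoxZ.finsum_comm]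
  · refine finsum_congr fun j => ?_
    rw [hCa.eq _ _ _ _ hm, jr, EZ.map_finsum (jr_ez hCa.bdd _ _ _ _), smul_finsum]
    refine finsum_congr fun i => ?_
    rw [map_smul, smul_comm, show m₁ + m₃ - i * T + j * T = m₁ + (m₃ + j * T) - i * T by ring]
  · obtain ⟨N, hN⟩ := hCa.bdd
    refine BoxZ.of_rows ⟨(N - l).toNat, fun i hi j => ?_⟩ fun i => ?_
    · rw [hN _ (by omega)]; simp
    · exact ((hCaT (l + i)).ez hT (m₁ + m₃ - i * T) x).of_imp fun j h => by simp [h]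

theorem IsProd.finsum_half_right (hCa : IsProd χ T θ r f A φ Ca) (hU : Trunc U)
    (hT : 0 < T) (l k m₁ m₂ m₃ : ℤ) (x : W) (hm : m₁ ≡ r [ZMOD T]) :
    ∑ᶠ i : ℕ, bc χ ((m₁ : R) * θ) i • half χ T (Ca (l + i)) U k (m₁ + m₃ - i * T) m₂ x =
      ∑ᶠ j : ℕ, ((-1 : F) ^ j * bc χ (k : R) j) •
        jl χ T f A φ l m₁ (m₃ + (k - j) * T) (U (m₂ + j * T) x) := by
  simp only [half, smul_finsum]
  rw [BoxZ.finsum_comm]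
  · refine finsum_congr fun j => ?_
    rw [hCa.eq _ _ _ _ hm, jr, smul_finsum]
    refine finsum_congr fun i => ?_
    rw [smul_comm, show m₁ + m₃ - i * T + (k - j) * T = m₁ + (m₃ + (k - j) * T) - i * T by ring]
  · obtain ⟨N, hN⟩ := hCa.bdd
    refine BoxZ.of_rows ⟨(N - l).toNat, fun i hi j => ?_⟩ fun i => ?_
    · rw [hN _ (by omega)]; simp
    · exact (hU.ez hT m₂ x).of_imp fun j h => by simp [h]

/-- The nested bracket of `U` with that of `A` and `φ`, written out as its four orderings of three
operators. -/
theorem IsProd.finsum_jl (hCa : IsProd χ T θ r f A φ Ca) (hCaT : ∀ l, Trunc (Ca l))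
    (hA : Trunc A) (hU : Trunc U) (hφ : Trunc φ) (hT : 0 < T) (h : F) (l k m₁ m₂ m₃ : ℤ) (x : W)
    (hm : m₁ ≡ r [ZMOD T]) :
    ∑ᶠ i : ℕ, bc χ ((m₁ : R) * θ) i • jl χ T h U (Ca (l + i)) k m₂ (m₁ + m₃ - i * T) x =
      (∑ᶠ j : ℕ, ((-1 : F) ^ j * bc χ (k : R) j) •
          U (m₂ + (k - j) * T) (half χ T A φ l m₁ (m₃ + j * T) x)
        - (f * (-1) ^ l) • ∑ᶠ j : ℕ, ((-1 : F) ^ j * bc χ (k : R) j) •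
          U (m₂ + (k - j) * T) (half χ T φ A l (m₃ + j * T) m₁ x))
      - (h * (-1) ^ k) • (∑ᶠ j : ℕ, ((-1 : F) ^ j * bc χ (k : R) j) •
          half χ T A φ l m₁ (m₃ + (k - j) * T) (U (m₂ + j * T) x)
        - (f * (-1) ^ l) • ∑ᶠ j : ℕ, ((-1 : F) ^ j * bc χ (k : R) j) •
          half χ T φ A l (m₃ + (k - j) * T) m₁ (U (m₂ + j * T) x)) := by
  have e1 : EZ fun i : ℕ =>
      bc χ ((m₁ : R) * θ) i • half χ T U (Ca (l + i)) k m₂ (m₁ + m₃ - i * T) x := by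
    obtain ⟨N, hN⟩ := hCa.bdd
    exact ⟨(N - l).toNat, fun i hi => by simp [half, hN (l + i) (by omega)]⟩
  have e2 : EZ fun i : ℕ =>
      bc χ ((m₁ : R) * θ) i • half χ T (Ca (l + i)) U k (m₁ + m₃ - i * T) m₂ x := by
    obtain ⟨N, hN⟩ := hCa.bdd
    exact ⟨(N - l).toNat, fun i hi => by simp [half, hN (l + i) (by omega)]⟩
  have e3 := half_ez (χ := χ) hφ hA hT l m₁ m₃ x
  have e4 := hU.ez hT m₂ x
  have h1 : ∀ i : ℕ, bc χ ((m₁ : R) * θ) i • jl χ T h U (Ca (l + i)) k m₂ (m₁ + m₃ - i * T) x =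
      bc χ ((m₁ : R) * θ) i • half χ T U (Ca (l + i)) k m₂ (m₁ + m₃ - i * T) x -
      (h * (-1) ^ k) •
        bc χ ((m₁ : R) * θ) i • half χ T (Ca (l + i)) U k (m₁ + m₃ - i * T) m₂ x := by
    intro i
    rw [jl]; module
  rw [finsum_congr h1, EZ.finsum_sub e1 (e2.smul fun _ => h * (-1) ^ k), ← smul_finsum,
    hCa.finsum_half_left hCaT hT _ _ _ _ _ _ hm, hCa.finsum_half_right hU hT _ _ _ _ _ _ hm]
  congr 1
  · rw [smul_finsum, ← EZ.finsum_sub]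
    · refine finsum_congr fun j => ?_
      rw [jl, map_sub, map_smul]
      module
    · exact e3.1.of_imp fun j h => by simp [h]
    · exact e3.2.of_imp fun j h => by simp [h]
  · congr 1
    rw [smul_finsum, ← EZ.finsum_sub]
    · refine finsum_congr fun j => ?_
      rw [jl]
      module
    · exact e4.of_imp fun j h => by simp [h]
    · exact e4.of_imp fun j h => by simp [h]

/-- In the ordering with `φ` in the middle both factors are expanded independently of each other, so
the nested bracketings coincide; these terms will cancel. -/
theorem finsum_half_comm (hU : Trunc U) (hφ : Trunc φ) (hT : 0 < T) (l k m₁ m₂ m₃ : ℤ) (x : W) :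
    ∑ᶠ i : ℕ, ((-1 : F) ^ i * bc χ (l : R) i) •
        A (m₁ + (l - i) * T) (half χ T φ U k (m₃ + i * T) m₂ x) =
      ∑ᶠ j : ℕ, ((-1 : F) ^ j * bc χ (k : R) j) •
        half χ T A φ l m₁ (m₃ + (k - j) * T) (U (m₂ + j * T) x) := by
  have h1 : ∀ i : ℕ, ((-1 : F) ^ i * bc χ (l : R) i) •
      A (m₁ + (l - i) * T) (half χ T φ U k (m₃ + i * T) m₂ x) =
      ∑ᶠ j : ℕ, ((-1 : F) ^ i * bc χ (l : R) i) • ((-1 : F) ^ j * bc χ (k : R) j) •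
        A (m₁ + (l - i) * T) (φ (m₃ + i * T + (k - j) * T) (U (m₂ + j * T) x)) := by
    intro i
    rw [half, EZ.map_finsum (hU.half_ez hT _ _ _ _), smul_finsum]
    simp only [map_smul]
  rw [finsum_congr h1, BoxZ.finsum_comm]
  · refine finsum_congr fun j => ?_
    rw [half, smul_finsum]
    refine finsum_congr fun i => ?_
    rw [smul_comm, show m₃ + i * T + (k - j) * T = m₃ + (k - j) * T + i * T by ring]
  · refine BoxZ.swap (BoxZ.of_rows ?_ fun j => ?_)
    · obtain ⟨N, hN⟩ := hU.ez hT m₂ x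
      simp only at hN
      exact ⟨N, fun j hj i => by simp [hN j hj]⟩
    · exact (hφ.ez hT (m₃ + (k - j) * T) (U (m₂ + j * T) x)).of_imp fun i h => by
        rw [show m₃ + i * T + (k - j) * T = m₃ + (k - j) * T + i * T by ring, h]; simp

/-- With `φ` rightmost, the two orderings of `A` and `U` combine to their commutator, a finite sum
of fields `K P`. Rewriting the coefficients by `sum_bc_sub` amounts to expanding `x₁ - x₃ = (x₂ -
x₃) + (x₁ - x₂)` against the derivatives of the delta function. -/
theorem finsum_commutator_left (hθ : T * θ = 1) (hφ : Trunc φ) (hT : 0 < T)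
    {K : ℕ → ℤ → Module.End F W} {N : ℕ} (hK : ∀ P ≥ N, K P = 0)
    (hcomm : ∀ m n x, m ≡ r [ZMOD T] → A m (U n x) - e • U n (A m x) =
      ∑ᶠ P : ℕ, bc χ ((m : R) * θ) P • K P (m + n - P * T) x)
    (l k m₁ m₂ m₃ : ℤ) (x : W) (hm : m₁ ≡ r [ZMOD T]) :
    ∑ᶠ i : ℕ, ((-1 : F) ^ i * bc χ (l : R) i) •
        A (m₁ + (l - i) * T) (half χ T U φ k m₂ (m₃ + i * T) x) -
      e • ∑ᶠ j : ℕ, ((-1 : F) ^ j * bc χ (k : R) j) •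
        U (m₂ + (k - j) * T) (half χ T A φ l m₁ (m₃ + j * T) x) =
    ∑ P ∈ range N, ∑ q ∈ antidiagonal P, (bc χ (l : R) q.1 * bc χ ((m₁ : R) * θ) q.2) •
      half χ T (K P) φ (k + l - q.1) (m₁ + m₂ - q.2 * T) m₃ x := by
  have hz : ∀ t : ℕ, ∀ i j : ℕ, i + j = t →
      m₃ + i * T + j * T = m₃ + t * T := by
    intro t i j h
    rw [← h]; push_cast; ring
  have h1 : ∑ᶠ i : ℕ, ((-1 : F) ^ i * bc χ (l : R) i) •
      A (m₁ + (l - i) * T) (half χ T U φ k m₂ (m₃ + i * T) x) =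
      ∑ᶠ i : ℕ, ∑ᶠ j : ℕ, ((-1 : F) ^ (i + j) * (bc χ (l : R) i * bc χ (k : R) j)) •
        A (m₁ + (l - i) * T) (U (m₂ + (k - j) * T) (φ (m₃ + (i + j : ℕ) * T) x)) := by
    refine finsum_congr fun i => ?_
    rw [half, EZ.map_finsum (hφ.half_ez hT _ _ _ _), smul_finsum]
    refine finsum_congr fun j => ?_
    rw [map_smul, smul_smul, hz _ i j rfl, pow_add]
    congr 1; ring
  have h2 : ∑ᶠ j : ℕ, ((-1 : F) ^ j * bc χ (k : R) j) •
        U (m₂ + (k - j) * T) (half χ T A φ l m₁ (m₃ + j * T) x) =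
      ∑ᶠ j : ℕ, ∑ᶠ i : ℕ, ((-1 : F) ^ (i + j) * (bc χ (l : R) i * bc χ (k : R) j)) •
        U (m₂ + (k - j) * T) (A (m₁ + (l - i) * T) (φ (m₃ + (i + j : ℕ) * T) x)) := by
    refine finsum_congr fun i => ?_
    rw [half, EZ.map_finsum (hφ.half_ez hT _ _ _ _), smul_finsum]
    refine finsum_congr fun j => ?_
    rw [map_smul, smul_smul, hz _ i j rfl, pow_add, add_comm j i]
    congr 1; ring
  obtain ⟨M, hM⟩ := hφ.ez hT m₃ x
  simp only at hM
  have b1 : BoxZ fun i j : ℕ => ((-1 : F) ^ (i + j) * (bc χ (l : R) i * bc χ (k : R) j)) •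
        A (m₁ + (l - i) * T) (U (m₂ + (k - j) * T) (φ (m₃ + (i + j : ℕ) * T) x)) :=
    ⟨M, fun i j h => by simp only; rw [hM (i + j) (by omega)]; simp⟩
  have b2 : BoxZ fun i j : ℕ => ((-1 : F) ^ (i + j) * (bc χ (l : R) i * bc χ (k : R) j)) •
        U (m₂ + (k - j) * T) (A (m₁ + (l - i) * T) (φ (m₃ + (i + j : ℕ) * T) x)) :=
    ⟨M, fun i j h => by simp only; rw [hM (i + j) (by omega)]; simp⟩
  rw [h1, h2, ← b2.finsum_comm, b1.finsum_antidiagonal, b2.finsum_antidiagonal, smul_finsum,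
    ← EZ.finsum_sub b1.ez_sum_antidiagonal (b2.ez_sum_antidiagonal.smul fun _ => e)]
  -- For fixed `t` the operator `φ (m₃ + t * T)` and the mode of `K P` do not depend on `q`, so the
  -- sum over `q` is purely numerical.
  have h3 : ∀ t : ℕ, ∑ q ∈ antidiagonal t,
      ((-1 : F) ^ (q.1 + q.2) * (bc χ (l : R) q.1 * bc χ (k : R) q.2)) •
        A (m₁ + (l - q.1) * T) (U (m₂ + (k - q.2) * T) (φ (m₃ + (q.1 + q.2 : ℕ) * T) x)) -
      e • ∑ q ∈ antidiagonal t,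
      ((-1 : F) ^ (q.1 + q.2) * (bc χ (l : R) q.1 * bc χ (k : R) q.2)) •
        U (m₂ + (k - q.2) * T) (A (m₁ + (l - q.1) * T) (φ (m₃ + (q.1 + q.2 : ℕ) * T) x)) =
      ∑ P ∈ range N, ∑ q ∈ antidiagonal P, (bc χ (l : R) q.1 * bc χ ((m₁ : R) * θ) q.2) •
        ((-1 : F) ^ t * bc χ ((k + l - q.1 : ℤ) : R) t) •
          K P (m₁ + m₂ - q.2 * T + ((k + l - q.1 : ℤ) - t) * T) (φ (m₃ + t * T) x) := by
    intro t
    have h4 : ∀ q ∈ antidiagonal t,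
        ((-1 : F) ^ (q.1 + q.2) * (bc χ (l : R) q.1 * bc χ (k : R) q.2)) •
          A (m₁ + (l - q.1) * T) (U (m₂ + (k - q.2) * T) (φ (m₃ + (q.1 + q.2 : ℕ) * T) x)) -
        e • ((-1 : F) ^ (q.1 + q.2) * (bc χ (l : R) q.1 * bc χ (k : R) q.2)) •
          U (m₂ + (k - q.2) * T) (A (m₁ + (l - q.1) * T) (φ (m₃ + (q.1 + q.2 : ℕ) * T) x)) =
        ∑ P ∈ range N, ((-1 : F) ^ t * (bc χ (l : R) q.1 * bc χ (k : R) q.2 *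
          bc χ ((m₁ : R) * θ + l - q.1) P)) •
            K P (m₁ + m₂ + (k + l - t - P) * T) (φ (m₃ + t * T) x) := by
      intro q hq
      rw [HasAntidiagonal.mem_antidiagonal] at hq
      have hm' : m₁ + (l - q.1) * T ≡ r [ZMOD T] := by
        simpa using hm.add (Int.modEq_zero_iff_dvd.2 (dvd_mul_left (T : ℤ) (l - q.1)))
      rw [hq, smul_comm e, ← smul_sub, hcomm _ _ _ hm', finsum_eq_sum_range (n := N)
        fun P hP => by rw [hK P hP]; simp, smul_sum]
      refine sum_congr rfl fun P _ => ?_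
      rw [smul_smul]
      refine smul_apply_congr ?_ (by rw [← hq]; push_cast; ring) _
      rw [mul_assoc]
      congr 3
      push_cast
      linear_combination ((l : R) - q.1) * hθ
    rw [smul_sum, ← sum_sub_distrib, sum_congr rfl h4, sum_comm]
    refine sum_congr rfl fun P _ => ?_
    rw [← sum_smul, ← mul_sum, sum_bc_sub, mul_sum, sum_smul]
    refine sum_congr rfl fun q hq => ?_
    rw [HasAntidiagonal.mem_antidiagonal] at hq
    rw [smul_smul]
    refine smul_apply_congr ?_ (by rw [← hq]; push_cast; ring) _
    push_cast; ring
  rw [finsum_congr h3, finsum_finset_sum]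
  · refine sum_congr rfl fun P _ => ?_
    rw [finsum_finset_sum]
    · refine sum_congr rfl fun q _ => ?_
      rw [half, smul_finsum]
    · exact fun q _ => (hφ.ez hT m₃ x).of_imp fun t h => by simp [h]
  · intro P _
    refine (hφ.ez hT m₃ x).of_imp fun t h => ?_
    simp [h]

/-- The counterpart of `finsum_commutator_left` with `φ` leftmost. The expansions now run in the
opposite direction, so `sum_bc_add` replaces `sum_bc_sub` and its cutoff shifts the index of
summation. -/
theorem finsum_commutator_right (hθ : T * θ = 1) (hA : Trunc A) (hU : Trunc U) (hT : 0 < T)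
    {K : ℕ → ℤ → Module.End F W} {N : ℕ} (hK : ∀ P ≥ N, K P = 0) (hKT : ∀ P, Trunc (K P))
    (hcomm : ∀ m n x, m ≡ r [ZMOD T] → A m (U n x) - e • U n (A m x) =
      ∑ᶠ P : ℕ, bc χ ((m : R) * θ) P • K P (m + n - P * T) x)
    (l k m₁ m₂ m₃ : ℤ) (x : W) (hm : m₁ ≡ r [ZMOD T]) :
    ∑ᶠ j : ℕ, ((-1 : F) ^ j * bc χ (k : R) j) •
        half χ T φ A l (m₃ + (k - j) * T) m₁ (U (m₂ + j * T) x) -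
      e • ∑ᶠ i : ℕ, ((-1 : F) ^ i * bc χ (l : R) i) •
        half χ T φ U k (m₃ + (l - i) * T) m₂ (A (m₁ + i * T) x) =
    ∑ P ∈ range N, ∑ q ∈ antidiagonal P, (bc χ (l : R) q.1 * bc χ ((m₁ : R) * θ) q.2) •
      ((-1 : F) ^ q.1) • half χ T φ (K P) (k + l - q.1) m₃ (m₁ + m₂ - q.2 * T) x := by
  have h1 : ∑ᶠ j : ℕ, ((-1 : F) ^ j * bc χ (k : R) j) •
        half χ T φ A l (m₃ + (k - j) * T) m₁ (U (m₂ + j * T) x) =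
      ∑ᶠ j : ℕ, ∑ᶠ i : ℕ, ((-1 : F) ^ (i + j) * (bc χ (l : R) i * bc χ (k : R) j)) •
        φ (m₃ + (k + l - (i + j : ℕ)) * T) (A (m₁ + i * T) (U (m₂ + j * T) x)) := by
    refine finsum_congr fun j => ?_
    rw [half, smul_finsum]
    refine finsum_congr fun i => ?_
    rw [smul_smul, pow_add]
    exact smul_apply_congr (by ring) (by push_cast; ring) _
  have h2 : ∑ᶠ i : ℕ, ((-1 : F) ^ i * bc χ (l : R) i) •
        half χ T φ U k (m₃ + (l - i) * T) m₂ (A (m₁ + i * T) x) =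
      ∑ᶠ i : ℕ, ∑ᶠ j : ℕ, ((-1 : F) ^ (i + j) * (bc χ (l : R) i * bc χ (k : R) j)) •
        φ (m₃ + (k + l - (i + j : ℕ)) * T) (U (m₂ + j * T) (A (m₁ + i * T) x)) := by
    refine finsum_congr fun j => ?_
    rw [half, smul_finsum]
    refine finsum_congr fun i => ?_
    rw [smul_smul, pow_add]
    exact smul_apply_congr (by ring) (by push_cast; ring) _
  have b1 : BoxZ fun i j : ℕ => ((-1 : F) ^ (i + j) * (bc χ (l : R) i * bc χ (k : R) j)) •
        φ (m₃ + (k + l - (i + j : ℕ)) * T) (A (m₁ + i * T) (U (m₂ + j * T) x)) := by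
    refine BoxZ.swap (BoxZ.of_rows ?_ fun j => ?_)
    · obtain ⟨M, hM⟩ := hU.ez hT m₂ x
      simp only at hM
      exact ⟨M, fun j hj i => by simp [hM j hj]⟩
    · exact (hA.ez hT m₁ (U (m₂ + j * T) x)).of_imp fun i h => by simp [h]
  have b2 : BoxZ fun i j : ℕ => ((-1 : F) ^ (i + j) * (bc χ (l : R) i * bc χ (k : R) j)) •
        φ (m₃ + (k + l - (i + j : ℕ)) * T) (U (m₂ + j * T) (A (m₁ + i * T) x)) := by
    refine BoxZ.of_rows ?_ fun i => ?_
    · obtain ⟨M, hM⟩ := hA.ez hT m₁ x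
      simp only at hM
      exact ⟨M, fun j hj i => by simp [hM j hj]⟩
    · exact (hU.ez hT m₂ (A (m₁ + i * T) x)).of_imp fun i h => by simp [h]
  rw [h1, h2, ← b1.finsum_comm, b1.finsum_antidiagonal, b2.finsum_antidiagonal, smul_finsum,
    ← EZ.finsum_sub b1.ez_sum_antidiagonal (b2.ez_sum_antidiagonal.smul fun _ => e)]
  let G : ℕ → ℕ → ℕ → W := fun P p t =>
    φ (m₃ + (k + l - p - t : ℤ) * T) (K P (m₁ + m₂ + (p + t - P : ℤ) * T) x)
  have hG : ∀ P p (c : ℕ → F), EZ fun t => c t • G P p t := by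
    intro P p c
    refine ((hKT P).ez hT (m₁ + m₂ + (p - P : ℤ) * T) x).of_imp fun t h => ?_
    simp only [G]
    rw [show m₁ + m₂ + (p + t - P : ℤ) * T = m₁ + m₂ + (p - P : ℤ) * T + t * T by ring, h,
      map_zero, smul_zero]
  have hG' : ∀ P p (c d : F) (b : ℕ → F),
      EZ fun t => c • d • (if p ≤ t then b (t - p) • G P p (t - p) else 0) := by
    intro P p c d b
    obtain ⟨n, hn⟩ := hG P p b
    refine ⟨p + n, fun t ht => ?_⟩
    simp only at hn ⊢
    rw [hn (t - p) (by omega), ite_self, smul_zero, smul_zero]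
  have h3 : ∀ t : ℕ, ∑ q ∈ antidiagonal t,
      ((-1 : F) ^ (q.1 + q.2) * (bc χ (l : R) q.1 * bc χ (k : R) q.2)) •
        φ (m₃ + (k + l - (q.1 + q.2 : ℕ)) * T) (A (m₁ + q.1 * T) (U (m₂ + q.2 * T) x)) -
      e • ∑ q ∈ antidiagonal t,
      ((-1 : F) ^ (q.1 + q.2) * (bc χ (l : R) q.1 * bc χ (k : R) q.2)) •
        φ (m₃ + (k + l - (q.1 + q.2 : ℕ)) * T) (U (m₂ + q.2 * T) (A (m₁ + q.1 * T) x)) =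
      ∑ P ∈ range N, ∑ q ∈ antidiagonal P, (bc χ (l : R) q.1 * bc χ ((m₁ : R) * θ) q.2) •
        (-1 : F) ^ q.1 • (if q.1 ≤ t then ((-1 : F) ^ (t - q.1) *
          bc χ ((k + l - q.1 : ℤ) : R) (t - q.1)) • G P q.1 (t - q.1) else 0) := by
    intro t
    have h4 : ∀ q ∈ antidiagonal t,
        ((-1 : F) ^ (q.1 + q.2) * (bc χ (l : R) q.1 * bc χ (k : R) q.2)) •
          φ (m₃ + (k + l - (q.1 + q.2 : ℕ)) * T) (A (m₁ + q.1 * T) (U (m₂ + q.2 * T) x)) -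
        e • ((-1 : F) ^ (q.1 + q.2) * (bc χ (l : R) q.1 * bc χ (k : R) q.2)) •
          φ (m₃ + (k + l - (q.1 + q.2 : ℕ)) * T) (U (m₂ + q.2 * T) (A (m₁ + q.1 * T) x)) =
        ∑ P ∈ range N, ((-1 : F) ^ t * (bc χ (l : R) q.1 * bc χ (k : R) q.2 *
          bc χ ((m₁ : R) * θ + q.1) P)) • G P 0 t := by
      intro q hq
      rw [HasAntidiagonal.mem_antidiagonal] at hq
      have hm' : m₁ + q.1 * T ≡ r [ZMOD T] := by
        simpa using hm.add (Int.modEq_zero_iff_dvd.2 (dvd_mul_left (T : ℤ) (q.1 : ℤ)))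
      rw [hq, smul_comm e, ← smul_sub, ← map_smul, ← map_sub, hcomm _ _ _ hm',
        finsum_eq_sum_range (n := N) fun P hP => by rw [hK P hP]; simp, map_sum, smul_sum]
      refine sum_congr rfl fun P _ => ?_
      rw [map_smul, smul_smul]
      refine smul_apply_apply_congr ?_ (by push_cast; ring) (by rw [← hq]; push_cast; ring) _
      rw [mul_assoc]
      congr 3
      push_cast
      linear_combination (q.1 : R) * hθ
    rw [smul_sum, ← sum_sub_distrib, sum_congr rfl h4, sum_comm]
    refine sum_congr rfl fun P _ => ?_
    rw [← sum_smul, ← mul_sum, sum_bc_add, mul_sum, sum_smul]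
    refine sum_congr rfl fun q hq => ?_
    rw [HasAntidiagonal.mem_antidiagonal] at hq
    split_ifs with h
    · obtain ⟨t', rfl⟩ := Nat.exists_eq_add_of_le h
      rw [Nat.add_sub_cancel_left, smul_smul, smul_smul, pow_add]
      refine smul_apply_apply_congr ?_ (by push_cast; ring) (by push_cast; ring) _
      push_cast; ring
    · simp
  rw [finsum_congr h3, finsum_finset_sum]
  · refine sum_congr rfl fun P _ => ?_
    rw [finsum_finset_sum]
    · refine sum_congr rfl fun q hq => ?_
      rw [HasAntidiagonal.mem_antidiagonal] at hq
      rw [half, ← smul_finsum, ← smul_finsum]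
      congr 2
      refine (finsum_shift (f := fun t => ((-1 : F) ^ t * bc χ ((k + l - q.1 : ℤ) : R) t) •
        G P q.1 t) (hG P q.1 fun t => (-1 : F) ^ t * bc χ ((k + l - q.1 : ℤ) : R) t) q.1).trans
        (finsum_congr fun t => ?_)
      exact smul_apply_apply_congr rfl (by ring) (by rw [← hq]; push_cast; ring) _
    · exact fun q _ => hG' _ _ _ _ fun t => (-1 : F) ^ t * bc χ ((k + l - q.1 : ℤ) : R) t
  · exact fun P _ => EZ.finset_sum _ _ fun q _ =>
      hG' _ _ _ _ fun t => (-1 : F) ^ t * bc χ ((k + l - q.1 : ℤ) : R) t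

/-- The super Jacobi identity `[U, [A, φ]] = e [A, [U, φ]] - e [[A, U], φ]` of operators, multiplied
by `(x₁ - x₃) ^ l (x₂ - x₃) ^ k`. It is the common source of Dong's lemma and of the commutator
formula for products. -/
theorem IsProd.finsum_jl_eq (hθ : T * θ = 1) (hT : 0 < T) (he : e * e = 1)
    (hA : Trunc A) (hU : Trunc U) (hφ : Trunc φ)
    (hCa : IsProd χ T θ r f A φ Ca) (hCaT : ∀ l, Trunc (Ca l))
    (hCu : IsProd χ T θ s h U φ Cu) (hCuT : ∀ l, Trunc (Cu l))
    {K : ℕ → ℤ → Module.End F W} {N : ℕ} (hK : ∀ P ≥ N, K P = 0) (hKT : ∀ P, Trunc (K P))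
    (hcomm : ∀ m n x, m ≡ r [ZMOD T] → A m (U n x) - e • U n (A m x) =
      ∑ᶠ P : ℕ, bc χ ((m : R) * θ) P • K P (m + n - P * T) x)
    (l k m₁ m₂ m₃ : ℤ) (x : W) (hm : m₁ ≡ r [ZMOD T]) (hm' : m₂ ≡ s [ZMOD T]) :
    ∑ᶠ i : ℕ, bc χ ((m₁ : R) * θ) i • jl χ T (e * h) U (Ca (l + i)) k m₂ (m₁ + m₃ - i * T) x =
      e • ∑ᶠ j : ℕ, bc χ ((m₂ : R) * θ) j •
          jl χ T (e * f) A (Cu (k + j)) l m₁ (m₂ + m₃ - j * T) x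
        - e • ∑ P ∈ range N, ∑ q ∈ antidiagonal P, (bc χ (l : R) q.1 * bc χ ((m₁ : R) * θ) q.2) •
          jl χ T (f * h) (K P) φ (k + l - q.1) (m₁ + m₂ - q.2 * T) m₃ x := by
  have h1 := hCa.finsum_jl hCaT hA hU hφ hT (e * h) l k m₁ m₂ m₃ x hm
  have h2 := hCu.finsum_jl hCuT hU hA hφ hT (e * f) k l m₂ m₁ m₃ x hm'
  have h3 := finsum_half_comm (χ := χ) (A := A) hU hφ hT l k m₁ m₂ m₃ x
  have h4 := finsum_half_comm (χ := χ) (A := U) hA hφ hT k l m₂ m₁ m₃ x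
  have h5 := finsum_commutator_left hθ hφ hT hK hcomm l k m₁ m₂ m₃ x hm
  have h6 := finsum_commutator_right (φ := φ) hθ hA hU hT hK hKT hcomm l k m₁ m₂ m₃ x hm
  have h7 : ∑ P ∈ range N, ∑ q ∈ antidiagonal P, (bc χ (l : R) q.1 * bc χ ((m₁ : R) * θ) q.2) •
      jl χ T (f * h) (K P) φ (k + l - q.1) (m₁ + m₂ - q.2 * T) m₃ x =
      ∑ P ∈ range N, ∑ q ∈ antidiagonal P, (bc χ (l : R) q.1 * bc χ ((m₁ : R) * θ) q.2) •
        half χ T (K P) φ (k + l - q.1) (m₁ + m₂ - q.2 * T) m₃ x -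
      (f * h * ((-1) ^ k * (-1) ^ l)) • ∑ P ∈ range N, ∑ q ∈ antidiagonal P,
        (bc χ (l : R) q.1 * bc χ ((m₁ : R) * θ) q.2) •
        ((-1 : F) ^ q.1) • half χ T φ (K P) (k + l - q.1) m₃ (m₁ + m₂ - q.2 * T) x := by
    simp only [smul_sum, ← sum_sub_distrib]
    refine sum_congr rfl fun P _ => sum_congr rfl fun q _ => ?_
    have : (-1 : F) ^ (k + l - q.1 : ℤ) = (-1) ^ k * (-1) ^ l * (-1) ^ q.1 := by
      rw [zpow_sub₀ (by simp), zpow_add₀ (by simp), zpow_natCast, div_eq_mul_inv, ← inv_pow,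
        inv_neg_one]
    rw [jl, this]
    module
  rw [← h5, ← h6] at h7
  rw [h7, h1, h2, h3, h4]
  -- With `e = 1` or `e = -1` inserted, what remains is a linear identity between the expanded sums.
  rcases mul_self_eq_one_iff.1 he with rfl | rfl <;> module

end Triple

/-! ### Linearity of products, Dong's lemma and the commutator formula -/

section Products

open Finset

variable {F : Type u} [Field F] {R : Type*} [CommRing R] [BinomialRing R] {χ : R →+* F}
  {T : ℕ} {θ : R} {W : Type w} [AddCommGroup W] [Module F W]
  {A U φ φ' : ℤ → Module.End F W} {C C' Ca Cu : ℤ → ℤ → Module.End F W} {r s : ℤ} {e f h : F}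

theorem jl_field_add (hA : Trunc A) (hφ : Trunc φ) (hφ' : Trunc φ') (hT : 0 < T) (l m n : ℤ)
    (x : W) : jl χ T e A (φ + φ') l m n x = jl χ T e A φ l m n x + jl χ T e A φ' l m n x := by
  have h1 : half χ T A (φ + φ') l m n x = half χ T A φ l m n x + half χ T A φ' l m n x := by
    rw [half, half, half, ← EZ.finsum_add (hφ.half_ez hT _ _ _ _) (hφ'.half_ez hT _ _ _ _)]
    simp
  have h2 : half χ T (φ + φ') A l n m x = half χ T φ A l n m x + half χ T φ' A l n m x := by
    rw [half, half, half, ← EZ.finsum_add (hA.half_ez hT _ _ _ _) (hA.half_ez hT _ _ _ _)]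
    simp
  rw [jl, jl, jl, h1, h2]
  module

theorem jl_field_smul (c : F) (l m n : ℤ) (x : W) :
    jl χ T e A (c • φ) l m n x = c • jl χ T e A φ l m n x := by
  have h1 : half χ T A (c • φ) l m n x = c • half χ T A φ l m n x := by
    rw [half, half, smul_finsum]
    exact finsum_congr fun i => by simp [smul_comm c]
  have h2 : half χ T (c • φ) A l n m x = c • half χ T φ A l n m x := by
    rw [half, half, smul_finsum]
    exact finsum_congr fun i => by simp [smul_comm c]
  rw [jl, jl, h1, h2]
  module

theorem jl_smul_field (c : F) (l m n : ℤ) (x : W) :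
    jl χ T e (c • φ) A l m n x = c • jl χ T e φ A l m n x := by
  have h1 : half χ T A (c • φ) l n m x = c • half χ T A φ l n m x := by
    rw [half, half, smul_finsum]
    exact finsum_congr fun i => by simp [smul_comm c]
  have h2 : half χ T (c • φ) A l m n x = c • half χ T φ A l m n x := by
    rw [half, half, smul_finsum]
    exact finsum_congr fun i => by simp [smul_comm c]
  rw [jl, jl, h1, h2]
  module

@[simp] theorem jl_field_zero (l m n : ℤ) (x : W) : jl χ T e A 0 l m n x = 0 := by
  simp [jl, half]

theorem IsLocal.field_add (hA : Trunc A) (hφ : Trunc φ) (hφ' : Trunc φ') (hT : 0 < T)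
    (h : IsLocal χ T r e A φ) (h' : IsLocal χ T r e A φ') : IsLocal χ T r e A (φ + φ') := by
  obtain ⟨N, hN⟩ := h
  obtain ⟨N', hN'⟩ := h'
  refine ⟨max N N', fun l hl m n x hm => ?_⟩
  rw [jl_field_add hA hφ hφ' hT, hN l (le_trans (le_max_left _ _) hl) m n x hm,
    hN' l (le_trans (le_max_right _ _) hl) m n x hm, add_zero]

theorem IsLocal.field_smul (c : F) (h : IsLocal χ T r e A φ) : IsLocal χ T r e A (c • φ) := by
  obtain ⟨N, hN⟩ := h
  exact ⟨N, fun l hl m n x hm => by rw [jl_field_smul, hN l hl m n x hm, smul_zero]⟩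

theorem IsLocal.field_zero : IsLocal χ T r e A 0 := ⟨0, fun _ _ _ _ _ _ => jl_field_zero _ _ _ _⟩

theorem IsProd.field_add (hA : Trunc A) (hφ : Trunc φ) (hφ' : Trunc φ') (hT : 0 < T)
    (h : IsProd χ T θ r e A φ C) (h' : IsProd χ T θ r e A φ' C') :
    IsProd χ T θ r e A (φ + φ') (C + C') := by
  constructor
  · obtain ⟨N, hN⟩ := h.bdd
    obtain ⟨N', hN'⟩ := h'.bdd
    exact ⟨max N N', fun l hl => by
      simp [hN l (le_trans (le_max_left _ _) hl), hN' l (le_trans (le_max_right _ _) hl)]⟩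
  · intro l m n x hm
    rw [jl_field_add hA hφ hφ' hT, h.eq l m n x hm, h'.eq l m n x hm, jr, jr, jr,
      ← EZ.finsum_add (jr_ez h.bdd _ _ _ _) (jr_ez h'.bdd _ _ _ _)]
    simp

theorem IsProd.field_smul (c : F) (h : IsProd χ T θ r e A φ C) :
    IsProd χ T θ r e A (c • φ) (c • C) := by
  constructor
  · obtain ⟨N, hN⟩ := h.bdd
    exact ⟨N, fun l hl => by simp [hN l hl]⟩
  · intro l m n x hm
    rw [jl_field_smul, h.eq l m n x hm, jr, jr, smul_finsum]
    exact finsum_congr fun i => by simp [smul_comm c]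

theorem IsProd.smul_field (c : F) (h : IsProd χ T θ r e A φ C) :
    IsProd χ T θ r e (c • A) φ (c • C) := by
  constructor
  · obtain ⟨N, hN⟩ := h.bdd
    exact ⟨N, fun l hl => by simp [hN l hl]⟩
  · intro l m n x hm
    rw [jl_smul_field, h.eq l m n x hm, jr, jr, smul_finsum]
    exact finsum_congr fun i => by simp [smul_comm c]

theorem IsProd.field_zero : IsProd χ T θ r e A 0 0 :=
  ⟨⟨0, fun _ _ => rfl⟩, fun l m n x _ => by simp [jr]⟩

/-- The Jacobi identity with `l = 0`, where both expansions consist of a single term. -/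
theorem IsProd.commutator (h : IsProd χ T θ r e A U C) (m n : ℤ) (x : W) (hm : m ≡ r [ZMOD T]) :
    A m (U n x) - e • U n (A m x) =
      ∑ᶠ P : ℕ, bc χ ((m : R) * θ) P • C P (m + n - P * T) x := by
  have h1 : ∀ (B B' : ℤ → Module.End F W) (m n : ℤ), half χ T B B' 0 m n x = B m (B' n x) := by
    intro B B' m n
    rw [half, finsum_eq_single _ 0 fun i hi => by simp [bc_zero_left, hi]]
    simp
  have h2 := h.eq 0 m n x hm
  rw [jl, h1, h1] at h2
  simpa [jr] using h2

/-- Dong's lemma. -/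
theorem IsProd.isLocal_of_isLocal (hθ : T * θ = 1) (hT : 0 < T) (he : e * e = 1)
    (hA : Trunc A) (hU : Trunc U) (hφ : Trunc φ)
    (hCa : IsProd χ T θ r f A φ Ca) (hCu : IsProd χ T θ s h U φ Cu)
    {K : ℕ → ℤ → Module.End F W} {N : ℕ} (hK : ∀ P ≥ N, K P = 0) (hKT : ∀ P, Trunc (K P))
    (hcomm : ∀ m n x, m ≡ r [ZMOD T] → A m (U n x) - e • U n (A m x) =
      ∑ᶠ P : ℕ, bc χ ((m : R) * θ) P • K P (m + n - P * T) x)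
    (hKl : ∀ P, IsLocal χ T (r + s) (f * h) (K P) φ) (l : ℤ) :
    IsLocal χ T s (e * h) U (Ca l) := by
  obtain ⟨k₀, hk₀⟩ := hCu.bdd
  choose k₁ hk₁ using hKl
  refine ⟨max k₀ (∑ P ∈ range N, |k₁ P| + N - l), fun k hk m₂ n x hm₂ => ?_⟩
  have hk' := le_trans (le_max_left _ _) hk
  have hk'' := le_trans (le_max_right _ _) hk
  -- Downward in `l'`, all terms of the three-field identity except `i = 0` on the left vanish:
  -- those with larger index by induction, the products `Cu` because `k` is large, and the `K P` by
  -- their locality. The bound on `k` depends on `l` only, as `l ≤ l'`.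
  refine int_down_induction (P := fun l' => l ≤ l' → ∀ n, jl χ T (e * h) U (Ca l') k m₂ n x = 0)
    ?_ (fun l' ih hl n => ?_) l le_rfl n
  · obtain ⟨M, hM⟩ := hCa.bdd
    exact ⟨M, fun l' hl' _ n => by rw [hM l' hl', jl_field_zero]⟩
  · have h1 := hCa.finsum_jl_eq hθ hT he hA hU hφ (hCa.trunc hθ hA hφ hT) hCu
      (hCu.trunc hθ hU hφ hT) hK hKT hcomm l' k r m₂ (n - r) x rfl hm₂
    rw [finsum_eq_single _ 0, finsum_eq_zero_of_forall_eq_zero, sum_eq_zero] at h1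
    · simpa using h1
    · refine fun P hP => sum_eq_zero fun q hq => ?_
      rw [hk₁, smul_zero]
      · have h3 := single_le_sum (f := fun P => |k₁ P|) (fun _ _ => abs_nonneg _) hP
        have h4 := le_abs_self (k₁ P)
        rw [HasAntidiagonal.mem_antidiagonal] at hq
        rw [mem_range] at hP
        omega
      · have := (hm₂.add_left r).sub (Int.modEq_zero_iff_dvd.2 (dvd_mul_left (T : ℤ) (q.2 : ℤ)))
        simpa using this
    · intro j
      rw [hk₀ _ (by omega), jl_field_zero, smul_zero]
    · intro i hi
      rw [ih _ (by omega) (by omega), smul_zero]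

/-- Collecting by `i + j`, `sum_bc_add` turns the double sum into sums of the shape `jr`, to which
the Jacobi identity of `B` and `φ` applies. It matches the iterated products in the commutator
formula with the `K P` terms of `IsProd.finsum_jl_eq`. -/
theorem IsProd.finsum_finsum_eq {B : ℤ → Module.End F W} {L : ℤ → ℤ → Module.End F W}
    (hL : IsProd χ T θ r e B φ L) (P : ℕ) (k l m₁ m₂ m₃ : ℤ) (x : W)
    (hm : m₁ + m₂ ≡ r [ZMOD T]) (hθ : T * θ = 1) :
    ∑ᶠ i : ℕ, bc χ ((m₁ : R) * θ) i • ∑ᶠ j : ℕ, bc χ ((m₂ : R) * θ) j •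
      bc χ ((l + i : ℤ) : R) P • L (k + j + (l + i) - P) (m₂ + (m₁ + m₃ - i * T) - j * T) x =
    ∑ q ∈ antidiagonal P, (bc χ (l : R) q.1 * bc χ ((m₁ : R) * θ) q.2) •
      jl χ T e B φ (k + l - q.1) (m₁ + m₂ - q.2 * T) m₃ x := by
  let G : ℕ → W := fun s => L (k + l - P + s) (m₁ + m₂ + m₃ - s * T) x
  have hG : EZ G := by
    obtain ⟨N, hN⟩ := hL.bdd
    exact ⟨(N - (k + l - P)).toNat, fun s hs => by simp only [G]; rw [hN _ (by omega)]; rfl⟩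
  have h1 : ∀ i : ℕ, bc χ ((m₁ : R) * θ) i • ∑ᶠ j : ℕ, bc χ ((m₂ : R) * θ) j •
      bc χ ((l + i : ℤ) : R) P • L (k + j + (l + i) - P) (m₂ + (m₁ + m₃ - i * T) - j * T) x =
      ∑ᶠ j : ℕ, (bc χ ((m₁ : R) * θ) i * bc χ ((m₂ : R) * θ) j * bc χ ((l : R) + i) P) •
        G (i + j) := by
    intro i
    rw [smul_finsum]
    refine finsum_congr fun j => ?_
    rw [smul_smul, smul_smul]
    simp only [G]
    rw [show k + j + (l + i) - (P : ℤ) = k + l - P + (i + j : ℕ) by push_cast; ring,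
      show m₂ + (m₁ + m₃ - i * T) - j * T = m₁ + m₂ + m₃ - (i + j : ℕ) * T by push_cast; ring,
      Int.cast_add, Int.cast_natCast]
  rw [finsum_congr h1, BoxZ.finsum_antidiagonal]
  · have h2 : ∀ s : ℕ, ∑ q ∈ antidiagonal s,
        (bc χ ((m₁ : R) * θ) q.1 * bc χ ((m₂ : R) * θ) q.2 * bc χ ((l : R) + q.1) P) •
          G (q.1 + q.2) = ∑ q ∈ antidiagonal P, (bc χ ((m₁ : R) * θ) q.1 * bc χ (l : R) q.2) •
            (if q.1 ≤ s then bc χ ((m₂ : R) * θ + m₁ * θ - q.1) (s - q.1) •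
              G (s - q.1 + q.1) else 0) := by
      intro s
      have h3 : ∀ q ∈ antidiagonal s,
        (bc χ ((m₁ : R) * θ) q.1 * bc χ ((m₂ : R) * θ) q.2 * bc χ ((l : R) + q.1) P) •
          G (q.1 + q.2) = (bc χ ((m₁ : R) * θ) q.1 * bc χ ((m₂ : R) * θ) q.2 *
            bc χ ((l : R) + q.1) P) • G s := by
        intro q hq
        rw [HasAntidiagonal.mem_antidiagonal.1 hq]
      rw [sum_congr rfl h3, ← sum_smul, sum_bc_add, sum_smul]
      refine sum_congr rfl fun q _ => ?_
      split_ifs with hq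
      · rw [smul_smul, Nat.sub_add_cancel hq]
      · simp
    have hGs : ∀ q : ℕ × ℕ, EZ fun t => bc χ ((m₂ : R) * θ + m₁ * θ - q.1) t • G (t + q.1) := by
      intro q
      obtain ⟨N, hN⟩ := hG
      exact ⟨N, fun t ht => by simp only; rw [hN _ (by omega), smul_zero]⟩
    rw [finsum_congr h2, finsum_finset_sum, ← Finset.Nat.sum_antidiagonal_swap]
    · refine sum_congr rfl fun q hq => ?_
      rw [HasAntidiagonal.mem_antidiagonal] at hq
      have hm' : m₁ + m₂ - q.2 * T ≡ r [ZMOD T] := by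
        simpa using hm.sub (Int.modEq_zero_iff_dvd.2 (dvd_mul_left (T : ℤ) (q.2 : ℤ)))
      rw [hL.eq _ _ _ _ hm', jr, ← smul_finsum, Prod.fst_swap, Prod.snd_swap,
        mul_comm (bc χ (l : R) q.1)]
      congr 1
      refine (finsum_shift (hGs q.swap) q.2).trans (finsum_congr fun t => ?_)
      simp only [G, Prod.fst_swap]
      rw [← hq, show k + l - ((q.1 + q.2 : ℕ) : ℤ) + (t + q.2 : ℕ) = k + l - q.1 + t by
        push_cast; ring, show m₁ + m₂ + m₃ - ((t + q.2 : ℕ) : ℤ) * T =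
          m₁ + m₂ - q.2 * T + m₃ - t * T by push_cast; ring]
      congr 2
      push_cast
      linear_combination (q.2 : R) * hθ
    · intro q _
      obtain ⟨N, hN⟩ := hGs q
      refine ⟨N + q.1, fun t ht => ?_⟩
      simp only at hN ⊢
      rw [hN (t - q.1) (by omega), ite_self, smul_zero]
  · obtain ⟨N, hN⟩ := hG
    exact ⟨N, fun i j hij => by simp only; rw [hN _ (by omega), smul_zero]⟩

/-- The commutator formula `A_l (U_k φ) - e U_k (A_l φ) = ∑ binom(l, P) (A_P U)_{k + l - P} φ` for
product fields, solved for `U_k (A_l φ)`. Both sides of the Jacobi identity in question satisfy the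
three-field identity at `m₁ = r`, which is unitriangular in `l`. -/
theorem IsProd.comm (hθ : T * θ = 1) (hT : 0 < T) (he : e * e = 1)
    (hA : Trunc A) (hU : Trunc U) (hφ : Trunc φ)
    (hCa : IsProd χ T θ r f A φ Ca) (hCu : IsProd χ T θ s h U φ Cu)
    {K : ℕ → ℤ → Module.End F W} {N : ℕ} (hK : ∀ P ≥ N, K P = 0) (hKT : ∀ P, Trunc (K P))
    (hcomm : ∀ m n x, m ≡ r [ZMOD T] → A m (U n x) - e • U n (A m x) =
      ∑ᶠ P : ℕ, bc χ ((m : R) * θ) P • K P (m + n - P * T) x)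
    {D : ℤ → ℤ → ℤ → Module.End F W} (hD : ∀ k, IsProd χ T θ r (e * f) A (Cu k) (D k))
    {L : ℕ → ℤ → ℤ → Module.End F W} (hL : ∀ P, IsProd χ T θ (r + s) (f * h) (K P) φ (L P))
    (l : ℤ) :
    IsProd χ T θ s (e * h) U (Ca l) fun k =>
      e • D k l - e • ∑ P ∈ range N, bc χ (l : R) P • L P (k + l - P) := by
  have hCaT := hCa.trunc hθ hA hφ hT
  have hCuT := hCu.trunc hθ hU hφ hT
  obtain ⟨k₀, hk₀⟩ := hCu.bdd
  have hD₀ : ∀ k ≥ k₀, D k = 0 := by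
    intro k hk
    refine (hD k).unique (A' := A) (ε' := e * f) IsProd.field_zero fun l n x => ?_
    rw [hk₀ k hk]
  have hLb := fun P => (hL P).bdd
  choose n₁ hn₁ using hLb
  have hE : ∀ l, ∀ k ≥ max k₀ (∑ P ∈ range N, |n₁ P| + N - l), e • D k l -
      e • ∑ P ∈ range N, bc χ (l : R) P • L P (k + l - P) = 0 := by
    intro l k hk
    have hk' := le_trans (le_max_left _ _) hk
    have hk'' := le_trans (le_max_right _ _) hk
    rw [hD₀ k hk', sum_eq_zero]
    · simp
    · intro P hP
      have h3 := single_le_sum (f := fun P => |n₁ P|) (fun _ _ => abs_nonneg _) hP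
      have h4 := le_abs_self (n₁ P)
      rw [mem_range] at hP
      rw [hn₁ P _ (by omega), smul_zero]
  refine ⟨⟨_, hE l⟩, fun k m₂ n x hm₂ => ?_⟩
  rw [← sub_eq_zero]
  -- The elimination runs over the index `l` of `A_l φ`, with `k` and `m₂` fixed; it needs both
  -- sides to vanish for large `l`.
  refine eq_zero_of_finsum_eq_zero (T : ℤ) (bc χ ((r : R) * θ)) (bc_zero _ _)
    (fun l n => jl χ T (e * h) U (Ca l) k m₂ n x - jr χ T θ (fun k =>
      e • D k l - e • ∑ P ∈ range N, bc χ (l : R) P • L P (k + l - P)) k m₂ n x) ?_ ?_ l n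
  · obtain ⟨M, hM⟩ := hCa.bdd
    have hDb := fun k => (hD k).bdd
    choose n₂ hn₂ using hDb
    refine ⟨max M (max (∑ P ∈ range N, |n₁ P| + N - k)
      (∑ j ∈ range (k₀ - k).toNat, |n₂ (k + j)|)), fun l hl n => ?_⟩
    have hl' := le_trans (le_max_left _ _) hl
    have hl'' := le_trans (le_max_left _ _) (le_trans (le_max_right _ _) hl)
    have hl₃ := le_trans (le_max_right _ _) (le_trans (le_max_right _ _) hl)
    rw [hM l hl', jl_field_zero, jr, finsum_eq_zero_of_forall_eq_zero, sub_zero]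
    intro j
    have hDj : D (k + j) l = 0 := by
      rcases le_or_gt k₀ (k + j) with h | h
      · rw [hD₀ _ h]; rfl
      · refine hn₂ _ _ ?_
        have hj : j ∈ range (k₀ - k).toNat := by rw [mem_range]; omega
        have h3 := single_le_sum (f := fun j : ℕ => |n₂ (k + j)|) (fun _ _ => abs_nonneg _) hj
        exact le_trans (le_abs_self _) (le_trans h3 hl₃)
    rw [hDj, sum_eq_zero]
    · simp
    · intro P hP
      have h3 := single_le_sum (f := fun P => |n₁ P|) (fun _ _ => abs_nonneg _) hP
      have h4 := le_abs_self (n₁ P)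
      rw [mem_range] at hP
      rw [hn₁ P _ (by omega), smul_zero]
  intro l n
  have h1 := hCa.finsum_jl_eq hθ hT he hA hU hφ hCaT hCu hCuT hK hKT hcomm l k r m₂ (n - r) x
    rfl hm₂
  have h2 : ∑ᶠ j : ℕ, bc χ ((m₂ : R) * θ) j •
      jl χ T (e * f) A (Cu (k + j)) l r (m₂ + (n - r) - j * T) x =
      ∑ᶠ i : ℕ, bc χ ((r : R) * θ) i • ∑ᶠ j : ℕ, bc χ ((m₂ : R) * θ) j •
        D (k + j) (l + i) (m₂ + (n - i * T) - j * T) x := by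
    have h3 : ∀ j : ℕ, bc χ ((m₂ : R) * θ) j •
        jl χ T (e * f) A (Cu (k + j)) l r (m₂ + (n - r) - j * T) x =
        ∑ᶠ i : ℕ, bc χ ((r : R) * θ) i • bc χ ((m₂ : R) * θ) j •
          D (k + j) (l + i) (m₂ + (n - i * T) - j * T) x := by
      intro j
      rw [(hD _).eq _ _ _ _ rfl, jr, smul_finsum]
      refine finsum_congr fun i => ?_
      rw [smul_comm, show r + (m₂ + (n - r) - j * T) - i * T = m₂ + (n - i * T) - j * T by ring]
    simp only [smul_finsum]
    rw [finsum_congr h3, BoxZ.finsum_comm]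
    refine BoxZ.of_rows ⟨(k₀ - k).toNat, fun j hj i => ?_⟩ fun j => ?_
    · rw [hD₀ _ (by omega)]; simp
    · exact (jr_ez (hD (k + j)).bdd (fun i => bc χ ((r : R) * θ) i)
        (fun i => m₂ + (n - i * T) - j * T) l x).of_imp fun i h => by rw [smul_comm, h, smul_zero]
  have h4 : ∀ P, ∑ q ∈ antidiagonal P, (bc χ (l : R) q.1 * bc χ ((r : R) * θ) q.2) •
      jl χ T (f * h) (K P) φ (k + l - q.1) (r + m₂ - q.2 * T) (n - r) x = _ := fun P =>
    ((hL P).finsum_finsum_eq P k l r m₂ (n - r) x (hm₂.add_left r) hθ).symm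
  have h5 : ∀ i : ℕ, bc χ ((r : R) * θ) i • jr χ T θ (fun k =>
      e • D k (l + i) - e • ∑ P ∈ range N, bc χ ((l + i : ℤ) : R) P • L P (k + (l + i) - P)) k m₂
        (n - i * T) x =
      e • bc χ ((r : R) * θ) i • ∑ᶠ j : ℕ, bc χ ((m₂ : R) * θ) j •
        D (k + j) (l + i) (m₂ + (n - i * T) - j * T) x -
      e • ∑ P ∈ range N, bc χ ((r : R) * θ) i • ∑ᶠ j : ℕ, bc χ ((m₂ : R) * θ) j •
        bc χ ((l + i : ℤ) : R) P • L P (k + j + (l + i) - P) (m₂ + (r + (n - r) - i * T) - j * T) x := by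
    intro i
    have d : ∀ a : F, EZ fun j : ℕ => a • bc χ ((m₂ : R) * θ) j •
        D (k + j) (l + i) (m₂ + (n - i * T) - j * T) x := fun a =>
      ⟨(k₀ - k).toNat, fun j hj => by simp [hD₀ _ (show k + j ≥ k₀ by omega)]⟩
    have d' : ∀ (a : F) (P : ℕ), EZ fun j : ℕ => a • bc χ ((m₂ : R) * θ) j •
        bc χ ((l + i : ℤ) : R) P •
          L P (k + j + (l + i) - P) (m₂ + (r + (n - r) - i * T) - j * T) x := fun a P =>
      ⟨(n₁ P - k - l - i + P).toNat, fun j hj => by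
        simp [hn₁ P (k + j + (l + i) - P) (by omega)]⟩
    have h6 : ∀ j : ℕ, bc χ ((m₂ : R) * θ) j • (fun k : ℤ => e • D k (l + i) -
        e • ∑ P ∈ range N, bc χ ((l + i : ℤ) : R) P • L P (k + (l + i) - P)) (k + j)
          (m₂ + (n - i * T) - j * T) x =
        e • bc χ ((m₂ : R) * θ) j • D (k + j) (l + i) (m₂ + (n - i * T) - j * T) x -
        ∑ P ∈ range N, e • bc χ ((m₂ : R) * θ) j • bc χ ((l + i : ℤ) : R) P •
          L P (k + j + (l + i) - P) (m₂ + (r + (n - r) - i * T) - j * T) x := by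
      intro j
      simp only [Pi.sub_apply, Pi.smul_apply, Finset.sum_apply, LinearMap.sub_apply,
        LinearMap.smul_apply, LinearMap.sum_apply, smul_sub, smul_sum, add_sub_cancel]
      rw [smul_comm e]
      congr 1
      exact sum_congr rfl fun P _ => by rw [smul_comm e (bc χ _ j), smul_comm e]
    rw [jr, finsum_congr h6, EZ.finsum_sub (d e) (EZ.finset_sum _ _ fun P _ => d' e P),
      finsum_finset_sum _ _ fun P _ => d' e P, smul_sub, ← smul_finsum, smul_comm, smul_sum,
      smul_sum]
    congr 1
    refine sum_congr rfl fun P _ => ?_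
    rw [← smul_finsum, smul_comm]
  have z1 : EZ fun i : ℕ => bc χ ((r : R) * θ) i • jl χ T (e * h) U (Ca (l + i)) k m₂
      (n - i * T) x := by
    obtain ⟨M, hM⟩ := hCa.bdd
    exact ⟨(M - l).toNat, fun i hi => by simp [hM (l + i) (by omega)]⟩
  have hDb := fun k => (hD k).bdd
  choose n₂ hn₂ using hDb
  have z2 : BoxZ fun i j : ℕ => bc χ ((r : R) * θ) i • bc χ ((m₂ : R) * θ) j •
        D (k + j) (l + i) (m₂ + (n - i * T) - j * T) x := by
    refine BoxZ.swap (BoxZ.of_rows ⟨(k₀ - k).toNat, fun j hj i => ?_⟩ fun j => ?_)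
    · rw [hD₀ _ (by omega)]; simp
    · exact ⟨(n₂ (k + j) - l).toNat, fun i hi => by simp [hn₂ (k + j) (l + i) (by omega)]⟩
  have z2' : EZ fun i : ℕ => bc χ ((r : R) * θ) i • ∑ᶠ j : ℕ, bc χ ((m₂ : R) * θ) j •
        D (k + j) (l + i) (m₂ + (n - i * T) - j * T) x := by
    simpa only [smul_finsum] using z2.outer
  have z3 : ∀ P, EZ fun i : ℕ => bc χ ((r : R) * θ) i • ∑ᶠ j : ℕ, bc χ ((m₂ : R) * θ) j •
      bc χ ((l + i : ℤ) : R) P •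
        L P (k + j + (l + i) - P) (m₂ + (r + (n - r) - i * T) - j * T) x := fun P =>
    ⟨(n₁ P - k - l + P).toNat, fun i hi => by
      simp only
      rw [finsum_eq_zero_of_forall_eq_zero, smul_zero]
      intro j
      simp [hn₁ P (k + j + (l + i) - P) (by omega)]⟩
  have z4 := (z2'.smul fun _ => e).sub ((EZ.finset_sum (range N) _ fun P _ => z3 P).smul fun _ => e)
  simp only [smul_sub]
  rw [finsum_congr fun i : ℕ => congrArg _ (h5 i), EZ.finsum_sub z1 z4,
    EZ.finsum_sub (z2'.smul fun _ => e) ((EZ.finset_sum (range N) _ fun P _ => z3 P).smul fun _ => e),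
    ← smul_finsum, ← smul_finsum, finsum_finset_sum _ _ fun P _ => z3 P, ← h2,
    ← sum_congr rfl fun P _ => h4 P]
  rw [sub_eq_zero, ← h1]
  exact finsum_congr fun i => by rw [add_sub_cancel]

end Products

/-! ### The identity field and divided power derivatives -/

section Derivative

open Finset

variable {F : Type u} [Field F] {R : Type*} [CommRing R] [BinomialRing R] {χ : R →+* F}
  {T : ℕ} {θ : R} {W : Type w} [AddCommGroup W] [Module F W]
  {A U φ : ℤ → Module.End F W} {r s : ℤ} {e : F}

variable (F W T) in
/-- The identity field. -/
def oneField : ℤ → Module.End F W := fun k => if k = -T then 1 else 0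

theorem oneField_eq_zero {k : ℤ} (h : k ≠ -T) : oneField F T W k = 0 := if_neg h

theorem oneField_trunc : Trunc (oneField F T W) := fun _ =>
  ⟨1, fun k hk => by rw [oneField_eq_zero (by omega)]; rfl⟩

theorem half_zero_exp (A B : ℤ → Module.End F W) (m n : ℤ) (x : W) :
    half χ T A B 0 m n x = A m (B n x) := by
  rw [half, finsum_eq_single _ 0 fun i hi => by simp [bc_zero_left, hi]]
  simp

theorem jl_swap (he : e * e = 1) (A B : ℤ → Module.End F W) (l m n : ℤ) (x : W) :
    jl χ T e A B l m n x = -(e * (-1) ^ l) • jl χ T e B A l n m x := by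
  have h : (-1 : F) ^ l * (-1) ^ l = 1 := by
    rw [← mul_zpow]; simp
  rw [jl, jl, smul_sub, smul_smul]
  have : -(e * (-1) ^ l) * (e * (-1) ^ l) = -1 := by linear_combination -(e * e) * h - he
  rw [this]
  module

/-- The identity commutes with everything, which is the case `l = 0`; the recursion in `l` does the
rest. -/
theorem jl_oneField_of_nonneg (hφ : Trunc φ) (hT : 0 < T) (l : ℤ) (hl : 0 ≤ l) (m n : ℤ) (x : W) :
    jl χ T 1 (oneField F T W) φ l m n x = 0 := by
  obtain ⟨l, rfl⟩ := Int.eq_ofNat_of_zero_le hl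
  induction l generalizing m n with
  | zero =>
    rw [Nat.cast_zero, jl, half_zero_exp, half_zero_exp, oneField]
    split_ifs <;> simp
  | succ l ih =>
    rw [Nat.cast_succ, jl_succ oneField_trunc hφ hT, ih _ _ (by omega), ih _ _ (by omega), sub_zero]

theorem half_oneField_left (hT : 0 < T) (l n : ℤ) (x : W) :
    half χ T (oneField F T W) φ l 0 n x = if l = -1 then φ n x else 0 := by
  have h : ∀ i : ℕ, (i : ℤ) ≠ l + 1 → oneField F T W (0 + (l - i) * T) = 0 := by
    intro i hi
    refine oneField_eq_zero fun h => hi ?_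
    have : (l - i + 1) * T = 0 := by linear_combination h
    rcases mul_eq_zero.1 this with h | h <;> omega
  split_ifs with hl
  · subst hl
    rw [half, finsum_eq_single _ 0 fun i hi => by rw [h i (by omega)]; simp]
    simp [oneField]
  · refine finsum_eq_zero_of_forall_eq_zero fun i => ?_
    by_cases hi : (i : ℤ) = l + 1
    · obtain ⟨l', rfl⟩ := Int.eq_ofNat_of_zero_le (show 0 ≤ l by omega)
      rw [show i = l' + 1 by omega, Int.cast_natCast, bc_natCast, Nat.choose_succ_self]
      simp
    · rw [h i hi]; simp

theorem half_oneField_right (l m n : ℤ) (hn : ∀ i : ℕ, n + i * T ≠ -T) (x : W) :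
    half χ T φ (oneField F T W) l m n x = 0 :=
  finsum_eq_zero_of_forall_eq_zero fun i => by rw [oneField_eq_zero (hn i)]; simp

theorem zero_add_mul_ne (hT : 0 < T) (i : ℕ) : (0 : ℤ) + i * T ≠ -T := by
  have : (0 : ℤ) ≤ i * T := by positivity
  omega

theorem isProd_oneField_left (hθ : T * θ = 1) (hφ : Trunc φ) (hT : 0 < T) :
    IsProd χ T θ 0 1 (oneField F T W) φ fun l => if l = -1 then φ else 0 := by
  have hb : ∀ l ≥ 0, (if l = (-1 : ℤ) then φ else 0) = 0 := fun l hl => if_neg (by omega)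
  refine ⟨⟨0, hb⟩, fun l m n x hm => ?_⟩
  rw [← sub_eq_zero]
  refine eq_zero_of_recursion (T : ℤ) 0 (fun l m n => jl χ T 1 (oneField F T W) φ l m n x -
    jr χ T θ (fun l => if l = -1 then φ else 0) l m n x) ?_ ?_ ?_ l m n hm
  · intro l m n
    simp only [jl_succ oneField_trunc hφ hT, jr_succ hθ ⟨0, hb⟩]
    abel
  · exact ⟨0, fun l hl m n _ => by
      rw [jl_oneField_of_nonneg hφ hT l hl, jr_eq_zero fun l' hl' => hb l' (by omega), sub_zero]⟩
  · intro l m n hm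
    obtain ⟨d, hd⟩ := hm.dvd
    refine ⟨d, ?_⟩
    rw [show m + d * T = 0 by rw [mul_comm]; omega]
    generalize n - d * T = n'
    rw [jl, half_oneField_left hT, half_oneField_right _ _ _ (zero_add_mul_ne hT), jr,
      finsum_eq_single _ 0 fun i hi => by simp [bc_zero_left, hi]]
    simp only [Nat.cast_zero, Int.cast_zero, zero_mul, bc_zero, one_smul, add_zero, zero_add,
      sub_zero, smul_zero]
    split_ifs <;> simp

variable (χ T θ) in
/-- The divided power derivatives of a field. -/
def hasse (t : ℕ) (φ : ℤ → Module.End F W) : ℤ → Module.End F W :=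
  fun k => ((-1 : F) ^ t * bc χ ((k : R) * θ) t) • φ (k - t * T)

theorem hasse_apply (t : ℕ) (φ : ℤ → Module.End F W) (k : ℤ) (x : W) :
    hasse χ T θ t φ k x = ((-1 : F) ^ t * bc χ ((k : R) * θ) t) • φ (k - t * T) x := rfl

@[simp] theorem hasse_zero (φ : ℤ → Module.End F W) : hasse χ T θ 0 φ = φ := by
  funext k; simp [hasse]

/-- The product `U_{-1-t} 1` is the `t`-th divided derivative of `U`, by Taylor expansion of `U
(x₁)` about `x₂`. Divided powers are needed since `t!` may vanish in `F`. -/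
theorem isProd_oneField_right (hθ : T * θ = 1) (hU : Trunc U) (hT : 0 < T)
    (hs : ∀ k, ¬ k ≡ s [ZMOD T] → U k = 0) :
    IsProd χ T θ s 1 U (oneField F T W) fun l =>
      if l < 0 then hasse χ T θ (-1 - l).toNat U else 0 := by
  have hb : ∀ l ≥ 0, (if l < (0 : ℤ) then hasse χ T θ (-1 - l).toNat U else 0) = 0 :=
    fun l hl => if_neg (by omega)
  refine ⟨⟨0, hb⟩, fun l m n x hm => ?_⟩
  rw [← sub_eq_zero]
  refine eq_zero_of_recursion (T : ℤ) s (fun l m n => jl χ T 1 U (oneField F T W) l m n x -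
    jr χ T θ (fun l => if l < 0 then hasse χ T θ (-1 - l).toNat U else 0) l m n x) ?_ ?_ ?_ l m n hm
  · intro l m n
    simp only [jl_succ hU oneField_trunc hT, jr_succ hθ ⟨0, hb⟩]
    abel
  · exact ⟨0, fun l hl m n _ => by
      rw [jl_swap (by simp), jl_oneField_of_nonneg hU hT l hl,
        jr_eq_zero fun l' hl' => hb l' (by omega), smul_zero, sub_zero]⟩
  · intro l m n hm
    -- The identity field lives on multiples of `T`. If `T ∣ n`, the diagonal is followed to `n =
    -- 0`, where only one half can contribute; otherwise the left side vanishes, and so does the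
    -- right one by the support of `U`.
    by_cases hn : (T : ℤ) ∣ n
    · obtain ⟨d, rfl⟩ := hn
      refine ⟨d, ?_⟩
      rw [show T * d - d * T = (0 : ℤ) by ring]
      have hm' : m + d * T ≡ s [ZMOD T] := by
        simpa using hm.add (Int.modEq_zero_iff_dvd.2 (dvd_mul_left (T : ℤ) d))
      generalize m + d * T = m' at hm'
      rw [jl, half_oneField_left hT, half_oneField_right _ _ _ (zero_add_mul_ne hT), jr]
      rcases le_or_gt 0 l with hl | hl
      · rw [if_neg (by omega), finsum_eq_zero_of_forall_eq_zero]
        · simp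
        · exact fun i => by rw [hb _ (by omega)]; simp
      · obtain ⟨t, ht⟩ := Int.eq_ofNat_of_zero_le (show 0 ≤ -1 - l by omega)
        obtain rfl : l = -1 - t := by omega
        rw [finsum_eq_sum_range (n := t + 1) fun i hi => by
          rw [hb _ (by omega)]; simp]
        have h1 : ∀ i ∈ range (t + 1), bc χ ((m' : R) * θ) i •
            (if -1 - (t : ℤ) + i < 0 then hasse χ T θ (-1 - (-1 - (t : ℤ) + i)).toNat U else 0)
              (m' + 0 - i * T) x = ((-1 : F) ^ t * ((-1 : F) ^ i * (bc χ ((m' : R) * θ) i *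
                bc χ ((m' : R) * θ - i) (t - i)))) • U (m' - t * T) x := by
          intro i hi
          rw [mem_range] at hi
          obtain ⟨d, rfl⟩ := Nat.exists_eq_add_of_le (show i ≤ t by omega)
          have h5 : (-1 : F) ^ i * (-1) ^ i = 1 := by rw [← mul_pow]; simp
          rw [if_pos (by push_cast; omega),
            show (-1 - (-1 - ((i + d : ℕ) : ℤ) + i)).toNat = d by omega, hasse_apply, smul_smul,
            Nat.add_sub_cancel_left]
          refine smul_apply_congr ?_ (by push_cast; ring) x
          rw [show ((m' + 0 - i * T : ℤ) : R) * θ = m' * θ - i by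
            push_cast; linear_combination -(i : R) * hθ, pow_add]
          linear_combination -(-1 : F) ^ d * bc χ ((m' : R) * θ) i *
            bc χ ((m' : R) * θ - i) d * h5
        rw [sum_congr rfl h1, ← sum_smul, ← mul_sum, ← Nat.sum_antidiagonal_eq_sum_range_succ
          (fun i j => (-1 : F) ^ i * (bc χ ((m' : R) * θ) i * bc χ ((m' : R) * θ - i) j)),
          sum_neg_one_pow_bc]
        rcases Nat.eq_zero_or_pos t with rfl | ht'
        · simp
        · rw [if_neg (by omega), if_neg (by omega)]; simp
    · refine ⟨0, ?_⟩
      have h1 : ∀ i : ℤ, n + i * T ≠ -T := fun i h => hn ⟨-1 - i, by linear_combination h⟩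
      rw [zero_mul, add_zero, sub_zero, jl, half_oneField_right _ _ _ fun i => h1 i, half,
        jr, finsum_eq_zero_of_forall_eq_zero, finsum_eq_zero_of_forall_eq_zero]
      · simp
      · intro i
        split_ifs
        · rw [hasse_apply, hs]
          · simp
          · intro h
            refine hn ?_
            obtain ⟨c, hc⟩ := (h.trans hm.symm).dvd
            exact ⟨i + (-1 - (l + i)).toNat - c, by linear_combination -hc⟩
        · simp
      · intro i
        rw [oneField_eq_zero (h1 _)]; simp

/-- The Leibniz rule for the `t`-th divided `x₂`-derivative of `(x₁ - x₂) ^ l A(x₁) φ(x₂)`, where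
differentiating the power `q` times gives `(-1) ^ q binom(l, q) (x₁ - x₂) ^ (l - q)`. On
coefficients it is `sum_neg_one_pow_bc_mul_bc`. -/
theorem sum_smul_half_hasse_right (hφ : Trunc φ) (hT : 0 < T) (hθ : T * θ = 1) (t : ℕ) (l m n : ℤ)
    (x : W) : ∑ q ∈ antidiagonal t, ((-1 : F) ^ q.1 * bc χ (l : R) q.1) •
        half χ T A (hasse χ T θ q.2 φ) (l - q.1) m n x =
      ((-1 : F) ^ t * bc χ ((n : R) * θ) t) • half χ T A φ l m (n - t * T) x := by
  let G : ℕ → W := fun i => A (m + (l - i) * T) (φ (n - t * T + i * T) x)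
  have hG : EZ G := (hφ.ez hT (n - t * T) x).of_imp fun i h => by simp only [G]; rw [h, map_zero]
  have h1 : ∀ q ∈ antidiagonal t, ((-1 : F) ^ q.1 * bc χ (l : R) q.1) •
        half χ T A (hasse χ T θ q.2 φ) (l - q.1) m n x =
      ∑ᶠ i : ℕ, ((-1 : F) ^ (i + t) * bc χ (l : R) i * ((-1 : F) ^ q.1 *
        bc χ (i : R) q.1 * bc χ ((n : R) * θ + i - q.1) q.2)) • G i := by
    intro q hq
    rw [HasAntidiagonal.mem_antidiagonal] at hq
    have h2 : ∀ i : ℕ, ((-1 : F) ^ (i + t) * bc χ (l : R) i * ((-1 : F) ^ q.1 *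
        bc χ (i : R) q.1 * bc χ ((n : R) * θ + i - q.1) q.2)) • G i =
        if q.1 ≤ i then ((-1 : F) ^ q.1 * (-1 : F) ^ (i - q.1 + q.2) * (bc χ (l : R) q.1 *
          bc χ ((l : R) - q.1) (i - q.1)) * bc χ ((n : R) * θ + (i - q.1 : ℕ)) q.2) •
            G (i - q.1 + q.1) else 0 := by
      intro i
      have h3 := bc_mul_bc_natCast (χ := χ) (l : R) i q.1
      have h4 : (-1 : F) ^ (i + t) * bc χ (l : R) i * ((-1 : F) ^ q.1 *
        bc χ (i : R) q.1 * bc χ ((n : R) * θ + i - q.1) q.2) = (-1 : F) ^ (i + t) *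
        (-1 : F) ^ q.1 * bc χ ((n : R) * θ + i - q.1) q.2 * (bc χ (l : R) i *
        bc χ (i : R) q.1) := by ring
      rw [h4, h3]
      split_ifs with h
      · obtain ⟨d, rfl⟩ := Nat.exists_eq_add_of_le h
        have h5 : (-1 : F) ^ q.1 * (-1) ^ q.1 = 1 := by rw [← mul_pow]; simp
        rw [Nat.add_sub_cancel_left, ← hq, add_comm d q.1]
        congr 1
        rw [show (n : R) * θ + (q.1 + d : ℕ) - q.1 = n * θ + d by push_cast; ring]
        rw [show (-1 : F) ^ (q.1 + d + (q.1 + q.2)) = (-1) ^ (d + q.2) * ((-1) ^ q.1 * (-1) ^ q.1) by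
          ring, h5]
        ring
      · simp
    rw [finsum_congr h2, finsum_shift (f := fun i => ((-1 : F) ^ q.1 * (-1 : F) ^ (i + q.2) * (bc χ (l : R) q.1 *
          bc χ ((l : R) - q.1) i) * bc χ ((n : R) * θ + (i : ℕ)) q.2) • G (i + q.1)), half,
      smul_finsum]
    · refine finsum_congr fun i => ?_
      simp only [G]
      rw [hasse_apply, map_smul, smul_smul, smul_smul]
      refine smul_apply_apply_congr ?_ (by push_cast; ring) (by rw [← hq]; push_cast; ring) x
      rw [show ((n + i * T : ℤ) : R) * θ = n * θ + i by push_cast; linear_combination (i : R) * hθ]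
      push_cast
      ring
    · obtain ⟨N, hN⟩ := hG
      exact ⟨N, fun i hi => by simp only; rw [hN _ (by omega), smul_zero]⟩
  rw [sum_congr rfl h1, ← finsum_finset_sum _ _ fun q _ => hG.smul _, half, smul_finsum]
  refine finsum_congr fun i => ?_
  rw [← sum_smul, ← mul_sum, sum_neg_one_pow_bc_mul_bc, smul_smul]
  congr 1
  ring

theorem sum_smul_half_hasse_left (hA : Trunc A) (hT : 0 < T) (hθ : T * θ = 1) (t : ℕ) (l m n : ℤ)
    (x : W) : ∑ q ∈ antidiagonal t, bc χ (l : R) q.1 •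
        half χ T (hasse χ T θ q.2 φ) A (l - q.1) n m x =
      ((-1 : F) ^ t * bc χ ((n : R) * θ) t) • half χ T φ A l (n - t * T) m x := by
  have h1 : ∀ q ∈ antidiagonal t, bc χ (l : R) q.1 •
        half χ T (hasse χ T θ q.2 φ) A (l - q.1) n m x =
      ∑ᶠ i : ℕ, ((-1 : F) ^ (i + t) * bc χ (l : R) i * ((-1 : F) ^ q.1 *
        bc χ ((l : R) - i) q.1 * bc χ ((n : R) * θ + (l - i) - q.1) q.2)) •
          φ (n - t * T + (l - i) * T) (A (m + i * T) x) := by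
    intro q hq
    rw [HasAntidiagonal.mem_antidiagonal] at hq
    rw [half, smul_finsum]
    refine finsum_congr fun i => ?_
    rw [hasse_apply, smul_smul, smul_smul]
    refine smul_apply_congr ?_ (by rw [← hq]; push_cast; ring) _
    have h3 := bc_mul_bc_comm (χ := χ) (l : R) q.1 i
    have h5 : (-1 : F) ^ q.1 * (-1) ^ q.1 = 1 := by rw [← mul_pow]; simp
    rw [show ((n + ((l - q.1 : ℤ) - i) * T : ℤ) : R) * θ = n * θ + (l - i) - q.1 by
      push_cast; linear_combination ((l : R) - q.1 - i) * hθ, ← hq, pow_add, pow_add]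
    push_cast
    linear_combination (-1 : F) ^ i * (-1) ^ q.2 *
      bc χ ((n : R) * θ + (l - i) - q.1) q.2 * (h3 - bc χ (l : R) i * bc χ ((l : R) - i) q.1 * h5)
  rw [sum_congr rfl h1, ← finsum_finset_sum, half, smul_finsum]
  · refine finsum_congr fun i => ?_
    rw [← sum_smul, ← mul_sum, sum_neg_one_pow_bc_mul_bc, smul_smul]
    congr 1
    ring
  · exact fun q _ => hA.half_ez hT _ _ _ _

theorem jl_hasse (hA : Trunc A) (hφ : Trunc φ) (hT : 0 < T) (hθ : T * θ = 1) (t : ℕ) (l m n : ℤ)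
    (x : W) : ∑ q ∈ antidiagonal t, ((-1 : F) ^ q.1 * bc χ (l : R) q.1) •
        jl χ T e A (hasse χ T θ q.2 φ) (l - q.1) m n x =
      ((-1 : F) ^ t * bc χ ((n : R) * θ) t) • jl χ T e A φ l m (n - t * T) x := by
  rw [jl, smul_sub, smul_comm, ← sum_smul_half_hasse_left hA hT hθ,
    ← sum_smul_half_hasse_right hφ hT hθ, smul_sum, ← sum_sub_distrib]
  refine sum_congr rfl fun q _ => ?_
  have h5 : (-1 : F) ^ q.1 * (-1) ^ q.1 = 1 := by rw [← mul_pow]; simp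
  have : (-1 : F) ^ (l - q.1 : ℤ) = (-1) ^ l * (-1) ^ q.1 := by
    rw [zpow_sub₀ (by simp), zpow_natCast, div_eq_mul_inv, ← inv_pow, inv_neg_one]
  rw [jl, this, smul_sub, smul_smul, smul_smul]
  congr 2
  linear_combination bc χ (l : R) q.1 * e * (-1) ^ l * h5

/-- The Leibniz rule `∂⁽ᵗ⁾(A_l φ) = ∑ (-1) ^ q binom(l, q) A_{l-q} (∂⁽ᵗ⁻q⁾ φ)`. By unitriangularity
it may be checked after forming `jr` at `m = r`, where `jl_hasse` turns both sides into the same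
triple sum. -/
theorem IsProd.hasse_eq (hA : Trunc A) (hφ : Trunc φ) (hT : 0 < T) (hθ : T * θ = 1)
    {C : ℕ → ℤ → ℤ → Module.End F W}
    (hC : ∀ j, IsProd χ T θ r e A (hasse χ T θ j φ) (C j)) (t : ℕ) (l : ℤ) :
    hasse χ T θ t (C 0 l) =
      ∑ q ∈ antidiagonal t, ((-1 : F) ^ q.1 * bc χ (l : R) q.1) • C q.2 (l - q.1) := by
  funext k
  refine LinearMap.ext fun x => ?_
  rw [← sub_eq_zero]
  refine eq_zero_of_finsum_eq_zero (T : ℤ) (bc χ ((r : R) * θ)) (bc_zero _ _)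
    (fun l k => hasse χ T θ t (C 0 l) k x -
      (∑ q ∈ antidiagonal t, ((-1 : F) ^ q.1 * bc χ (l : R) q.1) • C q.2 (l - q.1)) k x) ?_ ?_ l k
  · have hb := fun j => (hC j).bdd
    choose N hN using hb
    refine ⟨∑ j ∈ range (t + 1), |N j| + t, fun l hl k => ?_⟩
    have h1 : ∀ j ≤ t, ∀ d ≤ t, C j (l - d) = 0 := by
      intro j hj d hd
      have h3 : |N j| ≤ ∑ j ∈ range (t + 1), |N j| := single_le_sum (f := fun j => |N j|)
        (fun _ _ => abs_nonneg _) (mem_range.2 (Nat.lt_succ_iff.2 hj))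
      have h4 := le_abs_self (N j)
      exact hN _ _ (by omega)
    have h2 := h1 0 (by omega) 0 (by omega)
    rw [Nat.cast_zero, sub_zero] at h2
    rw [h2, sum_eq_zero]
    · simp [hasse]
    · intro q hq
      rw [HasAntidiagonal.mem_antidiagonal] at hq
      rw [h1 _ (by omega) _ (by omega), smul_zero]
  intro l n
  obtain ⟨n, rfl⟩ : ∃ n', n = r + n' := ⟨n - r, by ring⟩
  have hmod : ∀ a : ℕ, r - a * T ≡ r [ZMOD T] := fun a => by
    simpa using (Int.ModEq.refl r).sub (Int.modEq_zero_iff_dvd.2 (dvd_mul_left (T : ℤ) (a : ℤ)))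
  have hcast : ∀ a : ℕ, ((r - a * T : ℤ) : R) * θ = r * θ - a := fun a => by
    push_cast; linear_combination -(a : R) * hθ
  have h1 : ∀ i : ℕ, bc χ ((r : R) * θ) i • hasse χ T θ t (C 0 (l + i)) (r + n - i * T) x =
      ∑ q ∈ antidiagonal t, ((-1 : F) ^ t * (bc χ ((r : R) * θ) q.1 * bc χ ((n : R) * θ) q.2)) •
        bc χ (((r - q.1 * T : ℤ) : R) * θ) i •
          C 0 (l + i) (r - q.1 * T + (n - q.2 * T) - i * T) x := by
    intro i
    rw [hasse_apply, show ((r + n - i * T : ℤ) : R) * θ = (r * θ - i) + n * θ by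
      push_cast; linear_combination -(i : R) * hθ, bc_add, mul_sum, sum_smul, smul_sum]
    refine sum_congr rfl fun q hq => ?_
    rw [HasAntidiagonal.mem_antidiagonal] at hq
    rw [smul_smul, smul_smul, hcast]
    refine smul_apply_congr ?_ (by rw [← hq]; push_cast; ring) x
    have := bc_mul_bc_comm (χ := χ) ((r : R) * θ) i q.1
    linear_combination (-1 : F) ^ t * bc χ ((n : R) * θ) q.2 * this
  have z1 : ∀ (j : ℕ) (c : F) (l' m n : ℤ), EZ fun i : ℕ =>
      c • bc χ ((m : R) * θ) i • C j (l' + i) (m + n - i * T) x := fun j c l' m n =>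
    (jr_ez (hC j).bdd _ (fun i => m + n - i * T) l' x).smul fun _ => c
  have h2 : ∑ᶠ i : ℕ, bc χ ((r : R) * θ) i • hasse χ T θ t (C 0 (l + i)) (r + n - i * T) x =
      ∑ q ∈ antidiagonal t, ∑ p ∈ antidiagonal q.2,
        ((-1 : F) ^ q.1 * bc χ ((r : R) * θ) q.1 * ((-1 : F) ^ p.1 * bc χ (l : R) p.1)) •
          jl χ T e A (hasse χ T θ p.2 φ) (l - p.1) (r - q.1 * T) n x := by
    rw [finsum_congr h1, finsum_finset_sum _ _ fun q _ => z1 0 _ _ _ _]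
    refine sum_congr rfl fun q hq => ?_
    rw [HasAntidiagonal.mem_antidiagonal] at hq
    have h3 := (hC 0).eq l (r - q.1 * T) (n - q.2 * T) x (hmod q.1)
    rw [hasse_zero] at h3
    rw [← smul_finsum, ← jr, ← h3]
    simp only [mul_smul]
    rw [← smul_sum, ← smul_sum]
    simp only [← mul_smul ((-1 : F) ^ _) (bc χ (l : R) _)]
    rw [jl_hasse hA hφ hT hθ, ← hq, pow_add]
    module
  have h4 : ∀ i : ℕ, bc χ ((r : R) * θ) i • (∑ q ∈ antidiagonal t,
      ((-1 : F) ^ q.1 * bc χ ((l + i : ℤ) : R) q.1) • C q.2 (l + i - q.1)) (r + n - i * T) x =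
      ∑ q ∈ antidiagonal t, ∑ p ∈ antidiagonal q.1,
        ((-1 : F) ^ p.1 * bc χ ((r : R) * θ) p.1 * ((-1 : F) ^ p.2 * bc χ (l : R) p.2)) •
        (if p.1 ≤ i then bc χ (((r - p.1 * T : ℤ) : R) * θ) (i - p.1) •
          C q.2 (l - p.2 + (i - p.1 : ℕ)) (r - p.1 * T + n - (i - p.1 : ℕ) * T) x else 0) := by
    intro i
    rw [Finset.sum_apply, LinearMap.sum_apply, smul_sum]
    refine sum_congr rfl fun q hq => ?_
    rw [Pi.smul_apply, LinearMap.smul_apply, smul_smul, Int.cast_add, Int.cast_natCast,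
      add_comm (l : R), bc_add, mul_sum, mul_sum, sum_smul]
    refine sum_congr rfl fun p hp => ?_
    rw [HasAntidiagonal.mem_antidiagonal] at hp
    have h5 := bc_mul_bc_natCast (χ := χ) ((r : R) * θ) i p.1
    have h6 : bc χ ((r : R) * θ) i * ((-1 : F) ^ q.1 * (bc χ (i : R) p.1 * bc χ (l : R) p.2)) =
      (-1 : F) ^ q.1 * bc χ (l : R) p.2 * (bc χ ((r : R) * θ) i * bc χ (i : R) p.1) := by ring
    rw [h6, h5, hcast]
    split_ifs with h
    · obtain ⟨d, rfl⟩ := Nat.exists_eq_add_of_le h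
      rw [smul_smul, Nat.add_sub_cancel_left, ← hp,
        show l + (p.1 + d : ℕ) - ((p.1 + p.2 : ℕ) : ℤ) = l - p.2 + d by push_cast; ring]
      refine smul_apply_congr ?_ (by push_cast; ring) x
      ring
    · simp
  have z2 : ∀ (j : ℕ) (c : F) (p : ℕ) (l' m : ℤ), EZ fun i : ℕ => c • (if p ≤ i then
      bc χ ((m : R) * θ) (i - p) • C j (l' + (i - p : ℕ)) (m + n - (i - p : ℕ) * T) x else 0) := by
    intro j c p l' m
    obtain ⟨N, hN⟩ := z1 j 1 l' m n
    refine ⟨N + p, fun i hi => ?_⟩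
    simp only [one_smul] at hN ⊢
    rw [hN (i - p) (by omega), ite_self, smul_zero]
  have h7 : ∑ᶠ i : ℕ, bc χ ((r : R) * θ) i • (∑ q ∈ antidiagonal t,
      ((-1 : F) ^ q.1 * bc χ ((l + i : ℤ) : R) q.1) • C q.2 (l + i - q.1)) (r + n - i * T) x =
      ∑ q ∈ antidiagonal t, ∑ p ∈ antidiagonal q.1,
        ((-1 : F) ^ p.1 * bc χ ((r : R) * θ) p.1 * ((-1 : F) ^ p.2 * bc χ (l : R) p.2)) •
          jl χ T e A (hasse χ T θ q.2 φ) (l - p.2) (r - p.1 * T) n x := by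
    rw [finsum_congr h4, finsum_finset_sum _ _ fun q _ => EZ.finset_sum _ _ fun p _ => z2 _ _ _ _ _]
    refine sum_congr rfl fun q _ => ?_
    rw [finsum_finset_sum _ _ fun p _ => z2 _ _ _ _ _]
    refine sum_congr rfl fun p _ => ?_
    rw [← smul_finsum, (hC q.2).eq _ _ _ _ (hmod p.1), jr, finsum_shift (f := fun i : ℕ =>
      bc χ (((r - p.1 * T : ℤ) : R) * θ) i • C q.2 (l - p.2 + i) (r - p.1 * T + n - i * T) x)]
    simpa using z1 q.2 1 (l - p.2) (r - p.1 * T) n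
  simp only [smul_sub]
  rw [EZ.finsum_sub, h2, h7, sum_antidiagonal_antidiagonal (fun a p j =>
    ((-1 : F) ^ a * bc χ ((r : R) * θ) a * ((-1 : F) ^ p * bc χ (l : R) p)) •
          jl χ T e A (hasse χ T θ j φ) (l - p) (r - a * T) n x), sub_self]
  · exact (EZ.finset_sum _ _ fun q _ => z1 0 _ _ _ _).of_imp fun i h => (h1 i).trans h
  · exact (EZ.finset_sum _ _ fun q _ => EZ.finset_sum _ _ fun p _ => z2 _ _ _ _ _).of_imp
      fun i h => (h4 i).trans h

end Derivative

/-! ### The enveloping algebra and its universal property -/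

section Envelope

variable {F : Type u} [Field F] {U : Type v} [AddCommGroup U] [Module F U]
  {B : LinearMap.BilinForm F U} {ℓ : F} {J : Type*}

/-- The mode `a_n`, as a linear function of `a`. -/
def modeLinear (B : LinearMap.BilinForm F U) (n : ℤ) : U →ₗ[F] Env B :=
  toEnv B ∘ₗ LinearMap.inl F _ _ ∘ₗ (TensorProduct.mk F U F[T;T⁻¹]).flip (LaurentPolynomial.T n)

theorem env_induction {P : Env B → Prop} (hs : ∀ c, P (algebraMap F _ c))
    (hm : ∀ a n, P (mode B a n)) (hc : P (toEnv B (central F U)))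
    (hadd : ∀ x y, P x → P y → P (x + y)) (hmul : ∀ x y, P x → P y → P (x * y)) (x : Env B) :
    P x := by
  have hsmul : ∀ (c : F) x, P x → P (c • x) := fun c x hx => by
    rw [Algebra.smul_def]; exact hmul _ _ (hs c) hx
  have h0 : P 0 := by simpa using hs 0
  obtain ⟨y, rfl⟩ := RingQuot.mkAlgHom_surjective F (EnvRel B) x
  induction y using TensorAlgebra.induction with
  | algebraMap c => rw [AlgHom.commutes]; exact hs c
  | add x y hx hy => rw [map_add]; exact hadd _ _ hx hy
  | mul x y hx hy => rw [map_mul]; exact hmul _ _ hx hy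
  | ι z =>
    obtain ⟨t, c⟩ := z
    change P (toEnv B (t, c))
    have h1 : ((t, c) : Affine F U) = (t, 0) + c • central F U := by simp [central]
    rw [h1, map_add, map_smul]
    refine hadd _ _ ?_ (hsmul _ _ hc)
    clear h1
    induction t using TensorProduct.induction_on with
    | zero => exact (map_zero (toEnv B)).symm ▸ h0
    | add x y hx hy =>
      have h2 : ((x + y, 0) : Affine F U) = (x, 0) + (y, 0) := by simp
      rw [h2, map_add]
      exact hadd _ _ hx hy
    | tmul a q =>
      induction q using LaurentPolynomial.induction_on' with
      | add p q hp hq =>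
        have h2 : ((a ⊗ₜ[F] (p + q), 0) : Affine F U) = (a ⊗ₜ p, 0) + (a ⊗ₜ q, 0) := by
          simp [TensorProduct.tmul_add]
        rw [h2, map_add]
        exact hadd _ _ hp hq
      | C_mul_T n c =>
        have h2 : ((a ⊗ₜ[F] (LaurentPolynomial.C c * LaurentPolynomial.T n), 0) : Affine F U) =
            c • loop a n := by
          rw [← LaurentPolynomial.smul_eq_C_mul, TensorProduct.tmul_smul, loop]
          simp
        rw [h2, map_smul]
        exact hsmul _ _ (hm a n)

/-- Algebra homomorphisms from the enveloping algebra. -/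
theorem exists_env_lift {E : Type*} [Ring E] [Algebra F E] (D : ℤ → U →ₗ[F] E) (z : E)
    (hD : ∀ a b m n, D m a * D n b + D n b * D m a = (if m + n + 1 = 0 then B a b else 0) • z)
    (hz : ∀ a m, z * D m a = D m a * z) :
    ∃ Φ : Env B →ₐ[F] E, (∀ a n, Φ (mode B a n) = D n a) ∧ Φ (toEnv B (central F U)) = z := by
  let g : F[T;T⁻¹] →ₗ[F] U →ₗ[F] E :=
    (Finsupp.lsum F fun n => LinearMap.toSpanSingleton F (U →ₗ[F] E) (D n)) ∘ₗ
      (AddMonoidAlgebra.coeffLinearEquiv F).toLinearMap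
  let L : Affine F U →ₗ[F] E :=
    LinearMap.coprod (TensorProduct.lift g.flip) (LinearMap.toSpanSingleton F E z)
  have hL : ∀ a n, L (loop a n) = D n a := by
    intro a n
    change L (a ⊗ₜ AddMonoidAlgebra.single n 1, 0) = _
    simp only [L, g, LinearMap.coprod_apply, TensorProduct.lift.tmul, LinearMap.flip_apply,
      LinearMap.comp_apply, map_zero, add_zero]
    change (Finsupp.lsum F fun n => LinearMap.toSpanSingleton F (U →ₗ[F] E) (D n))
      (Finsupp.single n 1) a = D n a
    simp
  have hc : L (central F U) = z := by simp [L, central]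
  refine ⟨RingQuot.liftAlgHom F ⟨TensorAlgebra.lift F L, ?_⟩, ?_, ?_⟩
  · intro x y h
    induction h with
    | odd a b m n =>
      simp only [map_add, map_mul, map_smul, TensorAlgebra.lift_ι_apply, hL, hc]
      exact hD a b m n
    | central a m => simpa [hL, hc] using hz a m
  · intro a n
    simp [mode, toEnv, hL]
  · simp [toEnv, hc]

end Envelope

/-- The properties of the vacuum module, its vacuum vector, the action `μ n a` of `a ⊗ t ^ n` and
its parity. -/
structure IsVacuumModule {F : Type u} [Field F] {U : Type v} [AddCommGroup U] [Module F U]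
    (B : LinearMap.BilinForm F U) (ℓ : F) {V : Type w} [AddCommGroup V] [Module F V] (vac : V)
    (μ : ℤ → U →ₗ[F] Module.End F V) (par : ZMod 2 → Submodule F V) : Prop where
  anticomm : ∀ a b m n, μ m a * μ n b + μ n b * μ m a =
    if m + n + 1 = 0 then (ℓ * B a b) • (1 : Module.End F V) else 0
  annih : ∀ a n, 0 ≤ n → μ n a vac = 0
  eq_top : ∀ N : Submodule F V, vac ∈ N → (∀ a n, ∀ v ∈ N, μ n a v ∈ N) → N = ⊤
  vac_mem : vac ∈ par 0
  mem_par : ∀ a n α, ∀ v ∈ par α, μ n a v ∈ par (α + 1)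
  par_le : ∀ N : ZMod 2 → Submodule F V, vac ∈ N 0 →
    (∀ a n α, ∀ v ∈ N α, μ n a v ∈ N (α + 1)) → ∀ α, par α ≤ N α

/-! ### The induced module, for an abstract algebra with the defining relations -/

section Quotient

variable {F : Type u} [Field F] {U : Type v} [AddCommGroup U] [Module F U]
  {B : LinearMap.BilinForm F U} {ℓ : F} {A : Type w} [Ring A] [Algebra F A]
  {μ : ℤ → U →ₗ[F] A} {c : A} {I : Submodule A A}

/-- These axioms are all that is used about the vacuum module besides its universal property. Linear
independence of the standard monomials is not among them; directness of the parity decomposition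
will come from the vertex operators. -/
theorem isVacuumModule_quotient
    (hind : ∀ P : A → Prop, (∀ c, P (algebraMap F A c)) → (∀ a n, P (μ n a)) → P c →
      (∀ x y, P x → P y → P (x + y)) → (∀ x y, P x → P y → P (x * y)) → ∀ x, P x)
    (hodd : ∀ a b m n, μ m a * μ n b + μ n b * μ m a = (if m + n + 1 = 0 then B a b else 0) • c)
    (hc : ∀ a m, c * μ m a = μ m a * c)
    (hI : I = Submodule.span A ({x | ∃ (a : U) (n : ℤ), 0 ≤ n ∧ x = μ n a} ∪
      {c - algebraMap F A ℓ})) :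
    IsVacuumModule B ℓ (Submodule.Quotient.mk 1 : A ⧸ I)
      (fun n => (Algebra.lsmul F F (A ⧸ I)).toLinearMap ∘ₗ μ n)
      (fun i => Submodule.span F {x | ∃ L : List (U × ℤ), (L.length : ZMod 2) = i ∧
        x = (L.map fun q => μ q.2 q.1).prod • (Submodule.Quotient.mk 1 : A ⧸ I)}) := by
  have hcv : ∀ v : A ⧸ I, c • v = ℓ • v := by
    have h1 : ∀ x : A, c * x = x * c := by
      refine hind _ ?_ ?_ rfl ?_ ?_
      · exact fun c => (Algebra.commutes c _).symm
      · exact fun a n => hc a n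
      · intro x y hx hy; rw [mul_add, add_mul, hx, hy]
      · intro x y hx hy; rw [← mul_assoc, hx, mul_assoc, hy, mul_assoc]
    -- As `c` is central, `c x - ℓ x = x (c - ℓ)`, which lies in the left ideal; so `c` acts as `ℓ`
    -- on all of the quotient.
    intro v
    obtain ⟨x, rfl⟩ := Submodule.Quotient.mk_surjective _ v
    rw [← sub_eq_zero, ← Submodule.Quotient.mk_smul, ← Submodule.Quotient.mk_smul,
      ← Submodule.Quotient.mk_sub, Submodule.Quotient.mk_eq_zero, smul_eq_mul, h1,
      Algebra.smul_def, Algebra.commutes, ← mul_sub, ← smul_eq_mul]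
    refine Submodule.smul_mem _ _ ?_
    rw [hI]
    exact Submodule.subset_span (Or.inr rfl)
  have hmk : ∀ x : A, x • (Submodule.Quotient.mk 1 : A ⧸ I) = Submodule.Quotient.mk x := fun x => by
    rw [← Submodule.Quotient.mk_smul, smul_eq_mul, mul_one]
  refine ⟨?_, ?_, ?_, ?_, ?_, ?_⟩
  · intro a b m n
    refine LinearMap.ext fun v => ?_
    have h1 : (μ m a * μ n b + μ n b * μ m a) • v =
        (if m + n + 1 = 0 then B a b else 0) • ℓ • v := by rw [hodd, smul_assoc, hcv]
    rw [add_smul, mul_smul, mul_smul] at h1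
    refine h1.trans ?_
    split_ifs
    · rw [smul_smul, mul_comm]; rfl
    · rw [zero_smul]; rfl
  · intro a n hn
    change μ n a • (Submodule.Quotient.mk 1 : A ⧸ I) = 0
    rw [hmk, Submodule.Quotient.mk_eq_zero, hI]
    exact Submodule.subset_span (Or.inl ⟨a, n, hn, rfl⟩)
  · intro N h0 h
    rw [eq_top_iff]
    intro v _
    obtain ⟨x, rfl⟩ := Submodule.Quotient.mk_surjective _ v
    rw [← hmk]
    suffices h1 : ∀ x : A, ∀ v ∈ N, x • v ∈ N from h1 x _ h0
    refine hind _ ?_ h ?_ ?_ ?_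
    · intro c v hv; rw [algebraMap_smul]; exact N.smul_mem _ hv
    · intro v hv; rw [hcv]; exact N.smul_mem _ hv
    · intro x y hx hy v hv; rw [add_smul]; exact N.add_mem (hx v hv) (hy v hv)
    · intro x y hx hy v hv; rw [mul_smul]; exact hx _ (hy v hv)
  · exact Submodule.subset_span ⟨[], by simp, by simp⟩
  · intro a n α v hv
    change μ n a • v ∈ _
    induction hv using Submodule.span_induction with
    | mem v hv =>
      obtain ⟨L, hL, rfl⟩ := hv
      exact Submodule.subset_span ⟨(a, n) :: L, by simp [hL], by simp [mul_smul]⟩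
    | zero => rw [smul_zero]; exact Submodule.zero_mem _
    | add v w _ _ hv hw => rw [smul_add]; exact Submodule.add_mem _ hv hw
    | smul c v _ hv => rw [smul_comm]; exact Submodule.smul_mem _ _ hv
  · intro N h0 h α
    refine Submodule.span_le.2 ?_
    rintro v ⟨L, rfl, rfl⟩
    induction L with
    | nil => simpa using h0
    | cons q L ih =>
      rw [List.map_cons, List.prod_cons, mul_smul, List.length_cons, Nat.cast_succ]
      exact h _ _ _ _ ih

/-- Frobenius reciprocity: the map `x ↦ Φ x w` kills the generators of the left ideal, hence the
ideal. -/
theorem exists_quotient_lift {M : Type*} [AddCommGroup M] [Module F M]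
    (hI : I = Submodule.span A ({x | ∃ (a : U) (n : ℤ), 0 ≤ n ∧ x = μ n a} ∪
      {c - algebraMap F A ℓ})) (Φ : A →ₐ[F] Module.End F M) (hΦ : Φ c = ℓ • 1)
    (w : M) (hw : ∀ a n, 0 ≤ n → Φ (μ n a) w = 0) :
    ∃ Ψ : (A ⧸ I) →ₗ[F] M, Ψ (Submodule.Quotient.mk 1) = w ∧ ∀ x v, Ψ (x • v) = Φ x (Ψ v) := by
  have hΨ : ∀ x ∈ I.restrictScalars F,
      x ∈ LinearMap.ker (LinearMap.applyₗ w ∘ₗ Φ.toLinearMap) := by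
    intro x hx
    simp only [LinearMap.mem_ker, LinearMap.comp_apply, AlgHom.toLinearMap_apply,
      LinearMap.applyₗ_apply_apply]
    subst hI
    induction hx using Submodule.span_induction with
    | mem x hx =>
      rcases hx with ⟨a, n, hn, rfl⟩ | hx
      · exact hw a n hn
      · rw [Set.mem_singleton_iff.1 hx, map_sub, hΦ, AlgHom.commutes]
        simp [Algebra.algebraMap_eq_smul_one]
    | zero => simp
    | add x y _ _ hx hy => rw [map_add, LinearMap.add_apply, hx, hy, add_zero]
    | smul c x _ hx => rw [smul_eq_mul, map_mul, Module.End.mul_apply, hx, map_zero]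
  refine ⟨(I.restrictScalars F).liftQ (LinearMap.applyₗ w ∘ₗ Φ.toLinearMap) hΨ, ?_, ?_⟩
  · change Φ 1 w = w
    simp
  · intro y v
    obtain ⟨x, rfl⟩ := Submodule.Quotient.mk_surjective _ v
    change Φ (y * x) w = Φ y (Φ x w)
    rw [map_mul]; rfl

end Quotient

/-! ### The vacuum module and its universal property -/

section Vacuum

variable {F : Type u} [Field F] {U : Type v} [AddCommGroup U] [Module F U]
  (B : LinearMap.BilinForm F U) (ℓ : F)

/-- The action of `a ⊗ t ^ n` on the vacuum module. -/
def vacMode (n : ℤ) : U →ₗ[F] Module.End F (VacuumModule B ℓ) :=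
  (Algebra.lsmul F F (VacuumModule B ℓ)).toLinearMap ∘ₗ modeLinear B n

theorem vacMode_apply (n : ℤ) (a : U) (v : VacuumModule B ℓ) :
    vacMode B ℓ n a v = mode B a n • v := rfl

theorem isVacuumModule :
    IsVacuumModule B ℓ (vacuumVector B ℓ) (vacMode B ℓ) (vacuumParity B ℓ) :=
  isVacuumModule_quotient (fun _ => env_induction) (toEnv_odd B) (toEnv_central B) rfl

theorem exists_vacuumModule_lift {M : Type*} [AddCommGroup M] [Module F M]
    (D : ℤ → U →ₗ[F] Module.End F M)
    (hD : ∀ a b m n, D m a * D n b + D n b * D m a =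
      if m + n + 1 = 0 then (ℓ * B a b) • (1 : Module.End F M) else 0)
    (w : M) (hw : ∀ a n, 0 ≤ n → D n a w = 0) :
    ∃ Ψ : VacuumModule B ℓ →ₗ[F] M, Ψ (vacuumVector B ℓ) = w ∧
      ∀ a n v, Ψ (vacMode B ℓ n a v) = D n a (Ψ v) := by
  obtain ⟨Φ, h1, h2⟩ := exists_env_lift (B := B) D (ℓ • 1)
    (fun a b m n => by rw [hD]; split_ifs <;> simp [smul_smul, mul_comm])
    (fun a m => by simp)
  obtain ⟨Ψ, h3, h4⟩ := exists_quotient_lift (ℓ := ℓ) (μ := modeLinear B) rfl Φ h2 w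
    fun a n hn => (congrArg (fun φ : Module.End F M => φ w) (h1 a n)).trans (hw a n hn)
  refine ⟨Ψ, h3, fun a n v => ?_⟩
  rw [vacMode_apply, ← h1]
  exact h4 _ _

end Vacuum

/-! ### From mode representations to a map from the vacuum module to fields -/

section FieldMap

variable {F : Type u} [Field F] {R : Type*} [CommRing R] [BinomialRing R] {χ : R →+* F}
  {T : ℕ} {θ : R} {W : Type w} [AddCommGroup W] [Module F W]
  {U : Type v} [AddCommGroup U] [Module F U] {B : LinearMap.BilinForm F U} {ℓ : F}
  {J : Type*} {f : Module.Basis J F U} {ρ : J → ℤ} {A : J → ℤ → Module.End F W}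

variable (F) in
/-- The sign `(-1) ^ α`. -/
def sg (α : ZMod 2) : F := if α = 1 then -1 else 1

theorem zmod_two_cases (α : ZMod 2) : α = 0 ∨ α = 1 := by
  revert α; decide

theorem zmod_two_add_self (α : ZMod 2) : α + 1 + 1 = α := by
  revert α; decide

@[simp] theorem sg_mul_self (α : ZMod 2) : sg F α * sg F α = 1 := by
  rw [sg]; split_ifs <;> simp

theorem sg_add_one (α : ZMod 2) : sg F (α + 1) = -sg F α := by
  rcases zmod_two_cases α with rfl | rfl <;> simp [sg, show (1 : ZMod 2) + 1 = 0 from rfl]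

theorem superSign_one_left (α : ZMod 2) : superSign F 1 α = sg F α := by
  simp [superSign, sg]

theorem superSign_add_one_left (α β : ZMod 2) :
    superSign F (α + 1) β = sg F β * superSign F α β := by
  rcases zmod_two_cases α with rfl | rfl <;> rcases zmod_two_cases β with rfl | rfl <;>
    simp [superSign, sg, show (1 : ZMod 2) + 1 = 0 from rfl]

theorem superSign_comm (α β : ZMod 2) : superSign F α β = superSign F β α := by
  simp [superSign, and_comm]

theorem sg_add (α β : ZMod 2) : sg F (α + β) = sg F α * sg F β := by
  rcases zmod_two_cases α with rfl | rfl <;> rcases zmod_two_cases β with rfl | rfl <;>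
    simp [sg, show (1 : ZMod 2) + 1 = 0 from rfl]

/-- Fields `A j` on `W` that satisfy the relations of the modes of the vectors `f j` on a twisted
module. -/
structure IsModeRep (T : ℕ) (B : LinearMap.BilinForm F U) (ℓ : F) (f : J → U) (ρ : J → ℤ)
    (A : J → ℤ → Module.End F W) : Prop where
  trunc : ∀ j, Trunc (A j)
  supp : ∀ j k, ¬ k ≡ ρ j [ZMOD T] → A j k = 0
  cls : ∀ i j, B (f i) (f j) ≠ 0 → ρ i + ρ j ≡ 0 [ZMOD T]
  rel : ∀ i j m n x, m ≡ ρ i [ZMOD T] → A i m (A j n x) + A j n (A i m x) =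
    if m + n + T = 0 then (ℓ * B (f i) (f j)) • x else 0

theorem IsProd.congr_class {r s : ℤ} {e : F} {A φ : ℤ → Module.End F W}
    {C : ℤ → ℤ → Module.End F W} (h : IsProd χ T θ r e A φ C) (hrs : r ≡ s [ZMOD T]) :
    IsProd χ T θ s e A φ C :=
  ⟨h.bdd, fun l m n x hm => h.eq l m n x (hm.trans hrs.symm)⟩

/-- The commutator field of two generators is a multiple of the identity field, which has class `0`.
If the multiple is nonzero, `ρ i + ρ j` is `0` modulo `T`; if it is zero, the class does not matter.
-/
theorem IsModeRep.isProd_scalar (hA : IsModeRep T B ℓ f ρ A) (hθ : T * θ = 1) (hT : 0 < T)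
    {φ : ℤ → Module.End F W} (hφ : Trunc φ) (i j : J) :
    IsProd χ T θ (ρ i + ρ j) 1 ((ℓ * B (f i) (f j)) • oneField F T W) φ
      fun l => if l = -1 then (ℓ * B (f i) (f j)) • φ else 0 := by
  by_cases h : B (f i) (f j) = 0
  · have : (fun l : ℤ => if l = -1 then (ℓ * B (f i) (f j)) • φ else 0) = 0 := by
      funext l; simp [h]
    rw [this, h, mul_zero, zero_smul]
    exact ⟨⟨0, fun _ _ => rfl⟩, fun l m n x _ => by simp [jl, jr, half]⟩
  · have h1 := ((isProd_oneField_left (χ := χ) hθ hφ hT).congr_class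
      (hA.cls i j h).symm).smul_field (ℓ * B (f i) (f j))
    refine ⟨?_, ?_⟩
    · exact ⟨0, fun l hl => if_neg (by omega)⟩
    · intro l m n x hm
      rw [h1.eq l m n x hm]
      congr 1
      funext l
      rw [Pi.smul_apply]
      split_ifs <;> simp

theorem IsModeRep.commutator (hA : IsModeRep T B ℓ f ρ A) (i j : J) (m n : ℤ) (x : W)
    (hm : m ≡ ρ i [ZMOD T]) : A i m (A j n x) - (-1 : F) • A j n (A i m x) =
      ∑ᶠ P : ℕ, bc χ ((m : R) * θ) P •
        (if P = 0 then (ℓ * B (f i) (f j)) • oneField F T W else 0) (m + n - P * T) x := by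
  rw [finsum_eq_single _ 0 fun P hP => by rw [if_neg hP]; simp, neg_one_smul, sub_neg_eq_add,
    hA.rel i j m n x hm]
  by_cases h : m + n + T = 0
  · have : m + n = -T := by omega
    simp [this, oneField]
  · have : m + n ≠ -T := by omega
    simp [h, this, oneField]

open Classical in
variable (χ T θ) in
/-- The products of two fields. -/
def prodField (r : ℤ) (e : F) (A φ : ℤ → Module.End F W) : ℤ → ℤ → Module.End F W :=
  if h : ∃ C, IsProd χ T θ r e A φ C then h.choose else 0

theorem isProd_prodField (hθ : T * θ = 1) (hT : 0 < T) {r : ℤ} {e : F}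
    {A φ : ℤ → Module.End F W} (hA : Trunc A) (hφ : Trunc φ) (h : IsLocal χ T r e A φ) :
    IsProd χ T θ r e A φ (prodField χ T θ r e A φ) := by
  obtain ⟨C, hC, -⟩ := exists_isProd hθ hA hφ hT h
  have h' : ∃ C, IsProd χ T θ r e A φ C := ⟨C, hC⟩
  rw [prodField, dif_pos h']
  exact h'.choose_spec

theorem IsProd.eq_prodField {r : ℤ} {e : F} {A φ : ℤ → Module.End F W}
    {C : ℤ → ℤ → Module.End F W} (h : IsProd χ T θ r e A φ C) : C = prodField χ T θ r e A φ := by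
  have h' : ∃ C, IsProd χ T θ r e A φ C := ⟨C, h⟩
  rw [prodField, dif_pos h']
  exact h.unique h'.choose_spec fun _ _ _ => rfl

variable (χ) in
/-- The space of pairs of fields that are local with the fields `A j`. -/
def fieldSpace (hT : 0 < T) (hA : IsModeRep T B ℓ f ρ A) :
    Submodule F (ZMod 2 → ℤ → Module.End F W) where
  carrier := {ψ | (∀ α, Trunc (ψ α)) ∧ ∀ α j, IsLocal χ T (ρ j) (sg F α) (A j) (ψ α)}
  add_mem' := fun h h' => ⟨fun α => (h.1 α).add (h'.1 α), fun α j =>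
    (h.2 α j).field_add (hA.trunc j) (h.1 α) (h'.1 α) hT (h'.2 α j)⟩
  zero_mem' := ⟨fun _ => Trunc.zero, fun _ _ => IsLocal.field_zero⟩
  smul_mem' := fun c _ h => ⟨fun α => (h.1 α).smul c, fun α j => (h.2 α j).field_smul c⟩

theorem IsModeRep.isProd_prodField (hθ : T * θ = 1) (hT : 0 < T) (hA : IsModeRep T B ℓ f ρ A)
    (ψ : fieldSpace χ hT hA) (α : ZMod 2) (j : J) :
    IsProd χ T θ (ρ j) (sg F α) (A j) (ψ.1 α)
      (prodField χ T θ (ρ j) (sg F α) (A j) (ψ.1 α)) :=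
  ModularClifford.isProd_prodField hθ hT (hA.trunc j) (ψ.2.1 α) (ψ.2.2 α j)

/-- The operator `ψ ↦ (A j)_n ψ` on pairs of fields. -/
def fieldOp (hθ : T * θ = 1) (hT : 0 < T) (hA : IsModeRep T B ℓ f ρ A) (n : ℤ) (j : J) :
    Module.End F (fieldSpace χ hT hA) where
  toFun ψ := ⟨fun α => prodField χ T θ (ρ j) (sg F (α + 1)) (A j) (ψ.1 (α + 1)) n, by
    have h := fun α j => hA.isProd_prodField hθ hT ψ α j
    refine ⟨fun α => (h (α + 1) j).trunc hθ (hA.trunc j) (ψ.2.1 _) hT n, fun α i => ?_⟩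
    -- Dong's lemma keeps the product in the space. Two generators anticommute up to the scalar
    -- field at `P = 0`, whence `e = -1` and `N = 1`; the shift of `α` accounts for the oddness of
    -- `A j`.
    have h1 := (h (α + 1) j).isLocal_of_isLocal hθ hT (e := -1) (by simp) (hA.trunc j)
      (hA.trunc i) (ψ.2.1 _) (h (α + 1) i)
      (K := fun P => if P = 0 then (ℓ * B (f j) (f i)) • oneField F T W else 0) (N := 1)
      (fun P hP => if_neg (by omega))
      (fun P => by
        split_ifs
        exacts [oneField_trunc.smul _, Trunc.zero])
      (hA.commutator j i) (fun P => by
        rw [sg_mul_self]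
        split_ifs
        · exact (hA.isProd_scalar hθ hT (ψ.2.1 _) j i).isLocal
        · exact ⟨0, fun l _ m n x _ => by simp [jl, half]⟩) n
    have h2 : -1 * sg F (α + 1) = sg F α := by rw [sg_add_one, neg_one_mul, neg_neg]
    rw [h2] at h1
    exact h1⟩
  map_add' ψ ψ' := by
    refine Subtype.ext (funext fun α => ?_)
    have h1 := (hA.isProd_prodField hθ hT ψ (α + 1) j).field_add (hA.trunc j) (ψ.2.1 _) (ψ'.2.1 _)
      hT (hA.isProd_prodField hθ hT ψ' (α + 1) j)
    exact (congrFun h1.eq_prodField n).symm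
  map_smul' c ψ := by
    refine Subtype.ext (funext fun α => ?_)
    have h1 := (hA.isProd_prodField hθ hT ψ (α + 1) j).field_smul c
    exact (congrFun h1.eq_prodField n).symm

/-- The affine relations hold for the action on fields: this is `IsProd.comm` with `e = -1`, where
only `P = 0` contributes. -/
theorem fieldOp_anticomm (hB : B.IsSymm) (hθ : T * θ = 1) (hT : 0 < T)
    (hA : IsModeRep T B ℓ f ρ A) (i j : J) (m n : ℤ) :
    fieldOp (χ := χ) hθ hT hA m i * fieldOp hθ hT hA n j +
      fieldOp hθ hT hA n j * fieldOp hθ hT hA m i =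
      if m + n + 1 = 0 then (ℓ * B (f i) (f j)) • 1 else 0 := by
  refine LinearMap.ext fun ψ => Subtype.ext (funext fun α => ?_)
  have h := fun ψ : fieldSpace χ hT hA => fun α j => hA.isProd_prodField hθ hT ψ α j
  have h1 := (h ψ α j).comm hθ hT (e := -1) (by simp) (hA.trunc j)
      (hA.trunc i) (ψ.2.1 _) (h ψ α i)
      (K := fun P => if P = 0 then (ℓ * B (f j) (f i)) • oneField F T W else 0) (N := 1)
      (fun P hP => if_neg (by omega))
      (fun P => by
        split_ifs
        exacts [oneField_trunc.smul _, Trunc.zero])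
      (hA.commutator j i)
      (D := fun k => prodField χ T θ (ρ j) (-1 * sg F α) (A j)
        (prodField χ T θ (ρ i) (sg F α) (A i) (ψ.1 α) k))
      (fun k => by
        have h2 := h (fieldOp hθ hT hA k i ψ) (α + 1) j
        rw [sg_add_one, ← neg_one_mul] at h2
        simpa only [fieldOp, LinearMap.coe_mk, AddHom.coe_mk, zmod_two_add_self] using h2)
      (L := fun P l => if P = 0 then if l = -1 then (ℓ * B (f j) (f i)) • ψ.1 α else 0 else 0)
      (fun P => by
        rw [sg_mul_self]
        split_ifs
        · exact hA.isProd_scalar hθ hT (ψ.2.1 _) j i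
        · exact ⟨⟨0, fun _ _ => rfl⟩, fun l m n x _ => by simp [jl, jr, half]⟩) n
  have h2 := congrFun h1.eq_prodField m
  have h3 : ∀ i j m n, (fieldOp hθ hT hA m i (fieldOp hθ hT hA n j ψ)).1 α =
      prodField χ T θ (ρ i) (-1 * sg F α) (A i)
        (prodField χ T θ (ρ j) (sg F α) (A j) (ψ.1 α) n) m := by
    intro i j m n
    change prodField χ T θ (ρ i) (sg F (α + 1)) (A i)
      (prodField χ T θ (ρ j) (sg F (α + 1 + 1)) (A j) (ψ.1 (α + 1 + 1)) n) m = _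
    rw [zmod_two_add_self, sg_add_one, neg_one_mul]
  change (fieldOp hθ hT hA m i (fieldOp hθ hT hA n j ψ)).1 α +
    (fieldOp hθ hT hA n j (fieldOp hθ hT hA m i ψ)).1 α = _
  rw [h3, h3, ← h2]
  simp only [Finset.sum_range_one, bc_zero, one_smul, if_true, Nat.cast_zero, sub_zero]
  -- The commutator formula delivers the form with its arguments exchanged, so symmetry is needed.
  rw [hB.eq (f j) (f i)]
  by_cases hmn : m + n + 1 = 0
  · rw [if_pos hmn, if_pos (by omega)]
    simp
  · rw [if_neg hmn, if_neg (by omega)]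
    simp

/-- The map from the vacuum module to fields determined by a mode representation. -/
structure IsFieldMap (χ : R →+* F) (T : ℕ) (θ : R) (f : J → U) (ρ : J → ℤ)
    (A : J → ℤ → Module.End F W) {V : Type*} [AddCommGroup V] [Module F V] (vac : V)
    (μ : ℤ → U →ₗ[F] Module.End F V) (Ψ : V →ₗ[F] ZMod 2 → ℤ → Module.End F W) : Prop where
  vac : Ψ vac = fun α => if α = 0 then oneField F T W else 0
  trunc : ∀ v α, Trunc (Ψ v α)
  prod : ∀ j v α, IsProd χ T θ (ρ j) (sg F α) (A j) (Ψ v α) fun l => Ψ (μ l (f j) v) (α + 1)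

theorem basis_induction (f : Module.Basis J F U) {P : U → Prop} (h : ∀ j, P (f j))
    (h0 : P 0) (hadd : ∀ a b, P a → P b → P (a + b)) (hsmul : ∀ (c : F) a, P a → P (c • a)) (a : U) :
    P a := by
  have := f.mem_span a
  induction this using Submodule.span_induction with
  | mem x hx => obtain ⟨j, rfl⟩ := hx; exact h j
  | zero => exact h0
  | add a b _ _ ha hb => exact hadd _ _ ha hb
  | smul c a _ ha => exact hsmul _ _ ha

/-- The identity field, placed in even parity, is a vacuum vector for the action on fields: its
products of index `n ≥ 0` vanish by `isProd_oneField_right`. The universal property of the vacuum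
module then provides the map. -/
theorem exists_isFieldMap (hB : B.IsSymm) (hθ : T * θ = 1) (hT : 0 < T)
    (hA : IsModeRep T B ℓ f ρ A) :
    ∃ Ψ : VacuumModule B ℓ →ₗ[F] ZMod 2 → ℤ → Module.End F W,
      IsFieldMap χ T θ f ρ A (vacuumVector B ℓ) (vacMode B ℓ) Ψ := by
  let D : ℤ → U →ₗ[F] Module.End F (fieldSpace χ hT hA) := fun n =>
    f.constr F fun j => fieldOp hθ hT hA n j
  have hDf : ∀ n j, D n (f j) = fieldOp hθ hT hA n j := fun n j => f.constr_basis _ _ _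
  have hD : ∀ a b m n, D m a * D n b + D n b * D m a =
      if m + n + 1 = 0 then (ℓ * B a b) • (1 : Module.End F (fieldSpace χ hT hA)) else 0 := by
    intro a b m n
    induction a using basis_induction f with
    | h i =>
      induction b using basis_induction f with
      | h j => rw [hDf, hDf, fieldOp_anticomm hB]
      | h0 => simp
      | hadd b b' hb hb' =>
        rw [map_add, mul_add, add_mul, map_add, mul_add, add_smul, add_add_add_comm, hb, hb']
        split_ifs <;> simp
      | hsmul c b hb =>
        rw [map_smul, mul_smul_comm, smul_mul_assoc, ← smul_add, hb, map_smul]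
        split_ifs
        · rw [smul_smul, smul_eq_mul, mul_left_comm]
        · simp
    | h0 => simp
    | hadd b b' hb hb' =>
      rw [map_add, mul_add, add_mul, map_add, LinearMap.add_apply, mul_add, add_smul,
        add_add_add_comm, hb, hb']
      split_ifs <;> simp
    | hsmul c b hb =>
      rw [map_smul, mul_smul_comm, smul_mul_assoc, ← smul_add, hb, map_smul, LinearMap.smul_apply]
      split_ifs
      · rw [smul_smul, smul_eq_mul, mul_left_comm]
      · simp
  let w : fieldSpace χ hT hA := ⟨fun α => if α = 0 then oneField F T W else 0, by
    refine ⟨fun α => ?_, fun α j => ?_⟩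
    · dsimp only
      split_ifs
      exacts [oneField_trunc, Trunc.zero]
    · dsimp only
      split_ifs with hα
      · subst hα
        simpa [sg] using (isProd_oneField_right (χ := χ) hθ (hA.trunc j) hT (hA.supp j)).isLocal
      · exact IsLocal.field_zero⟩
  have hw : ∀ a n, 0 ≤ n → D n a w = 0 := by
    intro a n hn
    induction a using basis_induction f with
    | h j =>
      rw [hDf]
      refine Subtype.ext (funext fun α => ?_)
      change prodField χ T θ (ρ j) (sg F (α + 1)) (A j) (w.1 (α + 1)) n = 0
      by_cases hα : α + 1 = 0
      · have h1 := isProd_oneField_right (χ := χ) hθ (hA.trunc j) hT (hA.supp j)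
        have h2 : w.1 (α + 1) = oneField F T W := if_pos hα
        rw [h2, hα, show sg F 0 = 1 by simp [sg], ← h1.eq_prodField]
        exact if_neg (by omega)
      · have h2 : w.1 (α + 1) = 0 := if_neg hα
        rw [h2, ← IsProd.field_zero.eq_prodField]
        rfl
    | h0 => simp
    | hadd b b' hb hb' => rw [map_add, LinearMap.add_apply, hb, hb', add_zero]
    | hsmul c b hb => rw [map_smul, LinearMap.smul_apply, hb, smul_zero]
  obtain ⟨Ψ, h1, h2⟩ := exists_vacuumModule_lift B ℓ D hD w hw
  refine ⟨(fieldSpace χ hT hA).subtype ∘ₗ Ψ, ?_, fun v α => (Ψ v).2.1 α, fun j v α => ?_⟩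
  · rw [LinearMap.comp_apply, h1]; rfl
  · have h3 := hA.isProd_prodField hθ hT (Ψ v) α j
    have h4 : (fun l => ((fieldSpace χ hT hA).subtype ∘ₗ Ψ) (vacMode B ℓ l (f j) v) (α + 1)) =
        prodField χ T θ (ρ j) (sg F α) (A j) ((Ψ v).1 α) := by
      funext l
      change (Ψ (vacMode B ℓ l (f j) v)).1 (α + 1) = _
      rw [h2, hDf]
      change prodField χ T θ (ρ j) (sg F (α + 1 + 1)) (A j) ((Ψ v).1 (α + 1 + 1)) l = _
      rw [zmod_two_add_self]
    rw [h4]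
    exact h3

end FieldMap

/-! ### Vertex operators: submodules, homomorphisms and equivariance -/

section VertexMap

open Finset

variable {F : Type u} [Field F] {R : Type*} [CommRing R] [BinomialRing R] {χ : R →+* F}
  {T : ℕ} {θ : R} {W : Type w} [AddCommGroup W] [Module F W] {W' : Type w'} [AddCommGroup W']
  [Module F W'] {U : Type v} [AddCommGroup U] [Module F U] {B : LinearMap.BilinForm F U} {ℓ : F}
  {J : Type*} {f : Module.Basis J F U} {ρ : J → ℤ} {A : J → ℤ → Module.End F W}
  {A' : J → ℤ → Module.End F W'} {V : Type*} [AddCommGroup V] [Module F V] {vac : V}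
  {μ : ℤ → U →ₗ[F] Module.End F V} {par : ZMod 2 → Submodule F V}

theorem IsVacuumModule.induction (hV : IsVacuumModule B ℓ vac μ par) (f : Module.Basis J F U)
    {P : ZMod 2 → V → Prop} (h0 : P 0 vac) (hz : ∀ α, P α 0)
    (ha : ∀ α v w, v ∈ par α → w ∈ par α → P α v → P α w → P α (v + w))
    (hs : ∀ α (c : F) v, v ∈ par α → P α v → P α (c • v))
    (h : ∀ j n α, ∀ v ∈ par α, P α v → P (α + 1) (μ n (f j) v)) :
    ∀ α, ∀ v ∈ par α, P α v := by
  intro α v hv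
  refine (hV.par_le (fun α => { carrier := {v | v ∈ par α ∧ P α v}
                                add_mem' := fun h h' => ⟨add_mem h.1 h'.1, ha _ _ _ h.1 h'.1 h.2 h'.2⟩
                                zero_mem' := ⟨zero_mem _, hz α⟩
                                smul_mem' := fun c v h =>
                                  ⟨(par α).smul_mem c h.1, hs _ _ _ h.1 h.2⟩ })
    ⟨hV.vac_mem, h0⟩ (fun a n α v hv => ?_) α hv).2
  induction a using basis_induction f with
  | h j => exact ⟨hV.mem_par _ _ _ _ hv.1, h j n α v hv.1 hv.2⟩
  | h0 => rw [map_zero]; exact ⟨zero_mem _, hz _⟩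
  | hadd b b' hb hb' =>
    rw [map_add]
    exact ⟨add_mem hb.1 hb'.1, ha _ _ _ hb.1 hb'.1 hb.2 hb'.2⟩
  | hsmul c b hb =>
    rw [map_smul]
    exact ⟨Submodule.smul_mem _ c hb.1, hs _ _ _ hb.1 hb.2⟩

theorem IsVacuumModule.sup_par (hV : IsVacuumModule B ℓ vac μ par) : par 0 ⊔ par 1 = ⊤ := by
  refine hV.eq_top _ (Submodule.mem_sup_left hV.vac_mem) fun a n v hv => ?_
  obtain ⟨x, hx, y, hy, rfl⟩ := Submodule.mem_sup.1 hv
  rw [map_add]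
  exact Submodule.add_mem _ (Submodule.mem_sup_right (hV.mem_par a n 0 x hx))
    (Submodule.mem_sup_left (hV.mem_par a n 1 y hy))

theorem IsVacuumModule.exists_add (hV : IsVacuumModule B ℓ vac μ par) (v : V) :
    ∃ x ∈ par 0, ∃ y ∈ par 1, x + y = v :=
  Submodule.mem_sup.1 (hV.sup_par ▸ Submodule.mem_top (x := v))

/-- The vertex operators `Y` on `W` determined by the vertex operators `A j` of the vectors
`f j`. -/
structure IsVertexMap (χ : R →+* F) (T : ℕ) (θ : R) (f : J → U) (ρ : J → ℤ)
    (A : J → ℤ → Module.End F W) (vac : V) (μ : ℤ → U →ₗ[F] Module.End F V)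
    (par : ZMod 2 → Submodule F V) (Y : V →ₗ[F] ℤ → Module.End F W) : Prop where
  vac : Y vac = oneField F T W
  trunc : ∀ v, Trunc (Y v)
  prod : ∀ j β, ∀ v ∈ par β, IsProd χ T θ (ρ j) (sg F β) (A j) (Y v) fun l => Y (μ l (f j) v)

/-- A vector of parity `α` has no field in component `α + 1`, so the sum of the two components is
the right field on homogeneous vectors. The additional clause for vectors of both parities is what
later separates even from odd. -/
theorem exists_isVertexMap (hV : IsVacuumModule B ℓ vac μ par)
    {Ψ : V →ₗ[F] ZMod 2 → ℤ → Module.End F W} (hΨ : IsFieldMap χ T θ f ρ A vac μ Ψ) :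
    ∃ Y : V →ₗ[F] ℤ → Module.End F W, IsVertexMap χ T θ f ρ A vac μ par Y ∧
      ∀ v ∈ par 0, v ∈ par 1 → Y v = 0 := by
  have h1 : ∀ α, ∀ v ∈ par α, Ψ v (α + 1) = 0 := by
    refine hV.induction f ?_ ?_ ?_ ?_ ?_
    · rw [hΨ.vac]; exact if_neg (by decide)
    · simp
    · intro α v w _ _ hv hw; rw [map_add, Pi.add_apply, hv, hw, add_zero]
    · intro α c v _ hv; rw [map_smul, Pi.smul_apply, hv, smul_zero]
    · intro j n α v _ hv
      have h2 := hΨ.prod j v (α + 1)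
      rw [hv] at h2
      exact congrFun (h2.unique IsProd.field_zero fun _ _ _ => rfl) n
  let Y : V →ₗ[F] ℤ → Module.End F W := LinearMap.proj 0 ∘ₗ Ψ + LinearMap.proj 1 ∘ₗ Ψ
  have h2 : ∀ v, Y v = Ψ v 0 + Ψ v 1 := fun v => rfl
  have h3 : ∀ α, ∀ v ∈ par α, Y v = Ψ v α := by
    intro α v hv
    have := h1 α v hv
    rcases zmod_two_cases α with rfl | rfl
    · rw [h2, show (0 : ZMod 2) + 1 = 1 from rfl] at *; rw [this, add_zero]
    · rw [h2, show (1 : ZMod 2) + 1 = 0 from rfl] at *; rw [this, zero_add]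
  refine ⟨Y, ⟨?_, ?_, ?_⟩, ?_⟩
  · rw [h3 0 _ hV.vac_mem, hΨ.vac]; rfl
  · exact fun v => (hΨ.trunc v 0).add (hΨ.trunc v 1)
  · intro j β v hv
    rw [h3 β v hv]
    have h4 := hΨ.prod j v β
    have h5 : ∀ l, Y (μ l (f j) v) = Ψ (μ l (f j) v) (β + 1) := fun l =>
      h3 _ _ (hV.mem_par _ _ _ _ hv)
    simp only [h5]
    exact h4
  · intro v hv hv'
    have h5 := h1 1 v hv'
    rw [show (1 : ZMod 2) + 1 = 0 from rfl] at h5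
    rw [h3 0 v hv, h5]

theorem half_mem {A φ : ℤ → Module.End F W} (hφ : Trunc φ) (hT : 0 < T) (S : Submodule F W)
    {l m n : ℤ} {x : W} (h : ∀ i j, A i (φ j x) ∈ S) : half χ T A φ l m n x ∈ S := by
  obtain ⟨N, hN⟩ := hφ.half_ez hT (A := A) (fun i => (-1 : F) ^ i * bc χ (l : R) i)
    (fun i => m + (l - i) * T) n x
  rw [half, finsum_eq_sum_range (n := N) hN]
  exact S.sum_mem fun i _ => S.smul_mem _ (h _ _)

/-- By `IsProd.apply_eq`, the modes of a product are finite combinations of composites of modes of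
the two factors, in both orders. Invariant subspaces, and below intertwining maps, therefore pass
from generators to all of `V`. -/
theorem IsProd.apply_mem {A φ : ℤ → Module.End F W} {C : ℤ → ℤ → Module.End F W} {r : ℤ} {e : F}
    (h : IsProd χ T θ r e A φ C) (hθ : T * θ = 1) (hA : Trunc A) (hφ : Trunc φ) (hT : 0 < T)
    (S : Submodule F W) {x : W} (h1 : ∀ i j, A i (φ j x) ∈ S) (h2 : ∀ i j, φ i (A j x) ∈ S)
    (l k : ℤ) : C l k x ∈ S := by
  obtain ⟨N, hN⟩ := h.isLocal
  rw [h.apply_eq hθ hA hφ hT, finsum_eq_sum_range (n := (N - l).toNat) fun j hj => by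
    rw [hN _ (by omega) _ _ _ rfl, smul_zero]]
  exact S.sum_mem fun i _ => S.smul_mem _
    (S.sub_mem (half_mem hφ hT S h1) (S.smul_mem _ (half_mem hA hT S h2)))

theorem half_map {A φ : ℤ → Module.End F W} {A' φ' : ℤ → Module.End F W'} (hφ : Trunc φ)
    (hT : 0 < T) (g : W →ₗ[F] W') (hA : ∀ k x, g (A k x) = A' k (g x))
    (hg : ∀ k x, g (φ k x) = φ' k (g x)) (l m n : ℤ) (x : W) :
    g (half χ T A φ l m n x) = half χ T A' φ' l m n (g x) := by
  rw [half, EZ.map_finsum (hφ.half_ez hT _ _ _ _), half]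
  simp only [map_smul, hA, hg]

theorem IsProd.map_apply {A φ : ℤ → Module.End F W} {C : ℤ → ℤ → Module.End F W} {r : ℤ} {e : F}
    {A' φ' : ℤ → Module.End F W'} {C' : ℤ → ℤ → Module.End F W'}
    (h : IsProd χ T θ r e A φ C) (h' : IsProd χ T θ r e A' φ' C') (hθ : T * θ = 1) (hA : Trunc A)
    (hφ : Trunc φ) (hA' : Trunc A') (hφ' : Trunc φ') (hT : 0 < T)
    (g : W →ₗ[F] W') (hgA : ∀ k x, g (A k x) = A' k (g x))
    (hgφ : ∀ k x, g (φ k x) = φ' k (g x)) (l k : ℤ) (x : W) : g (C l k x) = C' l k (g x) := by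
  obtain ⟨N, hN⟩ := h.isLocal
  rw [h.apply_eq hθ hA hφ hT, h'.apply_eq hθ hA' hφ' hT, EZ.map_finsum]
  · simp only [map_smul, jl, map_sub, half_map hφ hT g hgA hgφ, half_map hA hT g hgφ hgA]
  · exact ⟨(N - l).toNat, fun j hj => by
      simp only
      rw [hN _ (by omega) _ _ _ rfl, smul_zero]⟩

theorem IsVertexMap.mem (hV : IsVacuumModule B ℓ vac μ par) (hθ : T * θ = 1) (hT : 0 < T)
    (hA : ∀ j, Trunc (A j)) {Y : V →ₗ[F] ℤ → Module.End F W}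
    (hY : IsVertexMap χ T θ f ρ A vac μ par Y) (S : Submodule F W)
    (hS : ∀ j k, ∀ x ∈ S, A j k x ∈ S) (v : V) (k : ℤ) {x : W} (hx : x ∈ S) : Y v k x ∈ S := by
  have h1 : ∀ α, ∀ v ∈ par α, ∀ k, ∀ x ∈ S, Y v k x ∈ S := by
    refine hV.induction f ?_ ?_ ?_ ?_ ?_
    · intro k x hx
      rw [hY.vac, oneField]
      split_ifs
      exacts [hx, zero_mem _]
    · simp
    · intro α v w _ _ hv hw k x hx
      rw [map_add]
      exact S.add_mem (hv k x hx) (hw k x hx)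
    · intro α c v _ hv k x hx
      rw [map_smul]
      exact S.smul_mem _ (hv k x hx)
    · intro j n α v hvα hv k x hx
      exact (hY.prod j α v hvα).apply_mem hθ (hA j) (hY.trunc v) hT S
        (fun i i' => hS _ _ _ (hv _ _ hx)) (fun i i' => hv _ _ (hS _ _ _ hx)) n k
  obtain ⟨y, hy, z, hz, rfl⟩ := hV.exists_add v
  rw [map_add]
  exact S.add_mem (h1 _ y hy k x hx) (h1 _ z hz k x hx)

theorem IsVertexMap.map_apply (hV : IsVacuumModule B ℓ vac μ par) (hθ : T * θ = 1) (hT : 0 < T)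
    (hA : ∀ j, Trunc (A j)) (hA' : ∀ j, Trunc (A' j)) {Y : V →ₗ[F] ℤ → Module.End F W}
    (hY : IsVertexMap χ T θ f ρ A vac μ par Y) {Y' : V →ₗ[F] ℤ → Module.End F W'}
    (hY' : IsVertexMap χ T θ f ρ A' vac μ par Y') (g : W →ₗ[F] W')
    (hg : ∀ j k x, g (A j k x) = A' j k (g x)) (v : V) (k : ℤ) (x : W) :
    g (Y v k x) = Y' v k (g x) := by
  have h1 : ∀ α, ∀ v ∈ par α, ∀ k x, g (Y v k x) = Y' v k (g x) := by
    refine hV.induction f ?_ ?_ ?_ ?_ ?_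
    · intro k x
      rw [hY.vac, hY'.vac, oneField, oneField]
      split_ifs <;> simp
    · simp
    · intro α v w _ _ hv hw k x
      simp only [map_add, Pi.add_apply, LinearMap.add_apply, hv, hw]
    · intro α c v _ hv k x
      simp only [map_smul, Pi.smul_apply, LinearMap.smul_apply, hv]
    · intro j n α v hvα hv k x
      exact (hY.prod j α v hvα).map_apply (hY'.prod j α v hvα) hθ (hA j) (hY.trunc v) (hA' j)
        (hY'.trunc v) hT g (hg j) hv n k x
  obtain ⟨y, hy, z, hz, rfl⟩ := hV.exists_add v
  simp only [map_add, Pi.add_apply, LinearMap.add_apply, h1 _ y hy, h1 _ z hz]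

theorem IsVertexMap.unique (hV : IsVacuumModule B ℓ vac μ par) (hθ : T * θ = 1) (hT : 0 < T)
    (hA : ∀ j, Trunc (A j)) {Y Y' : V →ₗ[F] ℤ → Module.End F W}
    (hY : IsVertexMap χ T θ f ρ A vac μ par Y) (hY' : IsVertexMap χ T θ f ρ A vac μ par Y') :
    Y = Y' :=
  LinearMap.ext fun v => funext fun k => LinearMap.ext fun x =>
    hY.map_apply hV hθ hT hA hA hY' LinearMap.id (fun _ _ _ => rfl) v k x

/-- All modes of `φ` in one coefficient of the left hand side have indices congruent modulo `T`, so
the weight `ζ ^ k` is a common factor. -/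
theorem IsProd.scale {A φ : ℤ → Module.End F W} {C : ℤ → ℤ → Module.End F W} {r : ℤ} {e : F}
    (h : IsProd χ T θ r e A φ C) {ζ : F} (hζ : ζ ^ T = 1) (hT : 0 < T) :
    IsProd χ T θ r e A (fun k => ζ ^ k • φ k) fun l k => ζ ^ (k - r) • C l k := by
  have hζ0 : ζ ≠ 0 := by
    rintro rfl
    rw [zero_pow hT.ne'] at hζ
    exact zero_ne_one hζ
  have h1 : ∀ k i : ℤ, ζ ^ (k + i * T) = ζ ^ k := by
    intro k i
    rw [zpow_add₀ hζ0, mul_comm i, zpow_mul, zpow_natCast, hζ, one_zpow, mul_one]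
  refine ⟨?_, fun l m n x hm => ?_⟩
  · obtain ⟨N, hN⟩ := h.bdd
    exact ⟨N, fun l hl => by funext k; simp [hN l hl]⟩
  · have h2 : jl χ T e A (fun k => ζ ^ k • φ k) l m n x = ζ ^ n • jl χ T e A φ l m n x := by
      have h3 : half χ T A (fun k => ζ ^ k • φ k) l m n x = ζ ^ n • half χ T A φ l m n x := by
        rw [half, half, smul_finsum]
        refine finsum_congr fun i => ?_
        rw [LinearMap.smul_apply, map_smul, h1, smul_comm]
      have h4 : half χ T (fun k => ζ ^ k • φ k) A l n m x = ζ ^ n • half χ T φ A l n m x := by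
        rw [half, half, smul_finsum]
        refine finsum_congr fun i => ?_
        rw [LinearMap.smul_apply, h1, smul_comm]
      rw [jl, jl, h3, h4]
      module
    rw [h2, h.eq l m n x hm, jr, jr, smul_finsum]
    refine finsum_congr fun i => ?_
    obtain ⟨d, hd⟩ := hm.symm.dvd
    rw [LinearMap.smul_apply, smul_comm,
      show m + n - i * T - r = n + (d - i) * T by linear_combination hd, h1]

/-- Equivariance under the automorphism `g`. For primitive `ζ` it confines the modes of an
eigenvector of `g` to one residue class, which is the support condition of a twisted module. -/
theorem IsVertexMap.scale (hV : IsVacuumModule B ℓ vac μ par) (hT : 0 < T)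
    {Y : V →ₗ[F] ℤ → Module.End F W} (hY : IsVertexMap χ T θ f ρ A vac μ par Y) {ζ : F}
    (hζ : ζ ^ T = 1) (g : Module.End F V) (hg0 : g vac = vac)
    (hg : ∀ j n v, g (μ n (f j) v) = ζ ^ ρ j • μ n (f j) (g v)) (v : V) (k : ℤ) :
    Y (g v) k = ζ ^ k • Y v k := by
  have hζ0 : ζ ≠ 0 := by
    rintro rfl
    rw [zero_pow hT.ne'] at hζ
    exact zero_ne_one hζ
  have h1 : ∀ α, ∀ v ∈ par α, g v ∈ par α ∧ ∀ k, Y (g v) k = ζ ^ k • Y v k := by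
    refine hV.induction f ?_ ?_ ?_ ?_ ?_
    · refine ⟨by rw [hg0]; exact hV.vac_mem, fun k => ?_⟩
      rw [hg0, hY.vac, oneField]
      split_ifs with hk
      · rw [hk, zpow_neg, zpow_natCast, hζ, inv_one, one_smul]
      · simp
    · simp
    · intro α v w _ _ hv hw
      refine ⟨by rw [map_add]; exact add_mem hv.1 hw.1, fun k => ?_⟩
      simp only [map_add, Pi.add_apply, hv.2, hw.2, smul_add]
    · intro α c v _ hv
      refine ⟨by rw [map_smul]; exact Submodule.smul_mem _ _ hv.1, fun k => ?_⟩
      simp only [map_smul, Pi.smul_apply, hv.2, smul_comm c]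
    · intro j n α v hvα hv
      refine ⟨by rw [hg]; exact Submodule.smul_mem _ _ (hV.mem_par _ _ _ _ hv.1), fun k => ?_⟩
      have h2 := hY.prod j α _ hv.1
      have h3 := (hY.prod j α v hvα).scale hζ hT
      have h4 : Y (g v) = fun k => ζ ^ k • Y v k := funext hv.2
      rw [h4] at h2
      have h5 := congrFun (congrFun (h2.unique h3 fun _ _ _ => rfl) n) k
      rw [hg, map_smul, Pi.smul_apply]
      rw [h5, smul_smul, ← zpow_add₀ hζ0]
      congr 2
      ring
  obtain ⟨y, hy, z, hz, rfl⟩ := hV.exists_add v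
  simp only [map_add, Pi.add_apply, (h1 _ y hy).2, (h1 _ z hz).2, smul_add]

end VertexMap

/-! ### Creation, derivatives and the Jacobi identity for arbitrary vectors -/

section Jacobi

open Finset

variable {F : Type u} [Field F] {R : Type*} [CommRing R] [BinomialRing R] {χ : R →+* F}
  {T : ℕ} {θ : R} {W : Type w} [AddCommGroup W] [Module F W]
  {U : Type v} [AddCommGroup U] [Module F U] {B : LinearMap.BilinForm F U} {ℓ : F}
  {J : Type*} {f : Module.Basis J F U} {ρ : J → ℤ} {A : J → ℤ → Module.End F W}
  {V : Type*} [AddCommGroup V] [Module F V] {vac : V}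
  {μ : ℤ → U →ₗ[F] Module.End F V} {par : ZMod 2 → Submodule F V}

/-- The vertex operators of the vacuum module. -/
abbrev IsVacuumMap (χ : R →+* F) (f : J → U) (vac : V) (μ : ℤ → U →ₗ[F] Module.End F V)
    (par : ZMod 2 → Submodule F V) (Y : V →ₗ[F] ℤ → Module.End F V) : Prop :=
  IsVertexMap χ 1 1 f 0 (fun j n => μ n (f j)) vac μ par Y

theorem jr_class_zero {C : ℤ → ℤ → Module.End F W} (l n : ℤ) (x : W) :
    jr χ T θ C l 0 n x = C l n x := by
  rw [jr, finsum_eq_single _ 0 fun i hi => by simp [bc_zero_left, hi]]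
  simp

theorem IsVacuumModule.trunc (hV : IsVacuumModule B ℓ vac μ par) (a : U) :
    Trunc fun n => μ n a := by
  intro v
  let S : Submodule F V :=
    { carrier := {v | ∃ N : ℤ, ∀ k ≥ N, μ k a v = 0}
      add_mem' := by
        rintro v w ⟨N, hN⟩ ⟨N', hN'⟩
        exact ⟨max N N', fun k hk => by
          rw [map_add, hN k (le_trans (le_max_left _ _) hk),
            hN' k (le_trans (le_max_right _ _) hk), add_zero]⟩
      zero_mem' := ⟨0, fun _ _ => map_zero _⟩
      smul_mem' := by
        rintro c v ⟨N, hN⟩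
        exact ⟨N, fun k hk => by rw [map_smul, hN k hk, smul_zero]⟩ }
  have hS : S = ⊤ := by
    refine hV.eq_top S ⟨0, fun k hk => hV.annih a k hk⟩ ?_
    rintro b n v ⟨N, hN⟩
    -- For `k ≥ -n` the index sum `k + n + 1` is positive, so the modes of `a` and `b` anticommute.
    refine ⟨max N (-n), fun k hk => ?_⟩
    have h1 := congrArg (fun φ : Module.End F V => φ v) (hV.anticomm a b k n)
    simp only [LinearMap.add_apply, Module.End.mul_apply] at h1
    rw [hN k (le_trans (le_max_left _ _) hk), map_zero, add_zero,
      if_neg (by have := le_trans (le_max_right _ _) hk; omega)] at h1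
    exact h1
  have h1 : v ∈ S := by rw [hS]; exact Submodule.mem_top
  exact h1

theorem IsVacuumModule.isModeRep (hV : IsVacuumModule B ℓ vac μ par) (f : J → U) :
    IsModeRep 1 B ℓ f 0 (fun j n => μ n (f j)) where
  trunc j := hV.trunc (f j)
  supp j k h := (h (by simpa using Int.modEq_one)).elim
  cls i j _ := by simp
  rel i j m n x _ := by
    have h1 := congrArg (fun φ : Module.End F V => φ x) (hV.anticomm (f i) (f j) m n)
    simp only [LinearMap.add_apply, Module.End.mul_apply] at h1
    rw [h1]
    push_cast
    split_ifs <;> rfl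

theorem IsVertexMap.apply_mem_par (hV : IsVacuumModule B ℓ vac μ par)
    {Y : V →ₗ[F] ℤ → Module.End F V} (hY : IsVacuumMap χ f vac μ par Y) :
    ∀ α, ∀ u ∈ par α, ∀ n β, ∀ v ∈ par β, Y u n v ∈ par (α + β) := by
  refine hV.induction f ?_ ?_ ?_ ?_ ?_
  · intro n β v hv
    rw [hY.vac, oneField, zero_add]
    split_ifs
    exacts [hv, zero_mem _]
  · simp
  · intro α u u' _ _ hu hu' n β v hv
    rw [map_add]
    exact add_mem (hu n β v hv) (hu' n β v hv)
  · intro α c u _ hu n β v hv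
    rw [map_smul]
    exact Submodule.smul_mem _ _ (hu n β v hv)
  · intro j l α u huα hu n β v hv
    refine (hY.prod j α u huα).apply_mem (by simp) (hV.trunc (f j)) (hY.trunc u) one_pos _
      (fun i i' => ?_) (fun i i' => ?_) l n
    · rw [add_right_comm]
      exact hV.mem_par _ _ _ _ (hu _ _ _ hv)
    · rw [add_assoc, add_comm 1 β]
      exact hu _ _ _ (hV.mem_par _ _ _ _ hv)

/-- At `m = 0` the right hand side of the Jacobi identity is a single term, and the second half
vanishes because nonnegative modes kill the vacuum. -/
theorem IsVertexMap.apply_vac (hV : IsVacuumModule B ℓ vac μ par)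
    {Y : V →ₗ[F] ℤ → Module.End F V} (hY : IsVacuumMap χ f vac μ par Y) {α : ZMod 2} {u : V}
    (hu : u ∈ par α) (j : J) (l n : ℤ) : Y (μ l (f j) u) n vac =
      ∑ᶠ i : ℕ, ((-1 : F) ^ i * bc χ (l : R) i) • μ (l - i) (f j) (Y u (n + i) vac) := by
  have h1 := (hY.prod j α u hu).eq l 0 n vac rfl
  rw [jr_class_zero] at h1
  rw [← h1, jl]
  have h2 : half χ 1 (Y u) (fun n => μ n (f j)) l n 0 vac = 0 :=
    finsum_eq_zero_of_forall_eq_zero fun i => by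
      rw [hV.annih _ _ (by simp), map_zero, smul_zero]
  rw [h2, smul_zero, sub_zero, half]
  refine finsum_congr fun i => ?_
  simp

theorem IsVertexMap.creation (hV : IsVacuumModule B ℓ vac μ par)
    {Y : V →ₗ[F] ℤ → Module.End F V} (hY : IsVacuumMap χ f vac μ par Y) (u : V) :
    (∀ n ≥ 0, Y u n vac = 0) ∧ Y u (-1) vac = u := by
  have h1 : ∀ α, ∀ u ∈ par α, (∀ n ≥ 0, Y u n vac = 0) ∧ Y u (-1) vac = u := by
    refine hV.induction f ?_ ?_ ?_ ?_ ?_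
    · rw [hY.vac]
      refine ⟨fun n hn => ?_, ?_⟩
      · rw [oneField_eq_zero (by push_cast; omega)]; rfl
      · simp [oneField]
    · simp
    · intro α u u' _ _ hu hu'
      simp only [map_add, Pi.add_apply, LinearMap.add_apply]
      exact ⟨fun n hn => by rw [hu.1 n hn, hu'.1 n hn, add_zero], by rw [hu.2, hu'.2]⟩
    · intro α c u _ hu
      simp only [map_smul, Pi.smul_apply, LinearMap.smul_apply]
      exact ⟨fun n hn => by rw [hu.1 n hn, smul_zero], by rw [hu.2]⟩
    · intro j l α u huα hu
      refine ⟨fun n hn => ?_, ?_⟩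
      · rw [hY.apply_vac hV huα]
        exact finsum_eq_zero_of_forall_eq_zero fun i => by
          rw [hu.1 _ (by omega), map_zero, smul_zero]
      · rw [hY.apply_vac hV huα, finsum_eq_single _ 0 fun i hi => by
          rw [hu.1 _ (by omega), map_zero, smul_zero]]
        simp [hu.2]
  obtain ⟨y, hy, z, hz, rfl⟩ := hV.exists_add u
  simp only [map_add, Pi.add_apply, LinearMap.add_apply]
  exact ⟨fun n hn => by rw [(h1 _ y hy).1 n hn, (h1 _ z hz).1 n hn, add_zero],
    by rw [(h1 _ y hy).2, (h1 _ z hz).2]⟩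

theorem hasse_oneField (hθ : T * θ = 1) (t : ℕ) :
    hasse χ T θ t (oneField F T W) = if t = 0 then oneField F T W else 0 := by
  split_ifs with ht
  · rw [ht, hasse_zero]
  · obtain ⟨t, rfl⟩ := Nat.exists_eq_succ_of_ne_zero ht
    funext k
    rw [hasse, oneField]
    split_ifs with hk
    · have h1 : (k : R) * θ = (t : ℕ) := by
        rw [show k = t * T by push_cast at hk; linear_combination hk]
        push_cast
        linear_combination (t : R) * hθ
      rw [h1, bc_natCast, Nat.choose_succ_self]
      simp
    · simp

/-- The maps `u ↦ u_{-1-t} 𝟏` serve as divided powers of the translation operator. By induction on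
`u`: they satisfy, by `IsVertexMap.apply_vac`, the Leibniz rule that `IsProd.hasse_eq` gives for the
fields. -/
theorem IsVertexMap.hasse_apply (hV : IsVacuumModule B ℓ vac μ par) (hθ : T * θ = 1) (hT : 0 < T)
    (hA : ∀ j, Trunc (A j)) {YV : V →ₗ[F] ℤ → Module.End F V}
    (hYV : IsVacuumMap χ f vac μ par YV) {Y : V →ₗ[F] ℤ → Module.End F W}
    (hY : IsVertexMap χ T θ f ρ A vac μ par Y) (u : V) (t : ℕ) :
    Y (YV u (-1 - t) vac) = hasse χ T θ t (Y u) := by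
  have h1 : ∀ α, ∀ u ∈ par α, ∀ t : ℕ, Y (YV u (-1 - t) vac) = hasse χ T θ t (Y u) := by
    refine hV.induction f ?_ ?_ ?_ ?_ ?_
    · intro t
      rw [hYV.vac, hY.vac, hasse_oneField hθ]
      split_ifs with ht
      · simp [ht, oneField, hY.vac]
      · rw [oneField_eq_zero (by push_cast; omega), LinearMap.zero_apply, map_zero]
    · intro α t; funext k; simp [hasse]
    · intro α u u' _ _ hu hu' t
      funext k
      simp [hasse, hu, hu']
    · intro α c u _ hu t
      funext k
      simp [hasse, hu, smul_comm c]
    · intro j l α u huα hu t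
      have h2 : ∀ t : ℕ, YV u (-1 - t) vac ∈ par α := fun t => by
        simpa using hYV.apply_mem_par hV α u huα (-1 - t) 0 vac hV.vac_mem
      have h3 := IsProd.hasse_eq (hA j) (hY.trunc u) hT hθ
        (C := fun i l => Y (μ l (f j) (YV u (-1 - i) vac))) (fun i => by
          rw [← hu i]
          exact hY.prod j α _ (h2 i)) t l
      simp only [Nat.cast_zero, sub_zero, (hYV.creation hV u).2] at h3
      rw [h3, hYV.apply_vac hV huα, finsum_eq_sum_range (n := t + 1) fun i hi => by
        rw [(hYV.creation hV u).1 _ (by omega), map_zero, smul_zero],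
        Nat.sum_antidiagonal_eq_sum_range_succ
          (fun a b => ((-1 : F) ^ a * bc χ (l : R) a) • Y (μ (l - a) (f j) (YV u (-1 - b) vac))),
        map_sum]
      refine sum_congr rfl fun i hi => ?_
      rw [mem_range] at hi
      rw [map_smul, Nat.cast_sub (by omega), show -1 - (t : ℤ) + i = -1 - (t - i) by ring]
  obtain ⟨y, hy, z, hz, rfl⟩ := hV.exists_add u
  funext k
  simp [hasse, h1 _ y hy, h1 _ z hz]

/-- The Jacobi identity. -/
theorem IsVertexMap.isProd (hV : IsVacuumModule B ℓ vac μ par) (hθ : T * θ = 1) (hT : 0 < T)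
    (hA : ∀ j, Trunc (A j)) {YV : V →ₗ[F] ℤ → Module.End F V}
    (hYV : IsVacuumMap χ f vac μ par YV) {Y : V →ₗ[F] ℤ → Module.End F W}
    (hY : IsVertexMap χ T θ f ρ A vac μ par Y) {ζ : F} (hζ : IsPrimitiveRoot ζ T)
    (g : Module.End F V) (hg0 : g vac = vac)
    (hg : ∀ j n v, g (μ n (f j) v) = ζ ^ ρ j • μ n (f j) (g v)) :
    ∀ β, ∀ v ∈ par β, ∀ α u (s : ℤ), u ∈ par α → g u = ζ ^ s • u →
      IsProd χ T θ s (superSign F α β) (Y u) (Y v) fun l => Y (YV u l v) := by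
  have hζ0 : ζ ≠ 0 := hζ.ne_zero hT.ne'
  have hsupp : ∀ u (s : ℤ), g u = ζ ^ s • u → ∀ k, ¬ k ≡ s [ZMOD T] → Y u k = 0 := by
    intro u s hu k hk
    have h1 := hY.scale hV hT hζ.pow_eq_one g hg0 hg u k
    rw [hu, map_smul, Pi.smul_apply, ← sub_eq_zero, ← sub_smul, smul_eq_zero] at h1
    refine h1.resolve_left fun h2 => hk ?_
    rw [sub_eq_zero] at h2
    have h3 : ζ ^ (s - k) = 1 := by
      rw [zpow_sub₀ hζ0, h2, div_self (zpow_ne_zero _ hζ0)]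
    exact Int.modEq_iff_dvd.2 ((hζ.zpow_eq_one_iff_dvd _).1 h3)
  refine hV.induction f ?_ ?_ ?_ ?_ ?_
  -- Base case: the field of the vacuum is the identity field, and its products with the field of
  -- `u` are the divided derivatives computed above.
  · intro α u s _ hu
    have h1 := isProd_oneField_right (χ := χ) hθ (hY.trunc u) hT (hsupp u s hu)
    have h2 : (fun l => Y (YV u l vac)) =
        fun l => if l < 0 then hasse χ T θ (-1 - l).toNat (Y u) else 0 := by
      funext l
      split_ifs with hl
      · rw [← hYV.hasse_apply hV hθ hT hA hY, show -1 - (((-1 - l).toNat : ℕ) : ℤ) = l by omega]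
      · rw [(hYV.creation hV u).1 l (by omega), map_zero]
    rw [h2, hY.vac]
    simpa [superSign] using h1
  · intro β α u s _ _
    simp only [map_zero]
    exact IsProd.field_zero
  · intro β v v' _ _ hv hv' α u s hu hus
    simp only [map_add]
    exact (hv α u s hu hus).field_add (hY.trunc u) (hY.trunc v) (hY.trunc v') hT (hv' α u s hu hus)
  · intro β c v _ hv α u s hu hus
    simp only [map_smul]
    exact (hv α u s hu hus).field_smul c
  · intro j l β v hvβ hv α u s hu hus
    have hp := hY.prod j α u hu
    obtain ⟨N, hN⟩ := hp.bdd
    obtain ⟨N', hN'⟩ := (hYV.prod j α u hu).bdd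
    have hK : ∀ P : ℕ, P ≥ (max N N').toNat → Y (μ P (f j) u) = 0 := fun P hP =>
      hN _ (by omega)
    have hK' : ∀ P : ℕ, P ≥ (max N N').toNat → YV (μ P (f j) u) = 0 := fun P hP =>
      hN' _ (by omega)
    -- The commutator formula is used for the generator `f j`, the vector `u` and the vector `v`.
    -- The commutator of the first two is given by the fields of `(f j)_P u`, to which the induction
    -- hypothesis for `v` applies.
    have h1 := (hY.prod j β v hvβ).comm hθ hT (sg_mul_self α) (hA j) (hY.trunc u) (hY.trunc v)
      (hv α u s hu hus) (K := fun P => Y (μ P (f j) u)) hK (fun P => hY.trunc _) hp.commutator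
      (D := fun k l => Y (μ l (f j) (YV u k v)))
      (fun k => by
        rw [← sg_add]
        exact hY.prod j _ _ (hYV.apply_mem_par hV α u hu k β v hvβ))
      (L := fun P k => Y (YV (μ P (f j) u) k v))
      (fun P => by
        rw [← superSign_add_one_left]
        refine hv _ _ _ (hV.mem_par _ _ _ _ hu) ?_
        rw [hg, hus, map_smul, smul_smul, zpow_add₀ hζ0]) l
    have h2 : sg F α * superSign F α β = superSign F α (β + 1) := by
      rw [superSign_comm, superSign_comm α, superSign_add_one_left]
    rw [h2] at h1
    convert h1 using 1
    funext k
    -- The same formula inside `V` rewrites `u_k (f j)_l v`, so the products obtained are the fields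
    -- of these vectors.
    have h3 := (hYV.prod j α u hu).commutator l k v (by simpa using Int.modEq_one)
    rw [finsum_eq_sum_range (n := (max N N').toNat) fun P hP => by rw [hK' P hP]; simp] at h3
    have h4 : YV u k (μ l (f j) v) = sg F α • μ l (f j) (YV u k v) -
        sg F α • ∑ P ∈ range (max N N').toNat, bc χ (l : R) P •
          YV (μ P (f j) u) (k + l - P) v := by
      have h5 : ∀ P : ℕ, bc χ ((l : R) * 1) P • YV (μ P (f j) u) (l + k - P * (1 : ℕ)) v =
          bc χ (l : R) P • YV (μ P (f j) u) (k + l - P) v := fun P => by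
        rw [mul_one, Nat.cast_one, mul_one, add_comm l k]
      rw [sum_congr rfl fun P _ => (h5 P).symm, ← h3, smul_sub, smul_smul, sg_mul_self]
      module
    rw [h4]
    simp only [map_sub, map_smul, map_sum]

end Jacobi

/-! ### Vertex superalgebra structures and twisted modules from mode representations -/

section Structures

open Finset

variable {p : ℕ} [Fact p.Prime] {F : Type u} [Field F] {χ : ℤ_[p] →+* F}
  {T : ℕ} {θ : ℤ_[p]} {W : Type w} [AddCommGroup W] [Module F W] {W' : Type w'} [AddCommGroup W']
  [Module F W'] {U : Type v} [AddCommGroup U] [Module F U] {B : LinearMap.BilinForm F U} {ℓ : F}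
  {J : Type*} {f : Module.Basis J F U} {V : Type*} [AddCommGroup V] [Module F V] {vac : V}
  {μ : ℤ → U →ₗ[F] Module.End F V} {par : ZMod 2 → Submodule F V}

theorem IsVertexMap.apply_generator (hV : IsVacuumModule B ℓ vac μ par) (hθ : T * θ = 1)
    (hT : 0 < T) {ρ : J → ℤ} {A : J → ℤ → Module.End F W} (hA : IsModeRep T B ℓ f ρ A)
    {Y : V →ₗ[F] ℤ → Module.End F W} (hY : IsVertexMap χ T θ f ρ A vac μ par Y) (j : J) :
    Y (μ (-1) (f j) vac) = A j := by
  have h1 := hY.prod j 0 vac hV.vac_mem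
  have h2 := isProd_oneField_right (χ := χ) hθ (hA.trunc j) hT (hA.supp j)
  rw [hY.vac, show sg F 0 = 1 by simp [sg]] at h1
  have h3 := congrFun (h1.unique h2 fun _ _ _ => rfl) (-1)
  simpa using h3

theorem TwistedModule.isSub_iff {g : Module.End F V} {η : F} {ρ : J → ℕ}
    {𝒱 : VertexSuperalgebra F V} (hV : IsVacuumModule B ℓ vac μ par)
    {M : TwistedModule 𝒱 g T η W} (hθ : T * θ = 1) (hT : 0 < T)
    (hM : IsVertexMap χ T θ f (fun j => (ρ j : ℤ)) (fun j => M.YW (μ (-1) (f j) vac)) vac μ par M.YW)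
    (N : Submodule F W) :
    M.IsSub N ↔ ∀ j k, ∀ x ∈ N, M.YW (μ (-1) (f j) vac) k x ∈ N :=
  ⟨fun h _ _ _ hx => h _ _ _ hx, fun h v k _ hx =>
    hM.mem hV hθ hT (fun _ => M.truncation _) N h v k hx⟩

theorem TwistedModule.isomorphic_iff {g : Module.End F V} {η : F} {ρ : J → ℕ}
    {𝒱 : VertexSuperalgebra F V} (hV : IsVacuumModule B ℓ vac μ par)
    {M : TwistedModule 𝒱 g T η W} {M' : TwistedModule 𝒱 g T η W'} (hθ : T * θ = 1) (hT : 0 < T)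
    (hM : IsVertexMap χ T θ f (fun j => (ρ j : ℤ)) (fun j => M.YW (μ (-1) (f j) vac)) vac μ par M.YW)
    (hM' : IsVertexMap χ T θ f (fun j => (ρ j : ℤ)) (fun j => M'.YW (μ (-1) (f j) vac)) vac μ par
      M'.YW) :
    M.Isomorphic M' ↔ ∃ e : W ≃ₗ[F] W', ∀ j k x,
      e (M.YW (μ (-1) (f j) vac) k x) = M'.YW (μ (-1) (f j) vac) k (e x) :=
  ⟨fun ⟨e, he⟩ => ⟨e, fun _ _ _ => he _ _ _⟩, fun ⟨e, he⟩ => ⟨e, fun v k x =>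
    hM.map_apply hV hθ hT (fun _ => M.truncation _) (fun _ => M'.truncation _) hM' e.toLinearMap
      he v k x⟩⟩

variable [CharP F p]

/-- The bridge between the definition, with rational binomials cast to `F`, and the calculus of `jl`
and `jr` over `ℤ_[p]`; here `θ` plays the part of `1 / T`. -/
theorem jacobiCoeff_iff (χ : ℤ_[p] →+* F) (hθ : T * θ = 1) (Y : V →ₗ[F] (ℤ → Module.End F V))
    (YW : V →ₗ[F] (ℤ → Module.End F W)) (ε : F) (u v : V) (l m n : ℤ) (x : W) :
    JacobiCoeff T Y YW ε u v l m n x ↔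
      jl χ T ε (YW u) (YW v) l m n x = jr χ T θ (fun l => YW (Y u l v)) l m n x := by
  have h1 : ∀ i, binom F (l : ℚ) i = bc χ (l : ℤ_[p]) i := binom_eq_bc χ _ _ (by simp)
  have h2 : ∀ i, binom F ((m : ℚ) / (T : ℚ)) i = bc χ ((m : ℤ_[p]) * θ) i := by
    refine binom_eq_bc χ _ _ ?_
    have h3 : (T : ℚ_[p]) * θ = 1 := by
      have := congrArg (fun z : ℤ_[p] => (z : ℚ_[p])) hθ
      simpa using this
    have h4 : (T : ℚ_[p]) ≠ 0 := left_ne_zero_of_mul_eq_one h3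
    push_cast
    rw [div_eq_iff h4, mul_assoc, mul_comm (θ : ℚ_[p]), h3, mul_one]
  rw [JacobiCoeff, jl, jr, half, half]
  simp only [h1, h2]
  rw [mul_smul, smul_finsum ((-1 : F) ^ l)]
  simp only [smul_smul]

/-- The vertex superalgebra `𝒱` on `V` is determined by `Y(a, x) = ∑ (μ n a) x ^ (-n - 1)`. -/
structure IsCliffordVertex (vac : V) (μ : ℤ → U →ₗ[F] Module.End F V)
    (par : ZMod 2 → Submodule F V) (𝒱 : VertexSuperalgebra F V) : Prop where
  parity_eq : 𝒱.parity = par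
  vac_eq : 𝒱.vac = vac
  field_eq : ∀ a n, 𝒱.Y (μ (-1) a vac) n = μ n a

theorem exists_isCliffordVertex (hV : IsVacuumModule B ℓ vac μ par)
    {Ψ : V →ₗ[F] ZMod 2 → ℤ → Module.End F V}
    (hΨ : IsFieldMap χ 1 1 f 0 (fun j n => μ n (f j)) vac μ Ψ) :
    ∃ 𝒱 : VertexSuperalgebra F V, IsCliffordVertex vac μ par 𝒱 := by
  obtain ⟨Y, hY, h0⟩ := exists_isVertexMap hV hΨ
  have hθ : ((1 : ℕ) : ℤ_[p]) * 1 = 1 := by simp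
  have hA := fun j => (hV.isModeRep f).trunc j
  have hYV : IsVacuumMap χ f vac μ par Y := hY
  refine ⟨{ parity := par
            vac := vac
            Y := Y
            isInternal := ?_
            vac_mem := hV.vac_mem
            parity_mode := fun α β u hu v hv n => hYV.apply_mem_par hV α u hu n β v hv
            truncation := fun u v => hY.trunc u v
            vacuum := fun n => ?_
            creation := fun u n hn => (hYV.creation hV u).1 n hn
            creation' := fun u => (hYV.creation hV u).2
            jacobi := ?_ }, rfl, rfl, ?_⟩
  · rw [DirectSum.isInternal_submodule_iff_isCompl par (i := 0) (j := 1) (by decide)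
      (by ext x; simpa using zmod_two_cases x)]
    -- A vector `v` that is both even and odd has zero field, and `v = v_{-1} 𝟏` is recovered from
    -- its field.
    refine ⟨disjoint_iff.2 ((Submodule.eq_bot_iff _).2 fun v hv => ?_), codisjoint_iff.2 hV.sup_par⟩
    rw [← (hYV.creation hV v).2, h0 v hv.1 hv.2]
    rfl
  · rw [hY.vac, oneField, Nat.cast_one]
  · intro α β u hu v hv l m n x
    rw [jacobiCoeff_iff χ hθ]
    exact (hY.isProd hV hθ one_pos hA hYV IsPrimitiveRoot.one 1 rfl (by simp) β v hv α u 0 hu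
      (by simp)).eq l m n x (by simp [Int.modEq_one])
  · intro a n
    induction a using basis_induction f with
    | h j => exact congrFun (hY.apply_generator hV hθ one_pos (hV.isModeRep f) j) n
    | h0 => simp
    | hadd a b ha hb =>
      rw [map_add, map_add, ← ha, ← hb, LinearMap.add_apply, map_add]; rfl
    | hsmul c a ha => rw [map_smul, map_smul, ← ha, LinearMap.smul_apply, map_smul]; rfl

/-- Only the Jacobi identities whose first vector is a generator are kept. They determine all vertex
operators, which gives uniqueness of the structure. -/
theorem IsCliffordVertex.isVacuumMap (χ : ℤ_[p] →+* F) (f : Module.Basis J F U)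
    (hV : IsVacuumModule B ℓ vac μ par)
    {𝒱 : VertexSuperalgebra F V} (h : IsCliffordVertex vac μ par 𝒱) :
    IsVacuumMap χ f vac μ par 𝒱.Y := by
  refine ⟨?_, 𝒱.truncation, fun j β v hv => ⟨?_, fun l m n x _ => ?_⟩⟩
  · funext n
    rw [← h.vac_eq, 𝒱.vacuum, oneField, Nat.cast_one]
  · obtain ⟨N, hN⟩ := hV.trunc (f j) v
    exact ⟨N, fun l hl => by rw [hN l hl, map_zero]⟩
  · have h1 := 𝒱.jacobi 1 β (μ (-1) (f j) vac)
      (by rw [h.parity_eq]; simpa using hV.mem_par (f j) (-1) 0 vac hV.vac_mem) v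
      (by rw [h.parity_eq]; exact hv) l m n x
    have h2 : 𝒱.Y (μ (-1) (f j) vac) = fun n => μ n (f j) := funext (h.field_eq _)
    rw [jacobiCoeff_iff χ (θ := 1) (by simp), superSign_one_left] at h1
    simp only [h2] at h1
    exact h1

theorem IsCliffordVertex.unique (χ : ℤ_[p] →+* F) (f : Module.Basis J F U)
    (hV : IsVacuumModule B ℓ vac μ par)
    {𝒱 𝒱' : VertexSuperalgebra F V} (h : IsCliffordVertex vac μ par 𝒱)
    (h' : IsCliffordVertex vac μ par 𝒱') : 𝒱 = 𝒱' := by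
  refine VertexSuperalgebra.ext ?_ ?_ ?_
  · rw [h.parity_eq, h'.parity_eq]
  · rw [h.vac_eq, h'.vac_eq]
  · exact (h.isVacuumMap χ f hV).unique hV (by simp) one_pos (fun j => (hV.isModeRep f).trunc j)
      (h'.isVacuumMap χ f hV)

section Twisted

variable {τ : U ≃ₗ[F] U} {g : Module.End F V} {η : F} {ρ : J → ℕ} {𝒱 : VertexSuperalgebra F V}

theorem eigenvector_smul (hg : ∀ a n v, g (μ n a v) = μ n (τ a) (g v))
    (hf : ∀ j, τ (f j) = η ^ ρ j • f j) (j : J) (n : ℤ) (v : V) :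
    g (μ n (f j) v) = η ^ (ρ j : ℤ) • μ n (f j) (g v) := by
  rw [hg, hf, map_smul, zpow_natCast]; rfl

theorem TwistedModule.isVertexMap (χ : ℤ_[p] →+* F) (hV : IsVacuumModule B ℓ vac μ par)
    (h𝒱 : IsCliffordVertex vac μ par 𝒱) (hg0 : g vac = vac)
    (hg : ∀ a n v, g (μ n a v) = μ n (τ a) (g v)) (hf : ∀ j, τ (f j) = η ^ ρ j • f j)
    (hρ : ∀ j, ρ j < T) (hθ : T * θ = 1) (M : TwistedModule 𝒱 g T η W) :
    IsVertexMap χ T θ f (fun j => ρ j) (fun j => M.YW (μ (-1) (f j) vac)) vac μ par M.YW := by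
  refine ⟨?_, M.truncation, fun j β v hv => ⟨?_, fun l m n x hm => ?_⟩⟩
  · funext n
    rw [← h𝒱.vac_eq, M.vacuum, oneField]
  · obtain ⟨N, hN⟩ := hV.trunc (f j) v
    exact ⟨N, fun l hl => by rw [hN l hl, map_zero]⟩
  · have h1 := M.jacobi (ρ j) (hρ j) 1 β (μ (-1) (f j) vac)
      (by rw [h𝒱.parity_eq]; simpa using hV.mem_par (f j) (-1) 0 vac hV.vac_mem)
      (by
        rw [Module.End.mem_eigenspace_iff, eigenvector_smul hg hf, hg0, zpow_natCast]) v
      (by rw [h𝒱.parity_eq]; exact hv) l m n hm x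
    rw [jacobiCoeff_iff χ hθ, superSign_one_left] at h1
    simpa only [h𝒱.field_eq] using h1

theorem isometry_class (hτ : ∀ a b, B (τ a) (τ b) = B a b)
    (hf : ∀ j, τ (f j) = η ^ ρ j • f j) (hη : IsPrimitiveRoot η T) (i j : J)
    (h : B (f i) (f j) ≠ 0) : (ρ i : ℤ) + ρ j ≡ 0 [ZMOD T] := by
  have h1 := hτ (f i) (f j)
  rw [hf, hf, map_smul, map_smul, LinearMap.smul_apply, smul_smul, ← pow_add, smul_eq_mul,
    mul_eq_right₀ h, add_comm] at h1
  have h2 := (hη.pow_eq_one_iff_dvd _).1 h1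
  exact Int.modEq_zero_iff_dvd.2 (by exact_mod_cast h2)

/-- The relations come from the commutator formula: for `P ≥ 0`, `(f i)_P (f j)_{-1} 𝟏` is `ℓ * B (f
i) (f j)` times the vacuum if `P = 0`, and zero otherwise. -/
theorem TwistedModule.isModeRep (χ : ℤ_[p] →+* F) (hV : IsVacuumModule B ℓ vac μ par)
    (h𝒱 : IsCliffordVertex vac μ par 𝒱) (hg0 : g vac = vac)
    (hg : ∀ a n v, g (μ n a v) = μ n (τ a) (g v)) (hf : ∀ j, τ (f j) = η ^ ρ j • f j)
    (hτ : ∀ a b, B (τ a) (τ b) = B a b) (hη : IsPrimitiveRoot η T)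
    (hρ : ∀ j, ρ j < T) (hθ : T * θ = 1) (M : TwistedModule 𝒱 g T η W) :
    IsModeRep T B ℓ f (fun j => (ρ j : ℤ)) fun j => M.YW (μ (-1) (f j) vac) := by
  refine ⟨fun j => M.truncation _, fun j k hk => ?_, isometry_class hτ hf hη, fun i j m n x hm => ?_⟩
  · refine M.support (ρ j) (hρ j) _ ?_ k hk
    rw [Module.End.mem_eigenspace_iff, eigenvector_smul hg hf, hg0, zpow_natCast]
  · have h1 := ((M.isVertexMap χ hV h𝒱 hg0 hg hf hρ hθ).prod i 1 (μ (-1) (f j) vac)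
      (by simpa using hV.mem_par (f j) (-1) 0 vac hV.vac_mem)).commutator m n x hm
    have h2 : ∀ P : ℕ, μ P (f i) (μ (-1) (f j) vac) =
        if P = 0 then (ℓ * B (f i) (f j)) • vac else 0 := by
      intro P
      have h3 := congrArg (fun φ : Module.End F V => φ vac) (hV.anticomm (f i) (f j) P (-1))
      simp only [LinearMap.add_apply, Module.End.mul_apply] at h3
      rw [hV.annih (f i) P (Int.natCast_nonneg P), map_zero, add_zero] at h3
      rw [h3]
      by_cases hP : P = 0
      · simp [hP]
      · rw [if_neg hP, if_neg (by omega)]; rfl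
    rw [show sg F 1 = -1 by simp [sg], neg_one_smul, sub_neg_eq_add] at h1
    rw [h1, finsum_eq_single _ 0 fun P hP => by rw [h2, if_neg hP]; simp]
    have h4 : M.YW vac (m + n) = if m + n = -(T : ℤ) then 1 else 0 := by
      rw [← h𝒱.vac_eq, M.vacuum]
    rw [h2, if_pos rfl, map_smul]
    simp only [bc_zero, Nat.cast_zero, zero_mul, sub_zero, one_smul, Pi.smul_apply, h4]
    by_cases hmn : m + n + T = 0
    · rw [if_pos hmn, if_pos (by omega)]; simp
    · rw [if_neg hmn, if_neg (by omega)]; simp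

/-- The converse of `TwistedModule.isModeRep`: the relations of the generators suffice for a twisted
module. -/
theorem exists_twistedModule (hV : IsVacuumModule B ℓ vac μ par)
    (h𝒱 : IsCliffordVertex vac μ par 𝒱) (hg0 : g vac = vac)
    (hg : ∀ a n v, g (μ n a v) = μ n (τ a) (g v)) (hf : ∀ j, τ (f j) = η ^ ρ j • f j)
    (hη : IsPrimitiveRoot η T) (hθ : T * θ = 1) (hT : 0 < T)
    {A : J → ℤ → Module.End F W} (hA : IsModeRep T B ℓ f (fun j => (ρ j : ℤ)) A)
    {Ψ : V →ₗ[F] ZMod 2 → ℤ → Module.End F W}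
    (hΨ : IsFieldMap χ T θ f (fun j => (ρ j : ℤ)) A vac μ Ψ) :
    ∃ M : TwistedModule 𝒱 g T η W, ∀ j, M.YW (μ (-1) (f j) vac) = A j := by
  obtain ⟨Y, hY, -⟩ := exists_isVertexMap hV hΨ
  have hg' := eigenvector_smul hg hf
  have h1 := (h𝒱.isVacuumMap χ f hV).isProd hV hθ hT hA.trunc hY hη g hg0 hg'
  refine ⟨{ YW := Y
            support := ?_
            truncation := fun u x => hY.trunc u x
            vacuum := fun k => ?_
            jacobi := ?_ }, hY.apply_generator hV hθ hT hA⟩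
  · intro r _ u hu k hk
    have h2 := hY.scale hV hT hη.pow_eq_one g hg0 hg' u k
    have hη0 : η ≠ 0 := hη.ne_zero hT.ne'
    rw [Module.End.mem_eigenspace_iff.1 hu, map_smul, Pi.smul_apply, ← sub_eq_zero, ← sub_smul,
      smul_eq_zero] at h2
    refine h2.resolve_left fun h3 => hk ?_
    rw [sub_eq_zero] at h3
    have h4 : η ^ ((r : ℤ) - k) = 1 := by
      rw [zpow_sub₀ hη0, zpow_natCast, h3, div_self (zpow_ne_zero _ hη0)]
    exact Int.modEq_iff_dvd.2 ((hη.zpow_eq_one_iff_dvd _).1 h4)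
  · rw [h𝒱.vac_eq, hY.vac, oneField]
  · intro r _ α β u hu hur v hv l m n hm x
    rw [h𝒱.parity_eq] at hu hv
    rw [jacobiCoeff_iff χ hθ]
    exact (h1 β v hv α u r hu (by rw [Module.End.mem_eigenspace_iff.1 hur, zpow_natCast])).eq
      l m n x hm

end Twisted

end Structures

/-! ### The abstract axioms for the given vacuum module and automorphism -/

section Concrete

variable {F : Type u} [Field F] {U : Type v} [AddCommGroup U] [Module F U]
  {B : LinearMap.BilinForm F U} {ℓ : F}

theorem isCliffordStructure_iff (𝒱 : VertexSuperalgebra F (VacuumModule B ℓ)) :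
    IsCliffordStructure B ℓ 𝒱 ↔
      IsCliffordVertex (vacuumVector B ℓ) (vacMode B ℓ) (vacuumParity B ℓ) 𝒱 :=
  ⟨fun h => ⟨h.parity_eq, h.vac_eq, fun a n => LinearMap.ext fun x => h.field_eq a n x⟩,
    fun h => ⟨h.parity_eq, h.vac_eq, fun a n x =>
      congrArg (fun φ : Module.End F (VacuumModule B ℓ) => φ x) (h.field_eq a n)⟩⟩

theorem vacuumMap_vacuumVector (τ : U ≃ₗ[F] U) (hτ : ∀ a b, B (τ a) (τ b) = B a b) :
    vacuumMap B ℓ τ hτ (vacuumVector B ℓ) = vacuumVector B ℓ := by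
  rw [vacuumVector, vacuumMap_mk, map_one]

theorem vacuumMap_vacMode (τ : U ≃ₗ[F] U) (hτ : ∀ a b, B (τ a) (τ b) = B a b) (a : U) (n : ℤ)
    (v : VacuumModule B ℓ) :
    vacuumMap B ℓ τ hτ (vacMode B ℓ n a v) = vacMode B ℓ n (τ a) (vacuumMap B ℓ τ hτ v) := by
  obtain ⟨x, rfl⟩ := Submodule.Quotient.mk_surjective _ v
  have h1 : envMap B τ hτ (mode B a n * x) = mode B (τ a) n * envMap B τ hτ x := by
    rw [map_mul, mode, envMap_toEnv, affineMap_loop, mode]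
  exact congrArg (Submodule.Quotient.mk (p := vacIdeal B ℓ)) h1

end Concrete

/-! ### Locally finite representations of the canonical anticommutation relations -/

section Fermion

variable {F : Type u} [Field F] {W : Type w} [AddCommGroup W] [Module F W] {W' : Type w'}
  [AddCommGroup W'] [Module F W'] {I : Type*} {s : F} {a c : I → Module.End F W}
  {z : Module.End F W} {a' c' : I → Module.End F W'} {z' : Module.End F W'}

/-- Annihilation operators `a i` and creation operators `c i`, with an involution `z` that commutes
with them up to the sign `s`. -/
structure IsFermion (s : F) (a c : I → Module.End F W) (z : Module.End F W) : Prop where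
  aa : ∀ i j x, a i (a j x) = -a j (a i x)
  aa_self : ∀ i x, a i (a i x) = 0
  cc : ∀ i j x, c i (c j x) = -c j (c i x)
  cc_self : ∀ i x, c i (c i x) = 0
  ac : ∀ i j, i ≠ j → ∀ x, a i (c j x) = -c j (a i x)
  ac_self : ∀ i x, a i (c i x) = x - c i (a i x)
  fin : ∀ x, {i | a i x ≠ 0}.Finite
  za : ∀ i x, z (a i x) = s • a i (z x)
  zc : ∀ i x, z (c i x) = s • c i (z x)
  zz : ∀ x, z (z x) = x

/-- The submodule `N` is stable under the operators `a i`, `c i` and `z`. -/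
structure IsStable (a c : I → Module.End F W) (z : Module.End F W) (N : Submodule F W) :
    Prop where
  a_mem : ∀ i, ∀ x ∈ N, a i x ∈ N
  c_mem : ∀ i, ∀ x ∈ N, c i x ∈ N
  z_mem : ∀ x ∈ N, z x ∈ N

theorem IsStable.inf {N N' : Submodule F W} (h : IsStable a c z N) (h' : IsStable a c z N') :
    IsStable a c z (N ⊓ N') :=
  ⟨fun i x hx => ⟨h.a_mem i x hx.1, h'.a_mem i x hx.2⟩,
    fun i x hx => ⟨h.c_mem i x hx.1, h'.c_mem i x hx.2⟩,
    fun x hx => ⟨h.z_mem x hx.1, h'.z_mem x hx.2⟩⟩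

theorem isStable_top : IsStable a c z ⊤ := by
  constructor <;> simp

/-- The vectors killed by all `a i`. -/
def vacuumSpace (a : I → Module.End F W) : Submodule F W := ⨅ i, LinearMap.ker (a i)

theorem mem_vacuumSpace {x : W} : x ∈ vacuumSpace a ↔ ∀ i, a i x = 0 := by
  simp [vacuumSpace]

/-- The smallest submodule that contains `N` and is stable under all `c i`. -/
def generated (c : I → Module.End F W) (N : Submodule F W) : Submodule F W :=
  sInf {N' | N ≤ N' ∧ ∀ i, ∀ x ∈ N', c i x ∈ N'}

theorem le_generated (N : Submodule F W) : N ≤ generated c N :=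
  le_sInf fun _ h => h.1

theorem generated_le {N N' : Submodule F W} (h : N ≤ N') (h' : ∀ i, ∀ x ∈ N', c i x ∈ N') :
    generated c N ≤ N' :=
  sInf_le ⟨h, h'⟩

theorem c_mem_generated (N : Submodule F W) (i : I) (x : W) (hx : x ∈ generated c N) :
    c i x ∈ generated c N := by
  rw [generated, Submodule.mem_sInf] at hx ⊢
  exact fun N' h => h.2 i x (hx N' h)

theorem generated_mono {N N' : Submodule F W} (h : N ≤ N') : generated c N ≤ generated c N' :=
  generated_le (h.trans (le_generated _)) (c_mem_generated _)

theorem generated_bot : generated c (⊥ : Submodule F W) = ⊥ :=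
  le_bot_iff.1 (generated_le le_rfl fun i x hx => by
    rw [Submodule.mem_bot] at hx ⊢; rw [hx, map_zero])

theorem IsStable.generated_le {N N' : Submodule F W} (h' : IsStable a c z N') (h : N ≤ N') :
    generated c N ≤ N' :=
  ModularClifford.generated_le h h'.c_mem

namespace IsFermion

theorem isStable_generated (h : IsFermion s a c z) {N : Submodule F W} (hN : N ≤ vacuumSpace a)
    (hz : ∀ x ∈ N, z x ∈ N) : IsStable a c z (generated c N) := by
  have hG := c_mem_generated (c := c) N
  refine ⟨fun i x hx => ?_, hG, fun x hx => ?_⟩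
  · have h1 : generated c N ≤ generated c N ⊓ ⨅ i, (generated c N).comap (a i) := by
      refine generated_le (le_inf (le_generated _) (le_iInf fun i x hx => ?_)) ?_
      · rw [Submodule.mem_comap, mem_vacuumSpace.1 (hN hx) i]
        exact zero_mem _
      · rintro i x ⟨hx, hx'⟩
        refine ⟨hG i x hx, ?_⟩
        simp only [SetLike.mem_coe, Submodule.mem_iInf, Submodule.mem_comap] at hx' ⊢
        intro j
        by_cases hij : j = i
        · subst hij
          rw [h.ac_self]
          exact sub_mem hx (hG _ _ (hx' _))
        · rw [h.ac j i hij]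
          exact neg_mem (hG _ _ (hx' _))
    have h2 := (h1 hx).2
    simp only [SetLike.mem_coe, Submodule.mem_iInf, Submodule.mem_comap] at h2
    exact h2 i
  · refine generated_le (c := c) (N' := (generated c N).comap z) (fun x hx =>
      le_generated _ (hz x hx)) (fun i x hx => ?_) hx
    rw [Submodule.mem_comap, h.zc]
    exact Submodule.smul_mem _ _ (hG _ _ hx)

theorem z_mem_vacuumSpace (h : IsFermion s a c z) (hs : s ≠ 0) (x : W) (hx : x ∈ vacuumSpace a) :
    z x ∈ vacuumSpace a := by
  rw [mem_vacuumSpace] at hx ⊢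
  intro i
  have h1 := h.za i x
  rw [hx i, map_zero] at h1
  exact (smul_eq_zero.1 h1.symm).resolve_left hs

/-- Induction on the number of annihilation operators that do not kill `x`. If `a i x ≠ 0`, then `x
= a i (c i x) + c i (a i x)`, and both `a i (c i x)` and `a i x` are killed by `a i` and by every `a
j` that kills `x`. -/
theorem mem_generated (h : IsFermion s a c z) {N : Submodule F W} (hN : IsStable a c z N) {x : W}
    (hx : x ∈ N) : x ∈ generated c (N ⊓ vacuumSpace a) := by
  generalize hn : (h.fin x).toFinset.card = n
  induction n using Nat.strong_induction_on generalizing x with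
  | _ n ih =>
    by_cases hΩ : x ∈ vacuumSpace a
    · exact le_generated _ ⟨hx, hΩ⟩
    rw [mem_vacuumSpace] at hΩ
    push Not at hΩ
    obtain ⟨i, hi⟩ := hΩ
    have key : ∀ y ∈ N, a i y = 0 → (∀ j, a j x = 0 → a j y = 0) →
        y ∈ generated c (N ⊓ vacuumSpace a) := by
      intro y hy hiy hj
      refine ih _ ?_ hy rfl
      rw [← hn]
      refine Finset.card_lt_card ⟨fun j hj' => ?_, fun hle => ?_⟩
      · simp only [Set.Finite.mem_toFinset, Set.mem_ofPred_eq] at hj' ⊢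
        exact fun h0 => hj' (hj j h0)
      · have := @hle i (by simpa using hi)
        simp [hiy] at this
    have h1 : x = a i (c i x) + c i (a i x) := by rw [h.ac_self, sub_add_cancel]
    have h2 := key (a i x) (hN.a_mem i x hx) (h.aa_self i x) fun j hj => by
      rw [h.aa, hj, map_zero, neg_zero]
    have h3 := key (a i (c i x)) (hN.a_mem i _ (hN.c_mem i x hx)) (h.aa_self i _) fun j hj => by
      by_cases hij : j = i
      · rw [hij, h.aa_self]
      · rw [h.aa, h.ac j i hij, hj, map_zero, neg_zero, map_zero, neg_zero]
    rw [h1]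
    exact add_mem h3 (c_mem_generated _ i _ h2)

theorem eq_generated (h : IsFermion s a c z) {N : Submodule F W} (hN : IsStable a c z N) :
    generated c (N ⊓ vacuumSpace a) = N :=
  le_antisymm (hN.generated_le inf_le_left) fun _ hx => h.mem_generated hN hx

theorem commute_proj (h : IsFermion s a c z) (i j : I) :
    Commute (a i * c i) (a j * c j) := by
  by_cases hij : i = j
  · rw [hij]
  refine LinearMap.ext fun x => ?_
  simp only [Module.End.mul_apply]
  have hji := Ne.symm hij
  have h1 : c i (a j (c j x)) = a j (c j (c i x)) := by
    rw [h.cc j i, map_neg, h.ac j i hji, neg_neg]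
  rw [h1, h.aa, h.ac i j hij, map_neg, neg_neg]

/-- The commuting operators `a i * c i` fix vacuum vectors and kill the image of `c i`. A suitable
product of them moves a given generated vector into `N`, while leaving it unchanged if it is a
vacuum vector. -/
theorem generated_inf (h : IsFermion s a c z) {N : Submodule F W} (hN : N ≤ vacuumSpace a) :
    generated c N ⊓ vacuumSpace a = N := by
  refine le_antisymm ?_ (le_inf (le_generated _) hN)
  let Q := Submonoid.closure (Set.range fun i => a i * c i)
  have hfix : ∀ q ∈ Q, ∀ x ∈ vacuumSpace a, q x = x := by
    intro q hq
    induction hq using Submonoid.closure_induction with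
    | mem q hq =>
      obtain ⟨i, rfl⟩ := hq
      intro x hx
      rw [Module.End.mul_apply, h.ac_self, mem_vacuumSpace.1 hx, map_zero, sub_zero]
    | one => intro x _; rfl
    | mul q q' _ _ h1 h2 => intro x hx; rw [Module.End.mul_apply, h2 x hx, h1 x hx]
  have hcomm : ∀ q ∈ Q, ∀ q' ∈ Q, Commute q q' := by
    intro q hq
    induction hq using Submonoid.closure_induction with
    | mem q hq =>
      intro q' hq'
      induction hq' using Submonoid.closure_induction with
      | mem q' hq' =>
        obtain ⟨i, rfl⟩ := hq
        obtain ⟨j, rfl⟩ := hq'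
        exact h.commute_proj i j
      | one => exact Commute.one_right _
      | mul _ _ _ _ h1 h2 => exact h1.mul_right h2
    | one => exact fun _ _ => Commute.one_left _
    | mul q q' _ _ h1 h2 => exact fun r hr => (h1 r hr).mul_left (h2 r hr)
  -- Commutativity of `Q` makes this set closed under addition: `q * q'` acts on `x` as `q` and on
  -- `y` as `q'`, since the images already lie in the vacuum space.
  let M : Submodule F W :=
    { carrier := {x | ∃ q ∈ Q, q x ∈ N}
      zero_mem' := ⟨1, one_mem _, by simp⟩
      add_mem' := by
        rintro x y ⟨q, hq, hx⟩ ⟨q', hq', hy⟩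
        refine ⟨q * q', mul_mem hq hq', ?_⟩
        have h1 : (q * q') x = q x := by
          rw [(hcomm q hq q' hq').eq, Module.End.mul_apply, hfix q' hq' _ (hN hx)]
        have h2 : (q * q') y = q' y := by
          rw [Module.End.mul_apply, hfix q hq _ (hN hy)]
        rw [map_add, h1, h2]
        exact add_mem hx hy
      smul_mem' := by
        rintro r x ⟨q, hq, hx⟩
        exact ⟨q, hq, by rw [map_smul]; exact N.smul_mem _ hx⟩ }
  have hM : generated c N ≤ M := by
    refine generated_le (fun x hx => ⟨1, one_mem _, hx⟩) fun i x _ =>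
      ⟨a i * c i, Submonoid.subset_closure ⟨i, rfl⟩, ?_⟩
    rw [Module.End.mul_apply, h.cc_self, map_zero]
    exact zero_mem _
  rintro x ⟨hx, hΩ⟩
  obtain ⟨q, hq, hqx⟩ := hM hx
  rwa [hfix q hq x hΩ] at hqx

theorem vacuum_ne_bot (h : IsFermion s a c z) {N : Submodule F W} (hN : IsStable a c z N)
    (h0 : N ≠ ⊥) : N ⊓ vacuumSpace a ≠ ⊥ := fun h1 => h0 <| by
  rw [← h.eq_generated hN, h1, generated_bot]

/-- An eigenvector in the vacuum space generates an irreducible submodule. -/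
theorem eq_bot_or_eq (h : IsFermion s a c z) {ω : W} (hω : ω ∈ vacuumSpace a)
    {N : Submodule F W} (hN : IsStable a c z N) (hle : N ≤ generated c (F ∙ ω)) :
    N = ⊥ ∨ N = generated c (F ∙ ω) := by
  have h1 : F ∙ ω ≤ vacuumSpace a := (Submodule.span_singleton_le_iff_mem _ _).2 hω
  have h2 : N ⊓ vacuumSpace a ≤ F ∙ ω := by
    rw [← h.generated_inf h1]
    exact inf_le_inf_right _ hle
  by_cases h3 : N ⊓ vacuumSpace a = ⊥
  · left
    rw [← h.eq_generated hN, h3, generated_bot]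
  · right
    obtain ⟨x, hx, hx0⟩ := Submodule.exists_mem_ne_zero_of_ne_bot h3
    obtain ⟨r, rfl⟩ := Submodule.mem_span_singleton.1 (h2 hx)
    have hr : r ≠ 0 := by rintro rfl; simp at hx0
    refine le_antisymm hle (hN.generated_le ((Submodule.span_singleton_le_iff_mem _ _).2 ?_))
    have := N.smul_mem r⁻¹ hx.1
    rwa [smul_smul, inv_mul_cancel₀ hr, one_smul] at this

theorem _root_.Submodule.exists_linearIndependent_span_eq (E : Submodule F W) :
    ∃ (ι : Type w) (b : ι → W), LinearIndependent F b ∧ Submodule.span F (Set.range b) = E := by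
  obtain ⟨S, hS, hli⟩ := exists_linearIndependent F (E : Set W)
  exact ⟨S, (↑), hli.2, by rw [Subtype.range_coe, hli.1, Submodule.span_eq]⟩

/-- The involution `z` preserves the vacuum space and is diagonalizable there, as `2` is invertible.
-/
theorem exists_eigenbasis (h : IsFermion s a c z) (hs : s ≠ 0) (h2 : (2 : F) ≠ 0) :
    ∃ (ι : Type w) (ω : ι → W), LinearIndependent F ω ∧
      Submodule.span F (Set.range ω) = vacuumSpace a ∧
      ∀ i, z (ω i) = ω i ∨ z (ω i) = -ω i := by
  obtain ⟨E, hE⟩ : ∃ E : F → Submodule F W, ∀ ε x, x ∈ E ε ↔ x ∈ vacuumSpace a ∧ z x = ε • x :=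
    ⟨fun ε => vacuumSpace a ⊓ LinearMap.ker (z - ε • 1), fun ε x => by simp [sub_eq_zero]⟩
  obtain ⟨κ, b, hb, hbs⟩ := (E 1).exists_linearIndependent_span_eq
  obtain ⟨κ', b', hb', hbs'⟩ := (E (-1)).exists_linearIndependent_span_eq
  refine ⟨κ ⊕ κ', Sum.elim b b', ?_, ?_, ?_⟩
  · refine hb.sum_type hb' ?_
    rw [hbs, hbs', Submodule.disjoint_def]
    intro x hx hx'
    rw [hE] at hx hx'
    have h3 : (2 : F) • x = 0 := by
      have h4 := hx.2.symm.trans hx'.2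
      rw [one_smul, neg_one_smul] at h4
      rw [two_smul]
      nth_rewrite 1 [h4]
      exact neg_add_cancel x
    exact (smul_eq_zero.1 h3).resolve_left h2
  · rw [Set.Sum.elim_range, Submodule.span_union, hbs, hbs']
    refine le_antisymm (sup_le (fun x hx => ((hE _ _).1 hx).1) fun x hx => ((hE _ _).1 hx).1)
      fun x hx => ?_
    have hz := h.z_mem_vacuumSpace hs x hx
    have h3 : x = (2 : F)⁻¹ • (x + z x) + (2 : F)⁻¹ • (x - z x) := by
      rw [← smul_add, add_add_sub_cancel, ← two_smul F, smul_smul, inv_mul_cancel₀ h2, one_smul]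
    rw [h3]
    refine Submodule.add_mem_sup (Submodule.smul_mem _ _ ((hE _ _).2 ⟨add_mem hx hz, ?_⟩))
      (Submodule.smul_mem _ _ ((hE _ _).2 ⟨sub_mem hx hz, ?_⟩))
    · rw [map_add, h.zz, one_smul, add_comm]
    · rw [map_sub, h.zz, neg_one_smul, neg_sub]
  · rintro (i | i)
    · left
      have := ((hE 1 (b i)).1 (hbs ▸ Submodule.subset_span ⟨i, rfl⟩)).2
      rwa [one_smul] at this
    · right
      have := ((hE (-1) (b' i)).1 (hbs' ▸ Submodule.subset_span ⟨i, rfl⟩)).2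
      rwa [neg_one_smul] at this

theorem isStable_generated_span (h : IsFermion s a c z) {ω : W} (hω : ω ∈ vacuumSpace a)
    {ε : F} (hz : z ω = ε • ω) : IsStable a c z (generated c (F ∙ ω)) := by
  refine h.isStable_generated ((Submodule.span_singleton_le_iff_mem _ _).2 hω) fun x hx => ?_
  obtain ⟨r, rfl⟩ := Submodule.mem_span_singleton.1 hx
  rw [map_smul, hz, smul_smul]
  exact Submodule.smul_mem _ _ (Submodule.mem_span_singleton_self _)

/-- The whole space is a direct sum of irreducible submodules. -/
theorem exists_decomposition (h : IsFermion s a c z) (hs : s ≠ 0) (h2 : (2 : F) ≠ 0) :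
    ∃ (ι : Type w) (N : ι → Submodule F W), (∀ i, IsStable a c z (N i) ∧ N i ≠ ⊥ ∧
      ∀ N' ≤ N i, IsStable a c z N' → N' = ⊥ ∨ N' = N i) ∧ iSupIndep N ∧ ⨆ i, N i = ⊤ := by
  obtain ⟨ι, ω, hli, hspan, hz⟩ := h.exists_eigenbasis hs h2
  have hω : ∀ i, ω i ∈ vacuumSpace a := fun i => hspan ▸ Submodule.subset_span ⟨i, rfl⟩
  have hz' : ∀ i, ∃ ε : F, z (ω i) = ε • ω i := fun i => by
    rcases hz i with h1 | h1
    · exact ⟨1, by rw [h1, one_smul]⟩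
    · exact ⟨-1, by rw [h1, neg_one_smul]⟩
  have hst : ∀ i, IsStable a c z (generated c (F ∙ ω i)) := fun i => by
    obtain ⟨ε, hε⟩ := hz' i
    exact h.isStable_generated_span (hω i) hε
  refine ⟨ι, fun i => generated c (F ∙ ω i), fun i => ⟨hst i, fun h1 => ?_, fun N' hle hN' =>
    h.eq_bot_or_eq (hω i) hN' hle⟩, fun i => ?_, ?_⟩
  · have h3 := le_generated (c := c) (F ∙ ω i)
    rw [show generated c (F ∙ ω i) = ⊥ from h1] at h3
    exact hli.ne_zero i (Submodule.mem_bot F |>.1 (h3 (Submodule.mem_span_singleton_self _)))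
  · have hle : ∀ S : Set ι, Submodule.span F (ω '' S) ≤ vacuumSpace a := fun S =>
      Submodule.span_le.2 (by rintro _ ⟨j, -, rfl⟩; exact hω j)
    have hle' : ⨆ j, ⨆ _ : j ≠ i, generated c (F ∙ ω j) ≤
        generated c (Submodule.span F (ω '' {j | j ≠ i})) :=
      iSup₂_le fun j hj => generated_mono (Submodule.span_mono (by
        rintro _ rfl; exact ⟨j, hj, rfl⟩))
    have hst' : IsStable a c z (generated c (Submodule.span F (ω '' {j | j ≠ i}))) := by
      refine h.isStable_generated (hle _) fun x hx => ?_
      induction hx using Submodule.span_induction with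
      | mem x hx =>
        obtain ⟨j, hj, rfl⟩ := hx
        obtain ⟨ε, hε⟩ := hz' j
        rw [hε]
        exact Submodule.smul_mem _ _ (Submodule.subset_span ⟨j, hj, rfl⟩)
      | zero => rw [map_zero]; exact zero_mem _
      | add x y _ _ hx hy => rw [map_add]; exact add_mem hx hy
      | smul r x _ hx => rw [map_smul]; exact Submodule.smul_mem _ _ hx
    -- A nonzero intersection of stable subspaces would contain a nonzero vacuum vector; so
    -- independence of the summands reduces to that of the vectors `ω`.
    refine Disjoint.mono_right hle' (disjoint_iff.2 ?_)
    by_contra h0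
    refine h.vacuum_ne_bot ((hst i).inf hst') h0 ?_
    rw [inf_inf_distrib_right, h.generated_inf (hle _),
      h.generated_inf ((Submodule.span_singleton_le_iff_mem _ _).2 (hω i)), ← disjoint_iff,
      ← Set.image_singleton]
    exact hli.disjoint_span_image (by simp)
  · rw [eq_top_iff, ← h.eq_generated isStable_top, top_inf_eq, ← hspan]
    refine generated_le (Submodule.span_le.2 ?_) fun i x hx => ?_
    · rintro _ ⟨i, rfl⟩
      exact Submodule.mem_iSup_of_mem i (le_generated _ (Submodule.mem_span_singleton_self _))
    · induction hx using Submodule.iSup_induction' with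
      | mem j x hx => exact Submodule.mem_iSup_of_mem j (c_mem_generated _ _ _ hx)
      | zero => rw [map_zero]; exact zero_mem _
      | add x y _ _ hx hy => rw [map_add]; exact add_mem hx hy

/-- The vacuum space of an irreducible module is spanned by an eigenvector. -/
theorem exists_vacuum (h : IsFermion s a c z) (hs : s ≠ 0) (h2 : (2 : F) ≠ 0)
    (hne : (⊤ : Submodule F W) ≠ ⊥) (hirr : ∀ N, IsStable a c z N → N = ⊥ ∨ N = ⊤) :
    ∃ ω : W, ω ≠ 0 ∧ vacuumSpace a = F ∙ ω ∧ (z ω = ω ∨ z ω = -ω) := by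
  obtain ⟨ι, ω, hli, hspan, hz⟩ := h.exists_eigenbasis hs h2
  have h1 := h.vacuum_ne_bot isStable_top hne
  rw [top_inf_eq, ← hspan] at h1
  have h3 : Nonempty ι := by
    by_contra h4
    rw [not_nonempty_iff] at h4
    simp at h1
  obtain ⟨i⟩ := h3
  have hω : ∀ i, ω i ∈ vacuumSpace a := fun i => hspan ▸ Submodule.subset_span ⟨i, rfl⟩
  have hst : IsStable a c z (generated c (F ∙ ω i)) := by
    rcases hz i with h1 | h1
    · exact h.isStable_generated_span (ε := 1) (hω i) (by rw [h1, one_smul])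
    · exact h.isStable_generated_span (ε := -1) (hω i) (by rw [h1, neg_one_smul])
  refine ⟨ω i, hli.ne_zero i, ?_, hz i⟩
  rcases hirr _ hst with h5 | h5
  · have h3 := le_generated (c := c) (F ∙ ω i)
    rw [h5] at h3
    exact (hli.ne_zero i (Submodule.mem_bot F |>.1 (h3 (Submodule.mem_span_singleton_self _)))).elim
  · rw [← h.generated_inf ((Submodule.span_singleton_le_iff_mem _ _).2 (hω i)), h5, top_inf_eq]

theorem irreducible (h : IsFermion s a c z) {ω : W} (hω : vacuumSpace a = F ∙ ω)
    (N : Submodule F W) (hN : IsStable a c z N) : N = ⊥ ∨ N = ⊤ := by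
  have h1 := h.eq_generated (isStable_top (a := a) (c := c) (z := z))
  rw [top_inf_eq, hω] at h1
  have h2 := h.eq_bot_or_eq (hω ▸ Submodule.mem_span_singleton_self ω) hN (by rw [h1]; exact le_top)
  rwa [h1] at h2

theorem prodMap (h : IsFermion s a c z) (h' : IsFermion s a' c' z') :
    IsFermion s (fun i => (a i).prodMap (a' i)) (fun i => (c i).prodMap (c' i)) (z.prodMap z') where
  aa i j x := Prod.ext (h.aa i j _) (h'.aa i j _)
  aa_self i x := Prod.ext (h.aa_self i _) (h'.aa_self i _)
  cc i j x := Prod.ext (h.cc i j _) (h'.cc i j _)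
  cc_self i x := Prod.ext (h.cc_self i _) (h'.cc_self i _)
  ac i j hij x := Prod.ext (h.ac i j hij _) (h'.ac i j hij _)
  ac_self i x := Prod.ext (h.ac_self i _) (h'.ac_self i _)
  fin x := ((h.fin x.1).union (h'.fin x.2)).subset fun i hi => by
    by_contra h1
    simp only [Set.mem_union, Set.mem_ofPred_eq, not_or, not_not] at h1
    exact hi (Prod.ext h1.1 h1.2)
  za i x := Prod.ext (h.za i _) (h'.za i _)
  zc i x := Prod.ext (h.zc i _) (h'.zc i _)
  zz x := Prod.ext (h.zz _) (h'.zz _)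

/-- Two irreducible modules with the same eigenvalue on the vacuum are isomorphic. -/
theorem exists_equiv (h : IsFermion s a c z) (h' : IsFermion s a' c' z') {ω : W} {ω' : W'}
    (hω0 : ω ≠ 0) (hω0' : ω' ≠ 0) (hω : vacuumSpace a = F ∙ ω) (hω' : vacuumSpace a' = F ∙ ω')
    {ε : F} (hz : z ω = ε • ω) (hz' : z' ω' = ε • ω') :
    ∃ e : W ≃ₗ[F] W', (∀ i x, e (a i x) = a' i (e x)) ∧ (∀ i x, e (c i x) = c' i (e x)) ∧
      ∀ x, e (z x) = z' (e x) := by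
  have hp := h.prodMap h'
  have hmem : (ω, ω') ∈ vacuumSpace fun i => (a i).prodMap (a' i) := mem_vacuumSpace.2 fun i =>
    Prod.ext (mem_vacuumSpace.1 (hω ▸ Submodule.mem_span_singleton_self ω) i)
      (mem_vacuumSpace.1 (hω' ▸ Submodule.mem_span_singleton_self ω') i)
  have hst := hp.isStable_generated_span (ε := ε) hmem (Prod.ext hz hz')
  have hinf := hp.generated_inf ((Submodule.span_singleton_le_iff_mem _ _).2 hmem)
  -- Goursat's argument: the submodule generated by `(ω, ω')` has vacuum space spanned by that
  -- vector, so it meets both kernels of the projections trivially, and by irreducibility it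
  -- projects onto both factors. It is the graph of the isomorphism.
  set Γ := generated (fun i => (c i).prodMap (c' i)) (F ∙ (ω, ω')) with hΓ
  have hΓω : (ω, ω') ∈ Γ := le_generated _ (Submodule.mem_span_singleton_self _)
  have hk1 : ∀ x ∈ Γ, x.1 = 0 → x = 0 := by
    have h1 : Γ ⊓ LinearMap.ker (LinearMap.fst F W W') = ⊥ := by
      by_contra h2
      refine hp.vacuum_ne_bot (hst.inf ⟨fun i x hx => ?_, fun i x hx => ?_, fun x hx => ?_⟩) h2 ?_
      · simp_all
      · simp_all
      · simp_all
      · rw [inf_right_comm, hinf, Submodule.eq_bot_iff]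
        rintro x ⟨hx, hx'⟩
        obtain ⟨r, rfl⟩ := Submodule.mem_span_singleton.1 hx
        have : r = 0 := by simpa [hω0] using hx'
        rw [this, zero_smul]
    intro x hx hx'
    rw [Submodule.eq_bot_iff] at h1
    exact h1 x ⟨hx, hx'⟩
  have hk2 : ∀ x ∈ Γ, x.2 = 0 → x = 0 := by
    have h1 : Γ ⊓ LinearMap.ker (LinearMap.snd F W W') = ⊥ := by
      by_contra h2
      refine hp.vacuum_ne_bot (hst.inf ⟨fun i x hx => ?_, fun i x hx => ?_, fun x hx => ?_⟩) h2 ?_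
      · simp_all
      · simp_all
      · simp_all
      · rw [inf_right_comm, hinf, Submodule.eq_bot_iff]
        rintro x ⟨hx, hx'⟩
        obtain ⟨r, rfl⟩ := Submodule.mem_span_singleton.1 hx
        have : r = 0 := by simpa [hω0'] using hx'
        rw [this, zero_smul]
    intro x hx hx'
    rw [Submodule.eq_bot_iff] at h1
    exact h1 x ⟨hx, hx'⟩
  have hs1 : Γ.map (LinearMap.fst F W W') = ⊤ := by
    refine (h.irreducible hω _ ⟨?_, ?_, ?_⟩).resolve_left fun h1 => hω0 ?_
    · rintro i _ ⟨x, hx, rfl⟩; exact ⟨_, hst.a_mem i x hx, rfl⟩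
    · rintro i _ ⟨x, hx, rfl⟩; exact ⟨_, hst.c_mem i x hx, rfl⟩
    · rintro _ ⟨x, hx, rfl⟩; exact ⟨_, hst.z_mem x hx, rfl⟩
    · exact (Submodule.eq_bot_iff _).1 h1 ω ⟨_, hΓω, rfl⟩
  have hs2 : Γ.map (LinearMap.snd F W W') = ⊤ := by
    refine (h'.irreducible hω' _ ⟨?_, ?_, ?_⟩).resolve_left fun h1 => hω0' ?_
    · rintro i _ ⟨x, hx, rfl⟩; exact ⟨_, hst.a_mem i x hx, rfl⟩
    · rintro i _ ⟨x, hx, rfl⟩; exact ⟨_, hst.c_mem i x hx, rfl⟩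
    · rintro _ ⟨x, hx, rfl⟩; exact ⟨_, hst.z_mem x hx, rfl⟩
    · exact (Submodule.eq_bot_iff _).1 h1 ω' ⟨_, hΓω, rfl⟩
  let e1 : Γ ≃ₗ[F] W := LinearEquiv.ofBijective (LinearMap.fst F W W' ∘ₗ Γ.subtype)
    ⟨(injective_iff_map_eq_zero _).2 fun x hx => Subtype.ext (hk1 x x.2 hx), fun y => by
      obtain ⟨x, hx, rfl⟩ := (hs1 ▸ Submodule.mem_top : y ∈ Γ.map (LinearMap.fst F W W'))
      exact ⟨⟨x, hx⟩, rfl⟩⟩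
  let e2 : Γ ≃ₗ[F] W' := LinearEquiv.ofBijective (LinearMap.snd F W W' ∘ₗ Γ.subtype)
    ⟨(injective_iff_map_eq_zero _).2 fun x hx => Subtype.ext (hk2 x x.2 hx), fun y => by
      obtain ⟨x, hx, rfl⟩ := (hs2 ▸ Submodule.mem_top : y ∈ Γ.map (LinearMap.snd F W W'))
      exact ⟨⟨x, hx⟩, rfl⟩⟩
  have key : ∀ x ∈ Γ, e1.symm.trans e2 x.1 = x.2 := by
    intro x hx
    have : e1.symm x.1 = ⟨x, hx⟩ := e1.symm_apply_eq.2 rfl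
    rw [LinearEquiv.trans_apply, this]
    rfl
  have key' : ∀ x, ∃ y ∈ Γ, y.1 = x := fun x =>
    ⟨(e1.symm x).1, (e1.symm x).2, e1.apply_symm_apply x⟩
  refine ⟨e1.symm.trans e2, fun i x => ?_, fun i x => ?_, fun x => ?_⟩
  · obtain ⟨y, hy, rfl⟩ := key' x
    rw [key y hy]
    exact key _ (hst.a_mem i y hy)
  · obtain ⟨y, hy, rfl⟩ := key' x
    rw [key y hy]
    exact key _ (hst.c_mem i y hy)
  · obtain ⟨y, hy, rfl⟩ := key' x
    rw [key y hy]
    exact key _ (hst.z_mem y hy)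

end IsFermion

end Fermion

/-! ### Dual bases of eigenvectors of the isometry -/

section Polarization

variable {F : Type u} [Field F] {U : Type v} [AddCommGroup U] [Module F U]
  {B : LinearMap.BilinForm F U} {τ : U ≃ₗ[F] U} {T : ℕ} {η : F} {J J' : Type} {f : J → U}
  {σ : J → J} {ρ : J → ℕ} {f' : J' → U} {σ' : J' → J'} {ρ' : J' → ℕ}

/-- A family of eigenvectors of `τ` that is dual to its own permutation by the involution `σ`. -/
structure IsDualSystem (B : LinearMap.BilinForm F U) (τ : U ≃ₗ[F] U) (T : ℕ) (η : F) (f : J → U)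
    (σ : J → J) (ρ : J → ℕ) : Prop where
  eig : ∀ j, τ (f j) = η ^ ρ j • f j
  lt : ∀ j, ρ j < T
  invol : ∀ j, σ (σ j) = j
  gram_self : ∀ j, B (f j) (f (σ j)) = 1
  gram : ∀ i j, j ≠ σ i → B (f i) (f j) = 0

/-- At most one fixed point of `σ` belongs to the eigenvalue `-1`. -/
def AtMostOneFixed (T : ℕ) (σ : J → J) (ρ : J → ℕ) : Prop :=
  ∀ i j, 2 * ρ i = T → 2 * ρ j = T → σ i = i → σ j = j → i = j

theorem IsDualSystem.sum (hB : B.IsSymm) (h : IsDualSystem B τ T η f σ ρ)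
    (h' : IsDualSystem B τ T η f' σ' ρ') (ho : ∀ i j, B (f i) (f' j) = 0) :
    IsDualSystem B τ T η (Sum.elim f f') (Sum.map σ σ') (Sum.elim ρ ρ') where
  eig := by rintro (j | j); exacts [h.eig j, h'.eig j]
  lt := by rintro (j | j); exacts [h.lt j, h'.lt j]
  invol := by rintro (j | j); exacts [congrArg _ (h.invol j), congrArg _ (h'.invol j)]
  gram_self := by rintro (j | j); exacts [h.gram_self j, h'.gram_self j]
  gram := by
    rintro (i | i) (j | j) hij
    · exact h.gram i j fun h1 => hij (congrArg _ h1)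
    · exact ho i j
    · exact (hB.eq _ _).symm.trans (ho j i)
    · exact h'.gram i j fun h1 => hij (congrArg _ h1)

theorem isDualSystem_single {v : U} {r : ℕ} (hr : r < T) (hv : τ v = η ^ r • v)
    (h1 : B v v = 1) : IsDualSystem B τ T η (fun _ : Unit => v) id fun _ => r :=
  ⟨fun _ => hv, fun _ => hr, fun _ => rfl, fun _ => h1, fun _ _ h => (h rfl).elim⟩

theorem isDualSystem_pair (hB : B.IsSymm) {x y : U} {r r' : ℕ} (hr : r < T) (hr' : r' < T)
    (hx : τ x = η ^ r • x) (hy : τ y = η ^ r' • y) (hxx : B x x = 0) (hyy : B y y = 0)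
    (hxy : B x y = 1) :
    IsDualSystem B τ T η (fun b : Bool => cond b x y) not fun b => cond b r r' where
  eig := by rintro (_ | _); exacts [hy, hx]
  lt := by rintro (_ | _); exacts [hr', hr]
  invol := by simp
  gram_self := by rintro (_ | _); exacts [(hB.eq _ _).symm.trans hxy, hxy]
  gram := by
    rintro (_ | _) (_ | _) h
    · exact hyy
    · exact (h rfl).elim
    · exact (h rfl).elim
    · exact hxx

theorem IsDualSystem.ne (h : IsDualSystem B τ T η f σ ρ) {e : J} (he : σ e = e) {j : J}
    (hj : j ≠ e) : σ j ≠ e := fun h1 => hj (by rw [← h.invol j, h1, he])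

theorem IsDualSystem.erase (h : IsDualSystem B τ T η f σ ρ) {e : J} (he : σ e = e) :
    IsDualSystem B τ T η (fun j : {j // j ≠ e} => f j) (fun j => ⟨σ j, h.ne he j.2⟩)
      fun j => ρ j where
  eig j := h.eig j
  lt j := h.lt j
  invol j := Subtype.ext (h.invol j)
  gram_self j := h.gram_self j
  gram i j hij := h.gram i j fun h1 => hij (Subtype.ext h1)

theorem IsDualSystem.apply_sum [Fintype J] (h : IsDualSystem B τ T η f σ ρ)
    (c : J → F) (i : J) : B (f i) (∑ j, c j • f (σ j)) = c i := by
  rw [map_sum, Finset.sum_eq_single i]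
  · rw [map_smul, h.gram_self, smul_eq_mul, mul_one]
  · intro j _ hj
    rw [map_smul, h.gram _ _ fun h1 => hj (by rw [← h.invol j, h1, h.invol]), smul_zero]
  · simp

/-- Pairing a relation with `f (σ i)` isolates the coefficient of `f i`. -/
theorem IsDualSystem.linearIndependent [Fintype J]
    (h : IsDualSystem B τ T η f σ ρ) : LinearIndependent F f := by
  rw [Fintype.linearIndependent_iff]
  intro c hc i
  have h1 := h.apply_sum (fun j => c (σ j)) (σ i)
  rw [h.invol] at h1
  have h2 : ∑ j, c (σ j) • f (σ j) = 0 :=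
    (Equiv.sum_comp (Function.Involutive.toPerm σ h.invol) fun j => c j • f j).trans hc
  rw [← h1, h2, map_zero]

/-- A vector is a sum of eigenvectors. -/
theorem exists_eigen_sum (hT : 0 < T) (hT' : (T : F) ≠ 0) (hη : IsPrimitiveRoot η T)
    (hτT : τ ^ T = 1) (x : U) : ∃ X : ℕ → U, (∀ r, τ (X r) = η ^ r • X r) ∧
      x = ∑ r ∈ Finset.range T, X r ∧
      ∀ S : Submodule F U, (∀ y ∈ S, τ y ∈ S) → x ∈ S → ∀ r, X r ∈ S := by
  have hη0 : η ≠ 0 := hη.ne_zero hT.ne'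
  -- The spectral projections of `τ`, obtained by averaging over its powers; they exist because `T`
  -- is invertible in `F`, and they preserve every `τ`-stable subspace.
  refine ⟨fun r => (T : F)⁻¹ • ∑ k ∈ Finset.range T, (η⁻¹ ^ r) ^ k • (τ ^ k) x, fun r => ?_, ?_,
    fun S hS hx r => S.smul_mem _ (S.sum_mem fun k _ => S.smul_mem _ ?_)⟩
  · rw [map_smul, smul_comm]
    congr 1
    rw [map_sum, Finset.smul_sum]
    have h1 : ∀ k, τ ((η⁻¹ ^ r) ^ k • (τ ^ k) x) =
        η ^ r • ((η⁻¹ ^ r) ^ (k + 1) • (τ ^ (k + 1)) x) := by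
      intro k
      rw [map_smul, smul_smul, pow_succ (η⁻¹ ^ r), mul_left_comm, inv_pow, 
        mul_inv_cancel₀ (pow_ne_zero r hη0), mul_one, pow_succ' τ]
      rfl
    simp only [h1]
    rw [← Finset.smul_sum, ← Finset.smul_sum]
    congr 1
    have h2 := Finset.sum_range_succ (fun k => (η⁻¹ ^ r) ^ k • (τ ^ k) x) T
    rw [Finset.sum_range_succ', hτT, pow_zero, pow_zero, ← pow_mul, mul_comm r T, pow_mul,
      hη.inv.pow_eq_one, one_pow] at h2
    exact add_right_cancel h2
  · rw [← Finset.smul_sum, Finset.sum_comm, Finset.sum_eq_single 0]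
    · simp [smul_smul, hT', ← Nat.cast_smul_eq_nsmul F]
    · intro k hk hk0
      rw [← Finset.sum_smul]
      have h1 : ∑ r ∈ Finset.range T, (η⁻¹ ^ r) ^ k = 0 := by
        have h2 : ∀ r, (η⁻¹ ^ r) ^ k = (η⁻¹ ^ k) ^ r := fun r => by
          rw [← pow_mul, ← pow_mul, mul_comm]
        simp only [h2]
        have h3 : η⁻¹ ^ k ≠ 1 := by
          rw [inv_pow, Ne, inv_eq_one]
          exact hη.pow_ne_one_of_pos_of_lt hk0 (Finset.mem_range.1 hk)
        have h4 := mul_neg_geom_sum (η⁻¹ ^ k) T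
        rw [← pow_mul, mul_comm k T, pow_mul, hη.inv.pow_eq_one, one_pow, sub_self,
          mul_eq_zero, sub_eq_zero] at h4
        exact h4.resolve_left h3.symm
      rw [h1, zero_smul]
    · simp [hT.ne']
  · clear * - hS hx
    induction k with
    | zero => exact hx
    | succ k ih => rw [pow_succ']; exact hS _ ih

theorem dvd_of_isometry (hη : IsPrimitiveRoot η T) (hτ : ∀ a b, B (τ a) (τ b) = B a b) {x y : U}
    {r r' : ℕ} (hx : τ x = η ^ r • x) (hy : τ y = η ^ r' • y) (h : B x y ≠ 0) : T ∣ r + r' := by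
  have h1 := hτ x y
  rw [hx, hy, map_smul, map_smul, LinearMap.smul_apply, smul_smul, ← pow_add, smul_eq_mul,
    mul_eq_right₀ h, add_comm] at h1
  exact (hη.pow_eq_one_iff_dvd _).1 h1

/-- In the orthogonal complement of a dual system there are eigenvectors that are not orthogonal. -/
theorem IsDualSystem.exists_orthogonal [Fintype J] (hB : B.IsSymm) (hBn : B.Nondegenerate)
    (hτ : ∀ a b, B (τ a) (τ b) = B a b) (hT : 0 < T) (hT' : (T : F) ≠ 0)
    (hη : IsPrimitiveRoot η T) (hτT : τ ^ T = 1) (h : IsDualSystem B τ T η f σ ρ)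
    (hspan : Submodule.span F (Set.range f) ≠ ⊤) :
    ∃ (x y : U) (r r' : ℕ), r < T ∧ r' < T ∧ τ x = η ^ r • x ∧ τ y = η ^ r' • y ∧
      B x y ≠ 0 ∧ (∀ j, B (f j) x = 0) ∧ ∀ j, B (f j) y = 0 := by
  have hη0 : η ≠ 0 := hη.ne_zero hT.ne'
  let S : Submodule F U := ⨅ j, LinearMap.ker (B (f j))
  have hS : ∀ x, x ∈ S ↔ ∀ j, B (f j) x = 0 := fun x => by simp [S]
  have hSτ : ∀ x ∈ S, τ x ∈ S := by
    intro x hx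
    rw [hS] at hx ⊢
    intro j
    have h1 := hτ (f j) x
    rw [h.eig, map_smul, LinearMap.smul_apply, hx, smul_eq_mul] at h1
    exact (mul_eq_zero.1 h1).resolve_left (pow_ne_zero _ hη0)
  -- The subtracted sum is the projection onto the span of the dual system along its orthogonal
  -- complement.
  have hP : ∀ x, x - ∑ j, B (f j) x • f (σ j) ∈ S := fun x => (hS _).2 fun i => by
    rw [map_sub, h.apply_sum, sub_self]
  obtain ⟨u, -, hu⟩ := SetLike.exists_of_lt (lt_top_iff_ne_top.2 hspan)
  set x := u - ∑ j, B (f j) u • f (σ j) with hx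
  have hx0 : x ≠ 0 := fun h0 => hu <| by
    rw [sub_eq_zero.1 (hx.symm.trans h0)]
    exact Submodule.sum_mem _ fun j _ => Submodule.smul_mem _ _ (Submodule.subset_span ⟨_, rfl⟩)
  obtain ⟨y, hy⟩ : ∃ y, B x y ≠ 0 := by
    by_contra! h0
    exact hx0 (hBn.1 x h0)
  have hxS : x ∈ S := hP u
  have hy' : B x (y - ∑ j, B (f j) y • f (σ j)) ≠ 0 := by
    rw [map_sub, map_sum, Finset.sum_eq_zero, sub_zero]
    · exact hy
    · intro j _
      rw [map_smul, hB.eq x, (hS x).1 hxS, smul_zero]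
  -- The complement is `τ`-stable, so the eigencomponents of both vectors stay in it, and some pair
  -- of components is not orthogonal.
  obtain ⟨X, hX, hX', hXS⟩ := exists_eigen_sum hT hT' hη hτT x
  obtain ⟨Y, hY, hY', hYS⟩ := exists_eigen_sum hT hT' hη hτT (y - ∑ j, B (f j) y • f (σ j))
  rw [hX', hY', map_sum] at hy'
  obtain ⟨r', hr', h1⟩ := Finset.exists_ne_zero_of_sum_ne_zero hy'
  rw [map_sum, LinearMap.sum_apply] at h1
  obtain ⟨r, hr, h2⟩ := Finset.exists_ne_zero_of_sum_ne_zero h1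
  exact ⟨X r, Y r', r, r', Finset.mem_range.1 hr, Finset.mem_range.1 hr', hX r, hY r', h2,
    (hS _).1 (hXS S hSτ hxS r), (hS _).1 (hYS S hSτ (hP y) r')⟩

theorem IsDualSystem.extend_single [Fintype J] (hB : B.IsSymm) (h : IsDualSystem B τ T η f σ ρ)
    (hu : AtMostOneFixed T σ ρ) {v : U} {r : ℕ} (hr : r < T) (hv : τ v = η ^ r • v)
    (h1 : B v v = 1) (ho : ∀ j, B (f j) v = 0) (hr' : 2 * r = T → ∀ j, 2 * ρ j = T → σ j ≠ j) :
    ∃ (J' : Type) (_ : Fintype J') (f' : J' → U) (σ' : J' → J') (ρ' : J' → ℕ),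
      IsDualSystem B τ T η f' σ' ρ' ∧ AtMostOneFixed T σ' ρ' ∧
      Fintype.card J < Fintype.card J' := by
  refine ⟨J ⊕ Unit, inferInstance, _, _, _, h.sum hB (isDualSystem_single hr hv h1) fun j _ => ho j,
    ?_, by simp⟩
  rintro (i | i) (j | j) hi hj hi' hj'
  · exact congrArg _ (hu i j hi hj (Sum.inl_injective hi') (Sum.inl_injective hj'))
  · exact (hr' hj i hi (Sum.inl_injective hi')).elim
  · exact (hr' hi j hj (Sum.inl_injective hj')).elim
  · rfl

theorem IsDualSystem.extend_pair [Fintype J] (hB : B.IsSymm) (h : IsDualSystem B τ T η f σ ρ)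
    (hu : AtMostOneFixed T σ ρ) {x y : U} {r r' : ℕ} (hr : r < T) (hr' : r' < T)
    (hx : τ x = η ^ r • x) (hy : τ y = η ^ r' • y) (hxx : B x x = 0) (hyy : B y y = 0)
    (hxy : B x y = 1) (hox : ∀ j, B (f j) x = 0) (hoy : ∀ j, B (f j) y = 0) :
    ∃ (J' : Type) (_ : Fintype J') (f' : J' → U) (σ' : J' → J') (ρ' : J' → ℕ),
      IsDualSystem B τ T η f' σ' ρ' ∧ AtMostOneFixed T σ' ρ' ∧
      Fintype.card J' = Fintype.card J + 2 := by
  refine ⟨J ⊕ Bool, inferInstance, _, _, _,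
    h.sum hB (isDualSystem_pair hB hr hr' hx hy hxx hyy hxy) ?_, ?_, by simp⟩
  · rintro i (_ | _)
    exacts [hoy i, hox i]
  · rintro (i | i) (j | j) hi hj hi' hj'
    · exact congrArg _ (hu i j hi hj (Sum.inl_injective hi') (Sum.inl_injective hj'))
    · exact (Bool.not_ne_self j (Sum.inr_injective hj')).elim
    · exact (Bool.not_ne_self i (Sum.inr_injective hi')).elim
    · exact (Bool.not_ne_self j (Sum.inr_injective hj')).elim

/-- An orthogonal pair of complementary eigenvalues is added as a hyperbolic pair; for equal
eigenvalues a normalized vector is added. If that would create a second fixed vector of eigenvalue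
`-1`, the two are recombined into a hyperbolic pair, which needs a square root of `-1`. -/
theorem IsDualSystem.extend [Fintype J] [IsAlgClosed F] (h2 : (2 : F) ≠ 0)
    (hB : B.IsSymm) (hBn : B.Nondegenerate)
    (hτ : ∀ a b, B (τ a) (τ b) = B a b) (hT : 0 < T) (hT' : (T : F) ≠ 0)
    (hη : IsPrimitiveRoot η T) (hτT : τ ^ T = 1) (h : IsDualSystem B τ T η f σ ρ)
    (hu : AtMostOneFixed T σ ρ) (hspan : Submodule.span F (Set.range f) ≠ ⊤) :
    ∃ (J' : Type) (_ : Fintype J') (f' : J' → U) (σ' : J' → J') (ρ' : J' → ℕ),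
      IsDualSystem B τ T η f' σ' ρ' ∧ AtMostOneFixed T σ' ρ' ∧
      Fintype.card J < Fintype.card J' := by
  classical
  obtain ⟨x, y, r, r', hr, hr', hx, hy, hxy, hox, hoy⟩ :=
    h.exists_orthogonal hB hBn hτ hT hT' hη hτT hspan
  obtain ⟨q, hq⟩ := dvd_of_isometry hη hτ hx hy hxy
  by_cases hrr : r = r'
  · subst hrr
    -- Polarization: if `x`, `y` and `x + y` were all isotropic, `B x y` would vanish.
    obtain ⟨v, hv, hov, hvv⟩ : ∃ v, τ v = η ^ r • v ∧ (∀ j, B (f j) v = 0) ∧ B v v ≠ 0 := by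
      by_contra! h0
      have h3 := h0 (x + y) (by rw [map_add, hx, hy, smul_add]) fun j => by
        rw [map_add, hox, hoy, add_zero]
      rw [map_add, map_add, LinearMap.add_apply, LinearMap.add_apply, h0 x hx hox, h0 y hy hoy,
        hB.eq y x, zero_add, add_zero, ← two_mul] at h3
      exact (mul_ne_zero h2 hxy) h3
    obtain ⟨t, ht⟩ := IsAlgClosed.exists_pow_nat_eq (B v v)⁻¹ (n := 2) (by norm_num)
    have hw : B (t • v) (t • v) = 1 := by
      rw [map_smul, map_smul, LinearMap.smul_apply, smul_smul, ← sq, ht, smul_eq_mul,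
        inv_mul_cancel₀ hvv]
    have how : ∀ j, B (f j) (t • v) = 0 := fun j => by rw [map_smul, hov, smul_zero]
    have hτw : τ (t • v) = η ^ r • (t • v) := by rw [map_smul, hv, smul_comm]
    generalize t • v = w at hw how hτw
    by_cases he : 2 * r = T → ∀ j, 2 * ρ j = T → σ j ≠ j
    · exact h.extend_single hB hu hr hτw hw how he
    · push Not at he
      obtain ⟨hrT, e, he, hσe⟩ := he
      obtain ⟨i, hi⟩ := IsAlgClosed.exists_pow_nat_eq (-1 : F) (n := 2) (by norm_num)
      have hre : ρ e = r := by omega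
      have hee : B (f e) (f e) = 1 := by
        have := h.gram_self e
        rwa [hσe] at this
      have hje : ∀ j : {j // j ≠ e}, B (f j) (f e) = 0 := fun j =>
        h.gram _ _ fun h1 => h.ne hσe j.2 h1.symm
      have hfe : τ (f e) = η ^ r • f e := hre ▸ h.eig e
      have hwe : B w (f e) = 0 := (hB.eq _ _).symm.trans (how e)
      -- The orthonormal vectors `f e` and `w` are replaced by `f e + i w` and half of `f e - i w`,
      -- which are isotropic and pair to `1`. One index is lost and two are gained.
      obtain ⟨J', hJ', f', σ', ρ', h3, h4, h5⟩ := (h.erase hσe).extend_pair hB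
        (fun i j hi hj hi' hj' => Subtype.ext (hu i j hi hj (congrArg Subtype.val hi')
          (congrArg Subtype.val hj')))
        (x := f e + i • w) (y := (2 : F)⁻¹ • (f e - i • w)) hr hr
        (by rw [map_add, map_smul, hfe, hτw, smul_add, smul_comm i])
        (by rw [map_smul, map_sub, map_smul, hfe, hτw]; module)
        (by
          simp only [map_add, map_smul, LinearMap.add_apply, LinearMap.smul_apply, hee, hwe, how e,
            hw, smul_eq_mul]
          linear_combination hi)
        (by
          simp only [map_sub, map_smul, LinearMap.sub_apply, LinearMap.smul_apply, hee, hwe, how e,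
            hw, smul_eq_mul]
          linear_combination (2 : F)⁻¹ ^ 2 * hi)
        (by
          simp only [map_add, map_sub, map_smul, LinearMap.add_apply,
            LinearMap.smul_apply, hee, hwe, how e, hw, smul_eq_mul]
          have := inv_mul_cancel₀ h2
          linear_combination this - (2 : F)⁻¹ * hi)
        (fun j => by rw [map_add, map_smul, hje, how, smul_zero, add_zero])
        (fun j => by rw [map_smul, map_sub, map_smul, hje, how, smul_zero, sub_zero, smul_zero])
      refine ⟨J', hJ', f', σ', ρ', h3, h4, ?_⟩
      have h6 : Fintype.card {j // j ≠ e} = Fintype.card J - 1 := by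
        rw [Fintype.card_subtype_compl, Fintype.card_subtype_eq]
      have h7 : 0 < Fintype.card J := Fintype.card_pos_iff.2 ⟨e⟩
      omega
  -- For distinct `r`, `r'` with `T ∣ r + r'`, necessarily `r + r' = T`, so neither eigenvalue is
  -- `1` or `-1` and both vectors are isotropic.
  · have hself : ∀ x' r, r < T → τ x' = η ^ r • x' → (2 * r = 0 ∨ 2 * r = T → False) →
        B x' x' = 0 := by
      intro x' r hr hx' hne
      by_contra h0
      obtain ⟨q, hq⟩ := dvd_of_isometry hη hτ hx' hx' h0
      have : q < 2 := by
        by_contra hq2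
        have : T * 2 ≤ T * q := Nat.mul_le_mul_left _ (by omega)
        omega
      refine hne ?_
      interval_cases q <;> omega
    have hq2 : q < 2 := by
      by_contra hq2
      have : T * 2 ≤ T * q := Nat.mul_le_mul_left _ (by omega)
      omega
    obtain ⟨J', hJ', f', σ', ρ', h3, h4, h5⟩ := h.extend_pair hB hu hr hr' hx
      (y := (B x y)⁻¹ • y) (by rw [map_smul, hy, smul_comm])
      (hself x r hr hx (by interval_cases q <;> omega))
      (by
        rw [map_smul, map_smul, LinearMap.smul_apply,
          hself y r' hr' hy (by interval_cases q <;> omega), smul_zero, smul_zero])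
      (by rw [map_smul, smul_eq_mul, inv_mul_cancel₀ hxy])
      hox (fun j => by rw [map_smul, hoy, smul_zero])
    exact ⟨J', hJ', f', σ', ρ', h3, h4, by omega⟩

theorem exists_isDualSystem [FiniteDimensional F U] [IsAlgClosed F] (h2 : (2 : F) ≠ 0)
    (hB : B.IsSymm) (hBn : B.Nondegenerate)
    (hτ : ∀ a b, B (τ a) (τ b) = B a b) (hT : 0 < T) (hT' : (T : F) ≠ 0)
    (hη : IsPrimitiveRoot η T) (hτT : τ ^ T = 1) :
    ∃ (J : Type) (_ : Fintype J) (f : Module.Basis J F U) (σ : J → J) (ρ : J → ℕ),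
      IsDualSystem B τ T η f σ ρ ∧ AtMostOneFixed T σ ρ := by
  suffices key : ∀ (n : ℕ) (J : Type) [Fintype J] (f : J → U) (σ : J → J) (ρ : J → ℕ),
      IsDualSystem B τ T η f σ ρ → AtMostOneFixed T σ ρ →
      Module.finrank F U - Fintype.card J = n → ∃ (J : Type) (_ : Fintype J)
        (f : Module.Basis J F U) (σ : J → J) (ρ : J → ℕ),
        IsDualSystem B τ T η f σ ρ ∧ AtMostOneFixed T σ ρ from
    key _ Empty Empty.elim id (fun _ => 0) ⟨nofun, nofun, nofun, nofun, nofun⟩ nofun rfl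
  intro n
  induction n using Nat.strong_induction_on with
  | _ n ih =>
    intro J _ f σ ρ h hu hn
    by_cases hspan : Submodule.span F (Set.range f) = ⊤
    · refine ⟨J, inferInstance, Module.Basis.mk (h.linearIndependent) hspan.ge, σ, ρ, ?_, hu⟩
      rw [Module.Basis.coe_mk]
      exact h
    · obtain ⟨J', hJ', f', σ', ρ', h3, h4, h5⟩ :=
        h.extend h2 hB hBn hτ hT hT' hη hτT hu hspan
      have h6 := (h3.linearIndependent).fintype_card_le_finrank
      exact ih _ (by omega) J' f' σ' ρ' h3 h4 rfl

theorem IsDualSystem.finrank_eigenspace [Fintype J] {f : Module.Basis J F U}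
    (hη : IsPrimitiveRoot η T) (h : IsDualSystem B τ T η f σ ρ) {r : ℕ} (hr : r < T) :
    Module.finrank F (Module.End.eigenspace τ.toLinearMap (η ^ r)) =
      Nat.card {j // ρ j = r} := by
  have h1 : Module.End.eigenspace τ.toLinearMap (η ^ r) =
      Submodule.span F (Set.range fun j : {j // ρ j = r} => f j) := by
    refine le_antisymm (fun u hu => ?_) (Submodule.span_le.2 ?_)
    · rw [Module.End.mem_eigenspace_iff, LinearEquiv.coe_coe] at hu
      have h2 : ∀ i, f.repr (τ u) i = η ^ ρ i * f.repr u i := by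
        intro i
        conv_lhs => rw [← f.sum_repr u, map_sum]
        simp only [map_smul, h.eig, smul_comm _ (η ^ _)]
        rw [map_sum, Finsupp.finsetSum_apply, Finset.sum_eq_single i]
        · simp
        · intro j _ hj
          simp [Finsupp.single_eq_of_ne hj.symm]
        · simp
      rw [← f.sum_repr u]
      refine Submodule.sum_mem _ fun i _ => ?_
      by_cases hi : ρ i = r
      · exact Submodule.smul_mem _ _ (Submodule.subset_span ⟨⟨i, hi⟩, rfl⟩)
      · have h3 := h2 i
        rw [hu, map_smul, Finsupp.smul_apply, smul_eq_mul, mul_eq_mul_right_iff] at h3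
        rw [h3.resolve_left fun h4 => hi (hη.pow_inj (h.lt i) hr h4.symm), zero_smul]
        exact zero_mem _
    · rintro _ ⟨⟨j, rfl⟩, rfl⟩
      exact Module.End.mem_eigenspace_iff.2 (h.eig j)
  classical
  rw [h1, finrank_span_eq_card (b := fun j : {j // ρ j = r} => f j)
    (f.linearIndependent.comp _ Subtype.val_injective),
    Nat.card_eq_fintype_card]

theorem IsDualSystem.class_eq (hη : IsPrimitiveRoot η T) (hτ : ∀ a b, B (τ a) (τ b) = B a b)
    (h : IsDualSystem B τ T η f σ ρ) (j : J) : T ∣ ρ j + ρ (σ j) :=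
  dvd_of_isometry hη hτ (h.eig _) (h.eig _) (by rw [h.gram_self]; exact one_ne_zero)

/-- The involution `σ` permutes the basis vectors of eigenvalue `-1`. Their number has the parity of
the number of fixed points, which is at most one. -/
theorem IsDualSystem.odd_finrank_iff [Fintype J] {f : Module.Basis J F U} (hT : 0 < T)
    (hη : IsPrimitiveRoot η T) (hτ : ∀ a b, B (τ a) (τ b) = B a b)
    (h : IsDualSystem B τ T η f σ ρ) (hu : AtMostOneFixed T σ ρ) (hTe : Even T) :
    Odd (Module.finrank F (Module.End.eigenspace τ.toLinearMap (η ^ (T / 2)))) ↔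
      ∃ e, 2 * ρ e = T ∧ σ e = e := by
  classical
  obtain ⟨d, hd⟩ := hTe
  have hTd : T / 2 = d := by omega
  rw [hTd, h.finrank_eigenspace hη (by omega : d < T), Nat.card_eq_fintype_card]
  have hσ : ∀ j, ρ j = d → ρ (σ j) = d := by
    intro j hj
    obtain ⟨q, hq⟩ := h.class_eq hη hτ j
    have h1 := h.lt (σ j)
    have h2 : q < 2 := by
      by_contra hq2
      have : T * 2 ≤ T * q := Nat.mul_le_mul_left _ (by omega)
      have := h.lt j
      omega
    interval_cases q <;> omega
  let σ' : {j // ρ j = d} → {j // ρ j = d} := fun j => ⟨σ j, hσ j j.2⟩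
  have hσ' : Function.Involutive σ' := fun j => Subtype.ext (h.invol j)
  have h1 := Equiv.Perm.card_fixedPoints_modEq (p := 2) (n := 1) (f := σ')
    (by funext j; exact hσ' j)
  have h2 : Fintype.card (Function.fixedPoints σ') ≤ 1 := Fintype.card_le_one_iff.2 fun i j =>
    Subtype.ext (Subtype.ext (hu i j (by have := i.1.2; omega) (by have := j.1.2; omega)
      (congrArg Subtype.val i.2) (congrArg Subtype.val j.2)))
  have h3 : Odd (Fintype.card {j // ρ j = d}) ↔
      Odd (Fintype.card (Function.fixedPoints σ')) := by
    rw [Nat.odd_iff, Nat.odd_iff, h1]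
  rw [h3]
  refine ⟨fun h4 => ?_, fun ⟨e, he, he'⟩ => ?_⟩
  · obtain ⟨e⟩ := Fintype.card_pos_iff.1 h4.pos
    exact ⟨e.1.1, by have := e.1.2; omega, congrArg Subtype.val e.2⟩
  · have h5 : 0 < Fintype.card (Function.fixedPoints σ') :=
      Fintype.card_pos_iff.2 ⟨⟨⟨e, by omega⟩, Subtype.ext he'⟩⟩
    rw [show Fintype.card (Function.fixedPoints σ') = 1 by omega]
    exact odd_one

end Polarization

/-! ### The exterior algebra as a model with one-dimensional vacuum space -/

section Model

open CliffordAlgebra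

variable (F : Type u) [Field F] (I : Type v)

/-- The exterior algebra on the space with basis `I`. -/
abbrev FermionModel : Type (max u v) := ExteriorAlgebra F (I →₀ F)

variable {I}

/-- Contraction with a coordinate. -/
def modelAnnih (i : I) : Module.End F (FermionModel F I) :=
  contractLeft (Q := (0 : QuadraticForm F (I →₀ F))) (Finsupp.lapply i)

/-- Multiplication by a basis vector. -/
def modelCreat (i : I) : Module.End F (FermionModel F I) :=
  LinearMap.mulLeft F (ExteriorAlgebra.ι F (Finsupp.single i 1))

variable {F}

theorem modelAnnih_one (i : I) : modelAnnih F i 1 = 0 := contractLeft_one _ _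

theorem modelAnnih_ι_mul (i : I) (m : I →₀ F) (x : FermionModel F I) :
    modelAnnih F i (ExteriorAlgebra.ι F m * x) =
      m i • x - ExteriorAlgebra.ι F m * modelAnnih F i x :=
  contractLeft_ι_mul _ m x

theorem fermionModel_induction {P : FermionModel F I → Prop}
    (algebraMap : ∀ r : F, P (algebraMap _ _ r)) (add : ∀ x y, P x → P y → P (x + y))
    (ι_mul : ∀ x m, P x → P (ExteriorAlgebra.ι F m * x)) (x : FermionModel F I) : P x :=
  left_induction (Q := (0 : QuadraticForm F (I →₀ F))) algebraMap add ι_mul x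

theorem modelAnnih_algebraMap (i : I) (r : F) :
    modelAnnih F i (algebraMap F (FermionModel F I) r) = 0 := by
  rw [Algebra.algebraMap_eq_smul_one, map_smul, modelAnnih_one, smul_zero]

theorem modelAnnih_finite (x : FermionModel F I) : {i | modelAnnih F i x ≠ 0}.Finite := by
  induction x using fermionModel_induction with
  | algebraMap r => simp [modelAnnih_algebraMap]
  | add x y hx hy =>
    refine (hx.union hy).subset fun i hi => ?_
    by_contra h
    simp only [Set.mem_union, Set.mem_ofPred_eq, not_or, not_not] at h
    exact hi (by rw [map_add, h.1, h.2, add_zero])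
  | ι_mul x m hx =>
    refine (hx.union m.hasFiniteSupport).subset fun i hi => ?_
    by_contra h
    simp only [Set.mem_union, Set.mem_ofPred_eq, not_or, not_not, Function.mem_support] at h
    exact hi (by rw [modelAnnih_ι_mul, h.1, h.2, zero_smul, mul_zero, sub_zero])

theorem isFermion_model {s : F} {z : Module.End F (FermionModel F I)}
    (za : ∀ i x, z (modelAnnih F i x) = s • modelAnnih F i (z x))
    (zc : ∀ i x, z (modelCreat F i x) = s • modelCreat F i (z x)) (zz : ∀ x, z (z x) = x) :
    IsFermion s (modelAnnih F) (modelCreat F) z where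
  aa i j x := contractLeft_comm _ _ x
  aa_self i x := contractLeft_contractLeft _ x
  cc i j x := by
    rw [modelCreat, modelCreat, LinearMap.mulLeft_apply, LinearMap.mulLeft_apply,
      LinearMap.mulLeft_apply, LinearMap.mulLeft_apply, ← mul_assoc, ← mul_assoc,
      ← add_eq_zero_iff_eq_neg, ← add_mul, ExteriorAlgebra.ι_add_mul_swap, zero_mul]
  cc_self i x := by
    rw [modelCreat, LinearMap.mulLeft_apply, LinearMap.mulLeft_apply, ← mul_assoc,
      ExteriorAlgebra.ι_sq_zero, zero_mul]
  ac i j hij x := by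
    rw [modelCreat, LinearMap.mulLeft_apply, modelAnnih_ι_mul, Finsupp.single_eq_of_ne hij,
      zero_smul, zero_sub, LinearMap.mulLeft_apply]
  ac_self i x := by
    rw [modelCreat, LinearMap.mulLeft_apply, modelAnnih_ι_mul, Finsupp.single_eq_same,
      one_smul, LinearMap.mulLeft_apply]
  fin := modelAnnih_finite
  za := za
  zc := zc
  zz := zz

variable (F I) in
theorem isFermion_model_one :
    IsFermion (1 : F) (modelAnnih F) (modelCreat F) (1 : Module.End F (FermionModel F I)) :=
  isFermion_model (by simp) (by simp) (by simp)

variable (F I) in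
/-- The parity operator. -/
def modelParity : Module.End F (FermionModel F I) :=
  (involute (Q := (0 : QuadraticForm F (I →₀ F)))).toLinearMap

theorem modelParity_one : modelParity F I 1 = 1 :=
  map_one (involute (Q := (0 : QuadraticForm F (I →₀ F))))

theorem modelParity_ι_mul (m : I →₀ F) (x : FermionModel F I) :
    modelParity F I (ExteriorAlgebra.ι F m * x) = -(ExteriorAlgebra.ι F m * modelParity F I x) := by
  have h1 := map_mul (involute (Q := (0 : QuadraticForm F (I →₀ F)))) (ι _ m) x
  rw [involute_ι, neg_mul] at h1
  exact h1

theorem modelParity_modelAnnih (i : I) (x : FermionModel F I) :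
    modelParity F I (modelAnnih F i x) = -modelAnnih F i (modelParity F I x) := by
  induction x using fermionModel_induction with
  | algebraMap r =>
    rw [Algebra.algebraMap_eq_smul_one]
    simp only [map_smul, modelAnnih_one, modelParity_one, smul_zero, map_zero, neg_zero]
  | add x y hx hy => rw [map_add, map_add, map_add, map_add, hx, hy, neg_add]
  | ι_mul x m hx =>
    rw [modelAnnih_ι_mul, map_sub, modelParity_ι_mul, modelParity_ι_mul, map_neg,
      modelAnnih_ι_mul, hx, map_smul, mul_neg]
    abel

theorem isFermion_model_parity {ε : F} (hε : ε * ε = 1) :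
    IsFermion (-1 : F) (modelAnnih F) (modelCreat F) (ε • modelParity F I) := by
  refine isFermion_model (fun i x => ?_) (fun i x => ?_) fun x => ?_
  · rw [LinearMap.smul_apply, LinearMap.smul_apply, modelParity_modelAnnih, map_smul, neg_one_smul,
      smul_neg]
  · rw [LinearMap.smul_apply, LinearMap.smul_apply, map_smul, neg_one_smul, modelCreat,
      LinearMap.mulLeft_apply, LinearMap.mulLeft_apply, modelParity_ι_mul, smul_neg]
  · rw [LinearMap.smul_apply, LinearMap.smul_apply, map_smul, smul_smul, hε, one_smul]
    exact involute_involute _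

variable (F I) in
-- Creation operators generate everything from `1`, so `generated_inf` identifies the vacuum space
-- without a basis of monomials.
theorem vacuumSpace_model : vacuumSpace (modelAnnih (I := I) F) = F ∙ (1 : FermionModel F I) := by
  have h1 : generated (modelCreat F) (F ∙ (1 : FermionModel F I)) = ⊤ := by
    rw [eq_top_iff]
    rintro x -
    induction x using fermionModel_induction with
    | algebraMap r =>
      rw [Algebra.algebraMap_eq_smul_one]
      exact le_generated _ (Submodule.smul_mem _ _ (Submodule.mem_span_singleton_self _))
    | add x y hx hy => exact add_mem hx hy
    | ι_mul x m hx =>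
      induction m using Finsupp.induction_linear with
      | zero => rw [map_zero, zero_mul]; exact zero_mem _
      | add m m' h h' => rw [map_add, add_mul]; exact add_mem h h'
      | single i r =>
        have h2 : Finsupp.single i r = r • Finsupp.single i (1 : F) := by simp
        rw [h2, map_smul, smul_mul_assoc]
        exact Submodule.smul_mem _ _ (c_mem_generated _ i x hx)
  have h2 := (isFermion_model_one F I).generated_inf (N := F ∙ (1 : FermionModel F I))
    ((Submodule.span_singleton_le_iff_mem _ _).2 (mem_vacuumSpace.2 modelAnnih_one))
  rwa [h1, top_inf_eq] at h2

end Model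

/-! ### From mode representations to annihilation, creation and zero operators -/

section Correspondence

variable {F : Type u} [Field F] {U : Type v} [AddCommGroup U] [Module F U]
  {B : LinearMap.BilinForm F U} {ℓ : F} {τ : U ≃ₗ[F] U} {T : ℕ} {η : F} {J : Type}
  {f : J → U} {σ : J → J} {ρ : J → ℕ} {e : Option J} {t : F}
  {W : Type w} [AddCommGroup W] [Module F W] {W' : Type w'} [AddCommGroup W'] [Module F W']
  {A : J → ℤ → Module.End F W} {A' : J → ℤ → Module.End F W'}

/-- The normalized mode of the fixed point `e` of `σ`, if there is one. -/
def zeroOp (t : F) (ρ : J → ℕ) (A : J → ℤ → Module.End F W) : Option J → Module.End F W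
  | none => 1
  | some e => t • A e (-ρ e)

variable (F) in
/-- The sign by which `zeroOp` commutes with the other operators. -/
def zeroSign : Option J → F
  | none => 1
  | some _ => -1

/-- The fixed point of `σ` belonging to the eigenvalue `-1` is `e`. -/
def IsFixedMode (T : ℕ) (σ : J → J) (ρ : J → ℕ) (e : Option J) : Prop :=
  ∀ j, 2 * ρ j = T ∧ σ j = j ↔ e = some j

theorem IsDualSystem.bar_class (hη : IsPrimitiveRoot η T) (hτ : ∀ a b, B (τ a) (τ b) = B a b)
    (h : IsDualSystem B τ T η f σ ρ) {j : J} {k : ℤ} (hk : k ≡ ρ j [ZMOD T]) :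
    -T - k ≡ ρ (σ j) [ZMOD T] := by
  obtain ⟨q, hq⟩ := h.class_eq hη hτ j
  obtain ⟨r, hr⟩ := hk.dvd
  refine Int.modEq_iff_dvd.2 ⟨q + 1 - r, ?_⟩
  have hq' : (ρ j : ℤ) + ρ (σ j) = T * q := by exact_mod_cast hq
  linear_combination hq' - hr

theorem IsFixedMode.class_eq {e' : J} (he : IsFixedMode T σ ρ (some e')) :
    2 * (-ρ e' : ℤ) = -T := by
  have := ((he e').2 rfl).1
  omega

namespace IsModeRep

theorem anticomm (h : IsDualSystem B τ T η f σ ρ) (hA : IsModeRep T B ℓ f (fun j => (ρ j : ℤ)) A)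
    {i j : J} {m n : ℤ} (hm : m ≡ ρ i [ZMOD T]) (hne : ¬ (j = σ i ∧ m + n + T = 0)) (x : W) :
    A i m (A j n x) = -A j n (A i m x) := by
  rw [← add_eq_zero_iff_eq_neg, hA.rel i j m n x hm]
  split_ifs with h1
  · rw [h.gram i j fun h2 => hne ⟨h2, h1⟩, mul_zero, zero_smul]
  · rfl

theorem anticomm_conj (h : IsDualSystem B τ T η f σ ρ)
    (hA : IsModeRep T B ℓ f (fun j => (ρ j : ℤ)) A)
    {i : J} {m : ℤ} (hm : m ≡ ρ i [ZMOD T]) (x : W) :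
    A i m (A (σ i) (-T - m) x) + A (σ i) (-T - m) (A i m x) = ℓ • x := by
  rw [hA.rel _ _ _ _ _ hm, if_pos (by ring), h.gram_self, mul_one]

theorem apply_fixed (ht : t ≠ 0) (A : J → ℤ → Module.End F W) (e' : J) (x : W) :
    A e' (-ρ e') x = t⁻¹ • zeroOp t ρ A (some e') x := by
  rw [zeroOp, LinearMap.smul_apply, smul_smul, inv_mul_cancel₀ ht, one_smul]

end IsModeRep

variable [LinearOrder J]

/-- The modes `(j, k)` that annihilate the vacuum. -/
structure IsAnnihMode (T : ℕ) (σ : J → J) (ρ : J → ℕ) (j : J) (k : ℤ) : Prop where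
  cls : k ≡ ρ j [ZMOD T]
  pos : -(T : ℤ) ≤ 2 * k
  lt : 2 * k = -T → j < σ j

/-- The set of the modes that annihilate the vacuum. -/
abbrev AnnihMode (T : ℕ) (σ : J → J) (ρ : J → ℕ) : Type :=
  {q : J × ℤ // IsAnnihMode T σ ρ q.1 q.2}

/-- The annihilation operators of a mode representation. -/
def annihOp (T : ℕ) (σ : J → J) (ρ : J → ℕ) (A : J → ℤ → Module.End F W) (q : AnnihMode T σ ρ) :
    Module.End F W := A q.1.1 q.1.2

/-- The creation operators of a mode representation. -/
def creatOp (ℓ : F) (T : ℕ) (σ : J → J) (ρ : J → ℕ) (A : J → ℤ → Module.End F W)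
    (q : AnnihMode T σ ρ) : Module.End F W := ℓ⁻¹ • A (σ q.1.1) (-T - q.1.2)

theorem IsAnnihMode.ne_fixed {j : J} {k : ℤ} (hk : IsAnnihMode T σ ρ j k) {e' : J}
    (he : IsFixedMode T σ ρ (some e')) : ¬ (j = e' ∧ k = -ρ e') := by
  rintro ⟨rfl, rfl⟩
  exact (hk.lt he.class_eq).ne ((he _).2 rfl).2.symm

/-- Two annihilating modes are not conjugate. -/
theorem IsDualSystem.not_conj (h : IsDualSystem B τ T η f σ ρ) {i j : J} {m n : ℤ}
    (hm : IsAnnihMode T σ ρ i m) (hn : IsAnnihMode T σ ρ j n) : ¬ (j = σ i ∧ m + n + T = 0) := by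
  rintro ⟨rfl, h0⟩
  have h1 := hm.pos
  have h2 := hn.pos
  have h3 := hm.lt (by omega)
  have h4 := hn.lt (by omega)
  rw [h.invol] at h4
  exact lt_asymm h3 h4

/-- Every mode is annihilating, or conjugate to an annihilating mode, or the fixed mode. -/
theorem IsDualSystem.mode_cases (hη : IsPrimitiveRoot η T) (hτ : ∀ a b, B (τ a) (τ b) = B a b)
    (h : IsDualSystem B τ T η f σ ρ) (he : IsFixedMode T σ ρ e) {j : J} {k : ℤ}
    (hk : k ≡ ρ j [ZMOD T]) :
    IsAnnihMode T σ ρ j k ∨ IsAnnihMode T σ ρ (σ j) (-T - k) ∨ e = some j ∧ k = -ρ j := by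
  have hbar := h.bar_class hη hτ hk
  rcases lt_trichotomy (-(T : ℤ)) (2 * k) with h1 | h1 | h1
  · exact Or.inl ⟨hk, h1.le, fun h2 => by omega⟩
  · rcases lt_trichotomy j (σ j) with h2 | h2 | h2
    · exact Or.inl ⟨hk, h1.le, fun _ => h2⟩
    · refine Or.inr (Or.inr ?_)
      have h3 : 2 * ρ j = T := by
        obtain ⟨q, hq⟩ := hk.dvd
        have h4 := h.lt j
        have h5 : 2 * (ρ j : ℤ) = T * (2 * q - 1) := by linear_combination 2 * hq - h1
        have h6 : 0 < 2 * q - 1 := by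
          by_contra h7
          rcases (by omega : 2 * q - 1 ≤ -1) with h8
          have : (T : ℤ) * (2 * q - 1) ≤ T * (-1) := mul_le_mul_of_nonneg_left h8 (by omega)
          omega
        have h7 : 2 * q - 1 < 2 := by
          by_contra h7
          have : (T : ℤ) * 2 ≤ T * (2 * q - 1) := mul_le_mul_of_nonneg_left (by omega) (by omega)
          omega
        have h8 : 2 * q - 1 = 1 := by omega
        rw [h8] at h5
        omega
      exact ⟨(he j).1 ⟨h3, h2.symm⟩, by omega⟩
    · exact Or.inr (Or.inl ⟨hbar, by omega, fun _ => by rwa [h.invol]⟩)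
  · exact Or.inr (Or.inl ⟨hbar, by omega, fun h2 => by omega⟩)

namespace IsModeRep

/-- Annihilating modes are never conjugate to one another, so the only nontrivial anticommutators
join a mode to its conjugate. Local finiteness combines truncation with the lower bound on `k` and
finiteness of `J`. The zero mode squares to `ℓ / 2`, hence the normalization `t * t * ℓ = 2`. -/
theorem isFermion [Finite J] (h2 : (2 : F) ≠ 0) (hℓ : ℓ ≠ 0) (ht : t * t * ℓ = 2)
    (hη : IsPrimitiveRoot η T)
    (hτ : ∀ a b, B (τ a) (τ b) = B a b) (h : IsDualSystem B τ T η f σ ρ)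
    (he : IsFixedMode T σ ρ e) (hA : IsModeRep T B ℓ f (fun j => (ρ j : ℤ)) A) :
    IsFermion (zeroSign F e) (annihOp T σ ρ A) (creatOp ℓ T σ ρ A) (zeroOp t ρ A e) := by
  have haa : ∀ (p q : AnnihMode T σ ρ) x, A p.1.1 p.1.2 (A q.1.1 q.1.2 x) =
      -A q.1.1 q.1.2 (A p.1.1 p.1.2 x) := fun p q x =>
    hA.anticomm h p.2.cls (h.not_conj p.2 q.2) x
  have hcc : ∀ (p q : AnnihMode T σ ρ) x,
      A (σ p.1.1) (-T - p.1.2) (A (σ q.1.1) (-T - q.1.2) x) =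
      -A (σ q.1.1) (-T - q.1.2) (A (σ p.1.1) (-T - p.1.2) x) := fun p q x =>
    hA.anticomm h (h.bar_class hη hτ p.2.cls) (fun ⟨h3, h4⟩ => h.not_conj p.2 q.2
      ⟨by rw [← h.invol q.1.1, h3, h.invol], by omega⟩) x
  -- Squares vanish because an operator anticommuting with itself satisfies `y = -y`, and `2` is
  -- invertible.
  have hself : ∀ y : W, y = -y → y = 0 := fun y hy => by
    have h3 : (2 : F) • y = 0 := by
      rw [two_smul]
      nth_rewrite 1 [hy]
      exact neg_add_cancel y
    exact (smul_eq_zero.1 h3).resolve_left h2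
  have hz : ∀ e', e = some e' → ∀ (p : AnnihMode T σ ρ) x,
      A e' (-ρ e') (A p.1.1 p.1.2 x) = -A p.1.1 p.1.2 (A e' (-ρ e') x) ∧
      A e' (-ρ e') (A (σ p.1.1) (-T - p.1.2) x) =
        -A (σ p.1.1) (-T - p.1.2) (A e' (-ρ e') x) := by
    rintro e' rfl p x
    have h3 := he.class_eq
    have h4 : -(ρ e' : ℤ) ≡ ρ e' [ZMOD T] := Int.modEq_iff_dvd.2 ⟨1, by omega⟩
    have h5 := ((he e').2 rfl).2
    refine ⟨hA.anticomm h h4 (fun ⟨h6, h7⟩ => p.2.ne_fixed he ⟨h6.trans h5, by omega⟩) x,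
      hA.anticomm h h4 (fun ⟨h6, h7⟩ => p.2.ne_fixed he ⟨?_, by omega⟩) x⟩
    rw [← h.invol p.1.1, h6, h.invol]
  refine ⟨fun p q x => haa p q x, fun p x => hself _ (haa p p x), fun p q x => ?_, fun p x => ?_,
    fun p q hpq x => ?_, fun p x => ?_, fun x => ?_, fun p x => ?_, fun p x => ?_, fun x => ?_⟩
  · simp only [creatOp, LinearMap.smul_apply, map_smul]
    rw [hcc p q, smul_neg, smul_neg]
  · simp only [creatOp, LinearMap.smul_apply, map_smul]
    rw [hself _ (hcc p p x), smul_zero, smul_zero]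
  · simp only [annihOp, creatOp, LinearMap.smul_apply, map_smul]
    rw [hA.anticomm h p.2.cls, smul_neg]
    rintro ⟨h3, h4⟩
    exact hpq (Subtype.ext (Prod.ext (by rw [← h.invol p.1.1, ← h3, h.invol]) (by omega)))
  · simp only [annihOp, creatOp, LinearMap.smul_apply, map_smul]
    rw [eq_sub_iff_add_eq, ← smul_add, hA.anticomm_conj h p.2.cls, smul_smul, inv_mul_cancel₀ hℓ,
      one_smul]
  · choose N hN using fun j => hA.trunc j x
    have h3 : (⋃ j, {j} ×ˢ Set.Icc (-(T : ℤ)) (N j)).Finite :=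
      Set.finite_iUnion fun j => (Set.finite_singleton j).prod (Set.finite_Icc _ _)
    refine (h3.preimage Subtype.val_injective.injOn).subset fun p hp => ?_
    have h4 := p.2.pos
    refine Set.mem_iUnion.2 ⟨p.1.1, rfl, by omega, ?_⟩
    by_contra h5
    exact hp (hN _ _ (by omega))
  · cases e with
    | none => simp [zeroSign, zeroOp]
    | some e' =>
      simp only [zeroSign, zeroOp, annihOp, LinearMap.smul_apply, map_smul]
      rw [(hz e' rfl p x).1, neg_one_smul, smul_neg]
  · cases e with
    | none => simp [zeroSign, zeroOp]
    | some e' =>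
      simp only [zeroSign, zeroOp, creatOp, LinearMap.smul_apply, map_smul]
      rw [(hz e' rfl p x).2, neg_one_smul, smul_neg, smul_neg, smul_comm t]
  · cases e with
    | none => rfl
    | some e' =>
      have h3 := he.class_eq
      have h4 : -(ρ e' : ℤ) ≡ ρ e' [ZMOD T] := Int.modEq_iff_dvd.2 ⟨1, by omega⟩
      have h5 := hA.anticomm_conj h h4 x
      rw [((he e').2 rfl).2, show -(T : ℤ) - -ρ e' = -ρ e' by omega, ← two_smul F] at h5
      simp only [zeroOp, LinearMap.smul_apply, map_smul]
      refine smul_right_injective W h2 ?_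
      change (2 : F) • t • t • _ = (2 : F) • x
      rw [smul_comm (2 : F), smul_comm (2 : F), h5, smul_smul, smul_smul, ht]

theorem op_cases (hη : IsPrimitiveRoot η T)
    (hτ : ∀ a b, B (τ a) (τ b) = B a b) (h : IsDualSystem B τ T η f σ ρ)
    (he : IsFixedMode T σ ρ e) (j : J) (k : ℤ) :
    ¬ k ≡ ρ j [ZMOD T] ∨ (∃ p : AnnihMode T σ ρ, j = p.1.1 ∧ k = p.1.2) ∨
      (∃ p : AnnihMode T σ ρ, j = σ p.1.1 ∧ k = -T - p.1.2) ∨ e = some j ∧ k = -ρ j := by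
  by_cases hk : k ≡ ρ j [ZMOD T]
  · rcases h.mode_cases hη hτ he hk with h1 | h1 | h1
    · exact Or.inr (Or.inl ⟨⟨(j, k), h1⟩, rfl, rfl⟩)
    · exact Or.inr (Or.inr (Or.inl ⟨⟨(σ j, -T - k), h1⟩, (h.invol j).symm, by dsimp only; ring⟩))
    · exact Or.inr (Or.inr (Or.inr h1))
  · exact Or.inl hk

theorem apply_conj (hℓ : ℓ ≠ 0) (A : J → ℤ → Module.End F W) (p : AnnihMode T σ ρ) (x : W) :
    A (σ p.1.1) (-T - p.1.2) x = ℓ • creatOp ℓ T σ ρ A p x := by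
  rw [creatOp, LinearMap.smul_apply, smul_smul, mul_inv_cancel₀ hℓ, one_smul]

theorem isStable_iff (hℓ : ℓ ≠ 0) (ht : t ≠ 0) (hη : IsPrimitiveRoot η T)
    (hτ : ∀ a b, B (τ a) (τ b) = B a b) (h : IsDualSystem B τ T η f σ ρ)
    (he : IsFixedMode T σ ρ e) (hA : IsModeRep T B ℓ f (fun j => (ρ j : ℤ)) A)
    (N : Submodule F W) : (∀ j k, ∀ x ∈ N, A j k x ∈ N) ↔
      IsStable (annihOp T σ ρ A) (creatOp ℓ T σ ρ A) (zeroOp t ρ A e) N := by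
  refine ⟨fun hN => ⟨fun p x hx => hN _ _ x hx, fun p x hx => N.smul_mem _ (hN _ _ x hx),
    fun x hx => ?_⟩, fun hN j k x hx => ?_⟩
  · cases e with
    | none => exact hx
    | some e' => exact N.smul_mem _ (hN _ _ x hx)
  · rcases op_cases hη hτ h he j k with h1 | ⟨p, rfl, rfl⟩ | ⟨p, rfl, rfl⟩ | ⟨rfl, rfl⟩
    · rw [hA.supp j k h1]; exact zero_mem _
    · exact hN.a_mem p x hx
    · rw [apply_conj hℓ]
      exact N.smul_mem _ (hN.c_mem p x hx)
    · rw [apply_fixed ht]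
      exact N.smul_mem _ (hN.z_mem x hx)

theorem intertwine_iff (hℓ : ℓ ≠ 0) (ht : t ≠ 0) (hη : IsPrimitiveRoot η T)
    (hτ : ∀ a b, B (τ a) (τ b) = B a b) (h : IsDualSystem B τ T η f σ ρ)
    (he : IsFixedMode T σ ρ e) (hA : IsModeRep T B ℓ f (fun j => (ρ j : ℤ)) A)
    (hA' : IsModeRep T B ℓ f (fun j => (ρ j : ℤ)) A') (E : W ≃ₗ[F] W') :
    (∀ j k x, E (A j k x) = A' j k (E x)) ↔
      (∀ p x, E (annihOp T σ ρ A p x) = annihOp T σ ρ A' p (E x)) ∧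
      (∀ p x, E (creatOp ℓ T σ ρ A p x) = creatOp ℓ T σ ρ A' p (E x)) ∧
      ∀ x, E (zeroOp t ρ A e x) = zeroOp t ρ A' e (E x) := by
  refine ⟨fun hE => ⟨fun p x => hE _ _ x, fun p x => ?_, fun x => ?_⟩, fun hE j k x => ?_⟩
  · rw [creatOp, creatOp, LinearMap.smul_apply, LinearMap.smul_apply, map_smul, hE]
  · cases e with
    | none => rfl
    | some e' =>
      rw [zeroOp, zeroOp, LinearMap.smul_apply, LinearMap.smul_apply, map_smul, hE]
  · rcases op_cases hη hτ h he j k with h1 | ⟨p, rfl, rfl⟩ | ⟨p, rfl, rfl⟩ | ⟨rfl, rfl⟩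
    · rw [hA.supp j k h1, hA'.supp j k h1, LinearMap.zero_apply, LinearMap.zero_apply, map_zero]
    · exact hE.1 p x
    · rw [apply_conj hℓ, apply_conj hℓ, map_smul, hE.2.1]
    · rw [apply_fixed ht, apply_fixed ht, map_smul, hE.2.2]

end IsModeRep

end Correspondence

/-! ### From annihilation, creation and zero operators back to mode representations -/

section Reconstruction

variable {F : Type u} [Field F] {U : Type v} [AddCommGroup U] [Module F U]
  {B : LinearMap.BilinForm F U} {ℓ : F} {τ : U ≃ₗ[F] U} {T : ℕ} {η : F} {J : Type}
  {f : J → U} {σ : J → J} {ρ : J → ℕ} {e : Option J} {t s : F}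
  {W : Type w} [AddCommGroup W] [Module F W] [LinearOrder J]
  {a c : AnnihMode T σ ρ → Module.End F W} {z : Module.End F W}

open Classical in
/-- The modes determined by annihilation, creation and zero operators. -/
def fermionMode (ℓ t : F) (T : ℕ) (σ : J → J) (ρ : J → ℕ) (e : Option J)
    (a c : AnnihMode T σ ρ → Module.End F W) (z : Module.End F W) (j : J) (k : ℤ) :
    Module.End F W :=
  if h : IsAnnihMode T σ ρ j k then a ⟨(j, k), h⟩
  else if h : IsAnnihMode T σ ρ (σ j) (-T - k) then ℓ • c ⟨(σ j, -T - k), h⟩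
  else if e = some j ∧ k = -ρ j then t⁻¹ • z else 0

theorem fermionMode_annih (p : AnnihMode T σ ρ) :
    fermionMode ℓ t T σ ρ e a c z p.1.1 p.1.2 = a p := dif_pos p.2

theorem fermionMode_conj (h : IsDualSystem B τ T η f σ ρ) (p : AnnihMode T σ ρ) :
    fermionMode ℓ t T σ ρ e a c z (σ p.1.1) (-T - p.1.2) = ℓ • c p := by
  have h1 : ((σ (σ p.1.1), -T - (-T - p.1.2)) : J × ℤ) = p.1 :=
    Prod.ext (h.invol _) (by dsimp only; ring)
  rw [fermionMode, dif_neg fun h' => h.not_conj p.2 h' ⟨rfl, by ring⟩,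
    dif_pos (by have := p.2; rwa [← h1] at this)]
  congr 2
  exact Subtype.ext h1

theorem fermionMode_fixed {e' : J}
    (he : IsFixedMode T σ ρ (some e')) :
    fermionMode ℓ t T σ ρ (some e') a c z e' (-ρ e') = t⁻¹ • z := by
  have h1 := he.class_eq
  rw [fermionMode, dif_neg fun h' => h'.ne_fixed he ⟨rfl, rfl⟩,
    dif_neg fun h' => h'.ne_fixed he ⟨((he e').2 rfl).2, by omega⟩, if_pos ⟨rfl, rfl⟩]

theorem fermionMode_support (hη : IsPrimitiveRoot η T)
    (hτ : ∀ a b, B (τ a) (τ b) = B a b) (h : IsDualSystem B τ T η f σ ρ)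
    (he : IsFixedMode T σ ρ e) {j : J} {k : ℤ} (hk : ¬ k ≡ ρ j [ZMOD T]) :
    fermionMode ℓ t T σ ρ e a c z j k = 0 := by
  rw [fermionMode, dif_neg fun h' => hk h'.cls, dif_neg, if_neg]
  · rintro ⟨rfl, rfl⟩
    exact hk (Int.modEq_iff_dvd.2 ⟨1, by have := he.class_eq; omega⟩)
  · intro h'
    have h1 := h.bar_class hη hτ h'.cls
    rw [h.invol, sub_sub_cancel] at h1
    exact hk h1

theorem IsFermion.trunc (hF : IsFermion s a c z) (j : J) :
    Trunc (fermionMode ℓ t T σ ρ e a c z j) := by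
  intro x
  obtain ⟨N, hN⟩ := ((hF.fin x).image fun p => p.1.2).bddAbove
  refine ⟨max (N + 1) (T + 1), fun k hk => ?_⟩
  have h1 : N + 1 ≤ k := (le_max_left _ _).trans hk
  have h2 : (T : ℤ) + 1 ≤ k := (le_max_right _ _).trans hk
  rw [fermionMode]
  split_ifs with h3 h4 h5
  · by_contra h6
    have := hN ⟨⟨(j, k), h3⟩, h6, rfl⟩
    dsimp only at this
    omega
  · have := h4.pos
    omega
  · omega
  · rfl

/-- Every pair of modes in the correct classes falls into one of nine cases, each kind being
annihilating, conjugate to annihilating or fixed. In each case the relation is one of the canonical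
anticommutation relations. -/
theorem IsFermion.isModeRep (hℓ : ℓ ≠ 0) (ht : t * t * ℓ = 2)
    (hη : IsPrimitiveRoot η T)
    (hτ : ∀ a b, B (τ a) (τ b) = B a b) (h : IsDualSystem B τ T η f σ ρ)
    (he : IsFixedMode T σ ρ e) (hF : IsFermion (zeroSign F e) a c z) (ht0 : t ≠ 0) :
    IsModeRep T B ℓ f (fun j => (ρ j : ℤ)) (fermionMode ℓ t T σ ρ e a c z) := by
  refine ⟨hF.trunc, fun j k hk => fermionMode_support hη hτ h he hk,
    fun i j hij => Int.modEq_zero_iff_dvd.2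
      (by exact_mod_cast dvd_of_isometry hη hτ (h.eig i) (h.eig j) hij), fun i j m n x hm => ?_⟩
  have hR : (if m + n + T = 0 then (ℓ * B (f i) (f j)) • x else 0) =
      if j = σ i ∧ m + n + T = 0 then ℓ • x else 0 := by
    by_cases h1 : j = σ i
    · subst h1
      simp [h.gram_self]
    · simp [h1, h.gram i j h1]
  rw [hR]
  have hbar : ∀ {p q : AnnihMode T σ ρ},
      ¬ (σ q.1.1 = σ (σ p.1.1) ∧ (-T - p.1.2) + (-T - q.1.2) + T = 0) := fun {p q} ⟨h3, h4⟩ =>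
    h.not_conj p.2 q.2 ⟨by rw [← h.invol q.1.1, h3, h.invol], by omega⟩
  have hconj : ∀ {p q : AnnihMode T σ ρ}, σ q.1.1 = σ p.1.1 ∧ p.1.2 + (-T - q.1.2) + T = 0 ↔
      p = q := by
    intro p q
    refine ⟨fun ⟨h3, h4⟩ => Subtype.ext (Prod.ext ?_ (by omega)), ?_⟩
    · rw [← h.invol p.1.1, ← h3, h.invol]
    · rintro rfl
      exact ⟨rfl, by ring⟩
  have hconj' : ∀ {p q : AnnihMode T σ ρ}, q.1.1 = σ (σ p.1.1) ∧ (-T - p.1.2) + q.1.2 + T = 0 ↔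
      p = q := by
    intro p q
    rw [h.invol]
    refine ⟨fun ⟨h3, h4⟩ => Subtype.ext (Prod.ext h3.symm (by omega)), ?_⟩
    rintro rfl
    exact ⟨rfl, by ring⟩
  by_cases hn : n ≡ ρ j [ZMOD T]
  swap
  · rw [fermionMode_support hη hτ h he hn, LinearMap.zero_apply, map_zero, LinearMap.zero_apply,
      add_zero, if_neg]
    rintro ⟨rfl, h1⟩
    have h2 := h.bar_class hη hτ hm
    rw [show -(T : ℤ) - m = n by omega] at h2
    exact hn h2
  have hfix : ∀ {e'}, e = some e' → ∀ (p : AnnihMode T σ ρ),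
      ¬ (e' = σ p.1.1 ∧ p.1.2 + -ρ e' + T = 0) ∧ ¬ (p.1.1 = σ e' ∧ -ρ e' + p.1.2 + T = 0) ∧
      ¬ (e' = σ (σ p.1.1) ∧ (-T - p.1.2) + -ρ e' + T = 0) ∧
      ¬ (σ p.1.1 = σ e' ∧ -ρ e' + (-T - p.1.2) + T = 0) := by
    rintro e' rfl p
    have h3 := he.class_eq
    have h4 := ((he e').2 rfl).2
    have h5 : σ p.1.1 = e' → p.1.1 = e' := fun h6 => by rw [← h.invol p.1.1, h6, h4]
    refine ⟨fun ⟨h6, h7⟩ => p.2.ne_fixed he ⟨h5 h6.symm, by omega⟩,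
      fun ⟨h6, h7⟩ => p.2.ne_fixed he ⟨h6.trans h4, by omega⟩,
      fun ⟨h6, h7⟩ => p.2.ne_fixed he ⟨by rw [h6, h.invol], by omega⟩,
      fun ⟨h6, h7⟩ => p.2.ne_fixed he ⟨h5 (h6.trans h4), by omega⟩⟩
  have hac : ∀ p q : AnnihMode T σ ρ,
      a p (ℓ • c q x) + ℓ • c q (a p x) = if p = q then ℓ • x else 0 := by
    intro p q
    rw [map_smul, ← smul_add]
    split_ifs with hpq
    · rw [hpq, hF.ac_self, sub_add_cancel]
    · rw [hF.ac p q hpq, neg_add_cancel, smul_zero]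
  rcases IsModeRep.op_cases hη hτ h he i m with h1 | ⟨p, rfl, rfl⟩ | ⟨p, rfl, rfl⟩ | ⟨rfl, rfl⟩
  · exact (h1 hm).elim
  all_goals
    rcases IsModeRep.op_cases hη hτ h he j n with h2 | ⟨q, rfl, rfl⟩ | ⟨q, rfl, rfl⟩ | ⟨h2, rfl⟩
  · exact (h2 hn).elim
  · rw [fermionMode_annih, fermionMode_annih, hF.aa, neg_add_cancel, if_neg (h.not_conj p.2 q.2)]
  · rw [fermionMode_annih, fermionMode_conj h, LinearMap.smul_apply, LinearMap.smul_apply, hac]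
    simp only [hconj]
  · subst h2
    rw [fermionMode_annih, fermionMode_fixed he, if_neg (hfix rfl p).1, LinearMap.smul_apply,
      LinearMap.smul_apply, hF.za, map_smul, zeroSign, neg_one_smul, smul_neg, add_neg_cancel]
  · exact (h2 hn).elim
  · rw [fermionMode_annih, fermionMode_conj h, LinearMap.smul_apply, LinearMap.smul_apply, add_comm,
      hac]
    simp only [hconj', eq_comm]
  · rw [fermionMode_conj h, fermionMode_conj h, if_neg hbar]
    simp only [LinearMap.smul_apply, map_smul]
    rw [hF.cc, smul_neg, smul_neg, neg_add_cancel]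
  · subst h2
    rw [fermionMode_conj h, fermionMode_fixed he, if_neg (hfix rfl p).2.2.1]
    simp only [LinearMap.smul_apply, map_smul]
    rw [hF.zc, zeroSign, neg_one_smul, smul_neg, smul_neg, smul_comm ℓ, add_neg_cancel]
  · exact (h2 hn).elim
  · rw [fermionMode_annih, fermionMode_fixed he, if_neg (hfix rfl q).2.1, LinearMap.smul_apply,
      LinearMap.smul_apply, hF.za, map_smul, zeroSign, neg_one_smul, smul_neg, neg_add_cancel]
  · rw [fermionMode_conj h, fermionMode_fixed he, if_neg (hfix rfl q).2.2.2]
    simp only [LinearMap.smul_apply, map_smul]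
    rw [hF.zc, zeroSign, neg_one_smul, smul_neg, smul_neg, smul_comm ℓ, neg_add_cancel]
  · obtain rfl := Option.some_injective _ h2
    have h3 := he.class_eq
    rw [fermionMode_fixed he, if_pos ⟨((he _).2 rfl).2.symm, by omega⟩]
    simp only [LinearMap.smul_apply, map_smul]
    rw [hF.zz, ← two_smul F, smul_smul, smul_smul, ← ht]
    congr 1
    field_simp

theorem annihOp_fermionMode :
    annihOp T σ ρ (fermionMode ℓ t T σ ρ e a c z) = a :=
  funext fermionMode_annih

theorem zeroOp_fermionMode (ht : t ≠ 0) (he : IsFixedMode T σ ρ e) (hz : e = none → z = 1) :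
    zeroOp t ρ (fermionMode ℓ t T σ ρ e a c z) e = z := by
  cases e with
  | none => exact (hz rfl).symm
  | some e' => rw [zeroOp, fermionMode_fixed he, smul_smul, mul_inv_cancel₀ ht, one_smul]

theorem IsFermion.reindex {I I' : Type*} {a c : I → Module.End F W} (hF : IsFermion s a c z)
    (g : I' ≃ I) : IsFermion s (a ∘ g) (c ∘ g) z where
  aa _ _ x := hF.aa _ _ x
  aa_self _ x := hF.aa_self _ x
  cc _ _ x := hF.cc _ _ x
  cc_self _ x := hF.cc_self _ x
  ac _ _ hij x := hF.ac _ _ (g.injective.ne hij) x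
  ac_self _ x := hF.ac_self _ x
  fin x := (hF.fin x).preimage g.injective.injOn
  za _ x := hF.za _ x
  zc _ x := hF.zc _ x
  zz := hF.zz

theorem vacuumSpace_reindex {I I' : Type*} (a : I → Module.End F W) (g : I' ≃ I) :
    vacuumSpace (a ∘ g) = vacuumSpace a := by
  ext x
  rw [mem_vacuumSpace, mem_vacuumSpace]
  exact g.forall_congr_left (p := fun i => a (g i) x = 0) |>.trans (by simp)

end Reconstruction

/-! ### Classification and complete reducibility of twisted modules -/

section Classification

variable {p : ℕ} [Fact p.Prime] {F : Type u} [Field F] {χ : ℤ_[p] →+* F}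
  {T : ℕ} {θ : ℤ_[p]} {W : Type w} [AddCommGroup W] [Module F W] {W' : Type w'} [AddCommGroup W']
  [Module F W'] {U : Type v} [AddCommGroup U] [Module F U] {B : LinearMap.BilinForm F U} {ℓ : F}
  {τ : U ≃ₗ[F] U} {η : F} {J : Type}
  {f : Module.Basis J F U} {σ : J → J} {ρ : J → ℕ} {e : Option J} {t : F}
  {V : Type*} [AddCommGroup V] [Module F V] {vac : V}
  {μ : ℤ → U →ₗ[F] Module.End F V} {par : ZMod 2 → Submodule F V} {g : Module.End F V}
  {𝒱 : VertexSuperalgebra F V}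

/-- The data that determine the twisted modules of a Clifford vertex superalgebra. -/
structure IsTwistedSetting (T : ℕ) (θ : ℤ_[p]) (B : LinearMap.BilinForm F U) (ℓ : F)
    (τ : U ≃ₗ[F] U) (η : F) (f : Module.Basis J F U) (σ : J → J) (ρ : J → ℕ) (e : Option J) (t : F)
    (vac : V) (μ : ℤ → U →ₗ[F] Module.End F V) (par : ZMod 2 → Submodule F V)
    (g : Module.End F V) (𝒱 : VertexSuperalgebra F V) : Prop where
  vacuum : IsVacuumModule B ℓ vac μ par
  vertex : IsCliffordVertex vac μ par 𝒱
  map_vac : g vac = vac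
  map_mode : ∀ a n v, g (μ n a v) = μ n (τ a) (g v)
  isometry : ∀ a b, B (τ a) (τ b) = B a b
  primitive : IsPrimitiveRoot η T
  inv : T * θ = 1
  pos : 0 < T
  dual : IsDualSystem B τ T η f σ ρ
  fixed : IsFixedMode T σ ρ e
  level : ℓ ≠ 0
  scale : t * t * ℓ = 2
  two : (2 : F) ≠ 0

/-- The modes of the generating fields of a twisted module. -/
def TwistedModule.modes (f : J → U) (vac : V) (μ : ℤ → U →ₗ[F] Module.End F V)
    (M : TwistedModule 𝒱 g T η W) (j : J) : ℤ → Module.End F W :=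
  M.YW (μ (-1) (f j) vac)

namespace IsTwistedSetting

theorem scale_ne (S : IsTwistedSetting T θ B ℓ τ η f σ ρ e t vac μ par g 𝒱) : t ≠ 0 := by
  rintro rfl
  exact S.two (by rw [← S.scale]; simp)

variable [CharP F p]

theorem isModeRep (χ : ℤ_[p] →+* F) (S : IsTwistedSetting T θ B ℓ τ η f σ ρ e t vac μ par g 𝒱)
    (M : TwistedModule 𝒱 g T η W) :
    IsModeRep T B ℓ f (fun j => (ρ j : ℤ)) (M.modes f vac μ) :=
  M.isModeRep χ S.vacuum S.vertex S.map_vac S.map_mode S.dual.eig S.isometry S.primitive S.dual.lt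
    S.inv

theorem isVertexMap (χ : ℤ_[p] →+* F) (S : IsTwistedSetting T θ B ℓ τ η f σ ρ e t vac μ par g 𝒱)
    (M : TwistedModule 𝒱 g T η W) :
    IsVertexMap χ T θ f (fun j => ρ j) (M.modes f vac μ) vac μ par M.YW :=
  M.isVertexMap χ S.vacuum S.vertex S.map_vac S.map_mode S.dual.eig S.dual.lt S.inv

variable [LinearOrder J]

theorem isSub_iff (χ : ℤ_[p] →+* F) (S : IsTwistedSetting T θ B ℓ τ η f σ ρ e t vac μ par g 𝒱)
    (M : TwistedModule 𝒱 g T η W) (N : Submodule F W) :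
    M.IsSub N ↔ IsStable (annihOp T σ ρ (M.modes f vac μ))
      (creatOp ℓ T σ ρ (M.modes f vac μ)) (zeroOp t ρ (M.modes f vac μ) e) N :=
  (TwistedModule.isSub_iff S.vacuum S.inv S.pos (S.isVertexMap χ M) N).trans
    ((S.isModeRep χ M).isStable_iff S.level S.scale_ne S.primitive S.isometry S.dual S.fixed N)

theorem isomorphic_iff (χ : ℤ_[p] →+* F)
    (S : IsTwistedSetting T θ B ℓ τ η f σ ρ e t vac μ par g 𝒱)
    (M : TwistedModule 𝒱 g T η W) (M' : TwistedModule 𝒱 g T η W') :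
    M.Isomorphic M' ↔ ∃ E : W ≃ₗ[F] W',
      (∀ q x, E (annihOp T σ ρ (M.modes f vac μ) q x) =
        annihOp T σ ρ (M'.modes f vac μ) q (E x)) ∧
      (∀ q x, E (creatOp ℓ T σ ρ (M.modes f vac μ) q x) =
        creatOp ℓ T σ ρ (M'.modes f vac μ) q (E x)) ∧
      ∀ x, E (zeroOp t ρ (M.modes f vac μ) e x) = zeroOp t ρ (M'.modes f vac μ) e (E x) :=
  (TwistedModule.isomorphic_iff S.vacuum S.inv S.pos (S.isVertexMap χ M)
    (S.isVertexMap χ M')).trans (exists_congr fun E => (S.isModeRep χ M).intertwine_iff S.level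
      S.scale_ne S.primitive S.isometry S.dual S.fixed (S.isModeRep χ M') E)

variable [Finite J]

theorem isFermion (χ : ℤ_[p] →+* F) (S : IsTwistedSetting T θ B ℓ τ η f σ ρ e t vac μ par g 𝒱)
    (M : TwistedModule 𝒱 g T η W) :
    IsFermion (zeroSign F e) (annihOp T σ ρ (M.modes f vac μ))
      (creatOp ℓ T σ ρ (M.modes f vac μ)) (zeroOp t ρ (M.modes f vac μ) e) :=
  (S.isModeRep χ M).isFermion S.two S.level S.scale S.primitive S.isometry S.dual S.fixed

theorem isCompletelyReducible (χ : ℤ_[p] →+* F)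
    (S : IsTwistedSetting T θ B ℓ τ η f σ ρ e t vac μ par g 𝒱) (M : TwistedModule 𝒱 g T η W) :
    M.IsCompletelyReducible := by
  obtain ⟨ι, N, h1, h2, h3⟩ := (S.isFermion χ M).exists_decomposition
    (by cases e <;> simp [zeroSign]) S.two
  refine ⟨ι, N, fun i => ⟨(S.isSub_iff χ M _).2 (h1 i).1, (h1 i).2.1, fun N' hle hN' =>
    (h1 i).2.2 N' hle ((S.isSub_iff χ M _).1 hN')⟩, h2, h3⟩

theorem exists_vacuum (χ : ℤ_[p] →+* F)
    (S : IsTwistedSetting T θ B ℓ τ η f σ ρ e t vac μ par g 𝒱) {M : TwistedModule 𝒱 g T η W}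
    (hM : M.IsIrreducible) : ∃ ω : W, ω ≠ 0 ∧
      vacuumSpace (annihOp T σ ρ (M.modes f vac μ)) = F ∙ ω ∧
      (zeroOp t ρ (M.modes f vac μ) e ω = ω ∨ zeroOp t ρ (M.modes f vac μ) e ω = -ω) :=
  (S.isFermion χ M).exists_vacuum (by cases e <;> simp [zeroSign]) S.two hM.2.1
    fun N hN => hM.2.2 N le_top ((S.isSub_iff χ M _).2 hN)

/-- A mode representation is realized by a twisted module. -/
theorem exists_module (S : IsTwistedSetting T θ B ℓ τ η f σ ρ e t vac μ par g 𝒱)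
    (hΨ : ∀ A : J → ℤ → Module.End F W, IsModeRep T B ℓ f (fun j => (ρ j : ℤ)) A →
      ∃ Ψ : V →ₗ[F] ZMod 2 → ℤ → Module.End F W,
        IsFieldMap χ T θ f (fun j => (ρ j : ℤ)) A vac μ Ψ)
    {a c : AnnihMode T σ ρ → Module.End F W} {z : Module.End F W}
    (hF : IsFermion (zeroSign F e) a c z) (hz : e = none → z = 1) {ω : W} (hω0 : ω ≠ 0)
    (hω : vacuumSpace a = F ∙ ω) :
    ∃ M : TwistedModule 𝒱 g T η W, M.IsIrreducible ∧
      vacuumSpace (annihOp T σ ρ (M.modes f vac μ)) = F ∙ ω ∧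
      zeroOp t ρ (M.modes f vac μ) e = z := by
  have hA := hF.isModeRep S.level S.scale S.primitive S.isometry S.dual S.fixed S.scale_ne
  obtain ⟨Ψ, hΨ⟩ := hΨ _ hA
  obtain ⟨M, hM⟩ := exists_twistedModule S.vacuum S.vertex S.map_vac S.map_mode S.dual.eig
    S.primitive S.inv S.pos hA hΨ
  have hM' : M.modes f vac μ = fermionMode ℓ t T σ ρ e a c z := funext hM
  have h1 : vacuumSpace (annihOp T σ ρ (M.modes f vac μ)) = F ∙ ω := by
    rw [hM', annihOp_fermionMode, hω]
  refine ⟨M, ⟨fun _ _ _ _ => trivial, fun h2 => ?_, fun N _ hN => ?_⟩, h1, ?_⟩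
  · exact hω0 ((Submodule.eq_bot_iff _).1 h2 ω trivial)
  · exact (S.isFermion χ M).irreducible h1 N ((S.isSub_iff χ M N).1 hN)
  · rw [hM', zeroOp_fermionMode S.scale_ne S.fixed hz]

theorem isomorphic (χ : ℤ_[p] →+* F) (S : IsTwistedSetting T θ B ℓ τ η f σ ρ e t vac μ par g 𝒱)
    {M : TwistedModule 𝒱 g T η W} {M' : TwistedModule 𝒱 g T η W'} {ω : W} {ω' : W'}
    (hω0 : ω ≠ 0) (hω0' : ω' ≠ 0) (hω : vacuumSpace (annihOp T σ ρ (M.modes f vac μ)) = F ∙ ω)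
    (hω' : vacuumSpace (annihOp T σ ρ (M'.modes f vac μ)) = F ∙ ω') {ε : F}
    (hz : zeroOp t ρ (M.modes f vac μ) e ω = ε • ω)
    (hz' : zeroOp t ρ (M'.modes f vac μ) e ω' = ε • ω') : M.Isomorphic M' :=
  (S.isomorphic_iff χ M M').2 ((S.isFermion χ M).exists_equiv (S.isFermion χ M') hω0 hω0' hω hω'
    hz hz')

theorem existsUnique_irreducible (S : IsTwistedSetting T θ B ℓ τ η f σ ρ none t vac μ par g 𝒱)
    (hΨ : ∀ (W : Type (max u v)) [AddCommGroup W] [Module F W] (A : J → ℤ → Module.End F W),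
      IsModeRep T B ℓ f (fun j => (ρ j : ℤ)) A →
      ∃ Ψ : V →ₗ[F] ZMod 2 → ℤ → Module.End F W,
        IsFieldMap χ T θ f (fun j => (ρ j : ℤ)) A vac μ Ψ) :
    ∃ (W : Type (max u v)) (_ : AddCommGroup W) (_ : Module F W) (M : TwistedModule 𝒱 g T η W),
      M.IsIrreducible ∧ ∀ (W' : Type w) [AddCommGroup W'] [Module F W']
        (M' : TwistedModule 𝒱 g T η W'), M'.IsIrreducible → M'.Isomorphic M := by
  -- The index type is lifted only to place the model in the universe `max u v`.
  have hF := (isFermion_model_one F (ULift.{v} (AnnihMode T σ ρ))).reindex Equiv.ulift.symm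
  obtain ⟨M, hM, h1, h2⟩ := S.exists_module (hΨ _) hF (fun _ => rfl) one_ne_zero
    ((vacuumSpace_reindex _ _).trans (vacuumSpace_model F _))
  refine ⟨_, _, _, M, hM, fun W' _ _ M' hM' => ?_⟩
  obtain ⟨ω, hω0, hω, -⟩ := S.exists_vacuum χ hM'
  exact S.isomorphic χ hω0 one_ne_zero hω h1 (ε := 1) (one_smul F ω).symm (one_smul F _).symm

/-- The zero mode acts on the model as `ε` times the parity operator, with `ε = 1` or `ε = -1`. Its
eigenvalue on the vacuum line is an invariant, and it separates the two modules as `2` is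
invertible. -/
theorem exists_two_irreducible {e : J}
    (S : IsTwistedSetting T θ B ℓ τ η f σ ρ (some e) t vac μ par g 𝒱)
    (hΨ : ∀ (W : Type (max u v)) [AddCommGroup W] [Module F W] (A : J → ℤ → Module.End F W),
      IsModeRep T B ℓ f (fun j => (ρ j : ℤ)) A →
      ∃ Ψ : V →ₗ[F] ZMod 2 → ℤ → Module.End F W,
        IsFieldMap χ T θ f (fun j => (ρ j : ℤ)) A vac μ Ψ) :
    ∃ (W₁ : Type (max u v)) (_ : AddCommGroup W₁) (_ : Module F W₁)
      (M₁ : TwistedModule 𝒱 g T η W₁)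
      (W₂ : Type (max u v)) (_ : AddCommGroup W₂) (_ : Module F W₂)
      (M₂ : TwistedModule 𝒱 g T η W₂),
      M₁.IsIrreducible ∧ M₂.IsIrreducible ∧ ¬ M₁.Isomorphic M₂ ∧
      ∀ (W' : Type w) [AddCommGroup W'] [Module F W'] (M' : TwistedModule 𝒱 g T η W'),
        M'.IsIrreducible → M'.Isomorphic M₁ ∨ M'.Isomorphic M₂ := by
  have key : ∀ ε : F, ε * ε = 1 →
      ∃ M : TwistedModule 𝒱 g T η (FermionModel F (ULift.{v} (AnnihMode T σ ρ))),
        M.IsIrreducible ∧ vacuumSpace (annihOp T σ ρ (M.modes f vac μ)) =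
          F ∙ (1 : FermionModel F (ULift.{v} (AnnihMode T σ ρ))) ∧
        zeroOp t ρ (M.modes f vac μ) (some e) 1 = ε • 1 := by
    intro ε hε
    obtain ⟨M, hM, h1, h2⟩ := S.exists_module (hΨ _)
      ((isFermion_model_parity hε).reindex Equiv.ulift.symm) nofun one_ne_zero
      ((vacuumSpace_reindex _ _).trans (vacuumSpace_model F _))
    exact ⟨M, hM, h1, by rw [h2, LinearMap.smul_apply, modelParity_one]⟩
  obtain ⟨M₁, hM₁, h1, h1'⟩ := key 1 (one_mul 1)
  obtain ⟨M₂, hM₂, h2, h2'⟩ := key (-1) (by simp)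
  refine ⟨_, _, _, M₁, _, _, _, M₂, hM₁, hM₂, fun hiso => ?_, fun W' _ _ M' hM' => ?_⟩
  · obtain ⟨E, hE, -, hE'⟩ := (S.isomorphic_iff χ M₁ M₂).1 hiso
    have h3 : E 1 ∈ vacuumSpace (annihOp T σ ρ (M₂.modes f vac μ)) := mem_vacuumSpace.2 fun q => by
      rw [← hE, mem_vacuumSpace.1 (h1 ▸ Submodule.mem_span_singleton_self _) q, map_zero]
    rw [h2] at h3
    obtain ⟨r, hr⟩ := Submodule.mem_span_singleton.1 h3
    have h4 := hE' 1
    rw [h1', one_smul, ← hr, map_smul, h2', ← sub_eq_zero, neg_one_smul, smul_neg, sub_neg_eq_add,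
      ← two_smul F, hr] at h4
    have h5 := (smul_eq_zero.1 h4).resolve_left S.two
    exact one_ne_zero (E.map_eq_zero_iff.1 h5)
  · obtain ⟨ω, hω0, hω, h3 | h3⟩ := S.exists_vacuum χ hM'
    · exact Or.inl (S.isomorphic χ hω0 one_ne_zero hω h1 (ε := 1) (by rw [h3, one_smul]) h1')
    · exact Or.inr (S.isomorphic χ hω0 one_ne_zero hω h2 (ε := -1) (by rw [h3, neg_one_smul]) h2')

end IsTwistedSetting

end Classification

end ModularClifford

end

open ModularClifford

/-! ### The main theorem -/

theorem mainTheorem10 (p : ℕ) [Fact p.Prime] (hp : 2 < p)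
    (F : Type u) [Field F] [IsAlgClosed F] [CharP F p]
    (U : Type v) [AddCommGroup U] [Module F U] [FiniteDimensional F U]
    (B : LinearMap.BilinForm F U) (hBsymm : B.IsSymm) (hBnondeg : B.Nondegenerate)
    (τ : U ≃ₗ[F] U) (hτ : ∀ a b, B (τ a) (τ b) = B a b)
    (T : ℕ) (hT : 0 < T) (hTp : T.Coprime p) (hτT : τ ^ T = 1)
    (η : F) (hη : IsPrimitiveRoot η T) (ℓ : F) (hℓ : ℓ ≠ 0) :
    ∃ 𝒱 : VertexSuperalgebra F (VacuumModule B ℓ),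
      IsCliffordStructure B ℓ 𝒱 ∧
      (∀ 𝒱' : VertexSuperalgebra F (VacuumModule B ℓ), IsCliffordStructure B ℓ 𝒱' → 𝒱' = 𝒱) ∧
      ((Odd T ∨ (Even T ∧
          Even (Module.finrank F (Module.End.eigenspace τ.toLinearMap (η ^ (T / 2)))))) →
        ∃ (W : Type (max u v)) (_ : AddCommGroup W) (_ : Module F W)
          (M : TwistedModule 𝒱 (vacuumMap B ℓ τ hτ) T η W),
          M.IsIrreducible ∧
          ∀ (W' : Type w) [AddCommGroup W'] [Module F W']
            (M' : TwistedModule 𝒱 (vacuumMap B ℓ τ hτ) T η W'),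
            M'.IsIrreducible → M'.Isomorphic M) ∧
      ((Even T ∧
          Odd (Module.finrank F (Module.End.eigenspace τ.toLinearMap (η ^ (T / 2))))) →
        ∃ (W₁ : Type (max u v)) (_ : AddCommGroup W₁) (_ : Module F W₁)
          (M₁ : TwistedModule 𝒱 (vacuumMap B ℓ τ hτ) T η W₁)
          (W₂ : Type (max u v)) (_ : AddCommGroup W₂) (_ : Module F W₂)
          (M₂ : TwistedModule 𝒱 (vacuumMap B ℓ τ hτ) T η W₂),
          M₁.IsIrreducible ∧ M₂.IsIrreducible ∧ ¬ M₁.Isomorphic M₂ ∧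
          ∀ (W' : Type w) [AddCommGroup W'] [Module F W']
            (M' : TwistedModule 𝒱 (vacuumMap B ℓ τ hτ) T η W'),
            M'.IsIrreducible → M'.Isomorphic M₁ ∨ M'.Isomorphic M₂) ∧
      (∀ (W : Type w) [AddCommGroup W] [Module F W]
        (M : TwistedModule 𝒱 (vacuumMap B ℓ τ hτ) T η W), M.IsCompletelyReducible) := by
  have h2 : (2 : F) ≠ 0 := Ring.two_ne_zero (by rw [ringChar.eq F p]; omega)
  have hT' : (T : F) ≠ 0 := fun h0 => by
    rw [CharP.cast_eq_zero_iff F p] at h0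
    exact (Fact.out : p.Prime).one_lt.ne'
      (Nat.dvd_one.1 (by rw [← hTp]; exact Nat.dvd_gcd h0 dvd_rfl))
  let χ : ℤ_[p] →+* F := (ZMod.castHom dvd_rfl F).comp PadicInt.toZMod
  obtain ⟨θ, hθ⟩ : ∃ θ : ℤ_[p], (T : ℤ_[p]) * θ = 1 := by
    have h1 : IsUnit (T : ℤ_[p]) := by
      rw [PadicInt.isUnit_iff, PadicInt.norm_natCast_eq_one_iff]
      exact hTp.symm
    exact h1.exists_right_inv
  obtain ⟨J, hJ, f, σ, ρ, hdual, hone⟩ :=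
    exists_isDualSystem h2 hBsymm hBnondeg hτ hT hT' hη hτT
  -- An arbitrary order; it only decides which of two distinct conjugate modes with `2 k = -T`
  -- counts as annihilating.
  let _ : LinearOrder J := LinearOrder.lift' (Fintype.equivFin J) (Fintype.equivFin J).injective
  obtain ⟨t, ht⟩ := IsAlgClosed.exists_pow_nat_eq (2 * ℓ⁻¹) (n := 2) (by norm_num)
  have ht' : t * t * ℓ = 2 := by rw [← sq, ht, mul_assoc, inv_mul_cancel₀ hℓ, mul_one]
  have hV := isVacuumModule B ℓ
  obtain ⟨Ψ, hΨ⟩ := exists_isFieldMap (χ := χ) (T := 1) (θ := 1) hBsymm (by simp) one_pos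
    (hV.isModeRep f)
  obtain ⟨𝒱, h𝒱⟩ := exists_isCliffordVertex hV hΨ
  have S : ∀ e, IsFixedMode T σ ρ e → IsTwistedSetting T θ B ℓ τ η f σ ρ e t (vacuumVector B ℓ)
      (vacMode B ℓ) (vacuumParity B ℓ) (vacuumMap B ℓ τ hτ) 𝒱 := fun e he =>
    ⟨hV, h𝒱, vacuumMap_vacuumVector τ hτ, vacuumMap_vacMode τ hτ, hτ, hη, hθ, hT, hdual, he, hℓ,
      ht', h2⟩
  have hfix : ∀ e, 2 * ρ e = T ∧ σ e = e → IsFixedMode T σ ρ (some e) := fun e he j =>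
    ⟨fun hj => congrArg some (hone e j he.1 hj.1 he.2 hj.2), fun h1 => by
      rwa [← Option.some_injective _ h1]⟩
  have hfix' : (¬ ∃ e, 2 * ρ e = T ∧ σ e = e) → IsFixedMode T σ ρ none := fun h j =>
    ⟨fun hj => (h ⟨j, hj⟩).elim, nofun⟩
  refine ⟨𝒱, (isCliffordStructure_iff 𝒱).2 h𝒱, fun 𝒱' h𝒱' =>
    ((isCliffordStructure_iff 𝒱').1 h𝒱').unique χ f hV h𝒱, fun h => ?_, fun h => ?_, ?_⟩
  · have hno : ¬ ∃ e, 2 * ρ e = T ∧ σ e = e := by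
      rcases h with h | ⟨h, h'⟩
      · rintro ⟨e, he, -⟩
        exact Nat.not_even_iff_odd.2 h ⟨ρ e, by omega⟩
      · rw [← hdual.odd_finrank_iff hT hη hτ hone h, Nat.not_odd_iff_even]
        exact h'
    exact (S none (hfix' hno)).existsUnique_irreducible (χ := χ) fun W _ _ A hA =>
      exists_isFieldMap hBsymm hθ hT hA
  · obtain ⟨e, he⟩ := (hdual.odd_finrank_iff hT hη hτ hone h.1).1 h.2
    exact (S (some e) (hfix e he)).exists_two_irreducible (χ := χ) fun W _ _ A hA =>
      exists_isFieldMap hBsymm hθ hT hA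
  · intro W _ _ M
    by_cases h : ∃ e, 2 * ρ e = T ∧ σ e = e
    · obtain ⟨e, he⟩ := h
      exact (S (some e) (hfix e he)).isCompletelyReducible χ M
    · exact (S none (hfix' h)).isCompletelyReducible χ M
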